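/- **Theorem ($L^2$-error estimates).** Let $L,T>0$, and let $y$ be a random variable with a beta distribution, with any positive parameters, rescaled to $(-1,1)$; write $\mathbb E$ for the expectation over $y$, and let $P_0,P_1,\dots$ be the corresponding orthonormal polynomials, $\deg P_n=n$ and $\mathbb E[P_nP_l]=\delta_{nl}$. Let $c$ be measurable with $|c|\le M$ on $(-1,1)$. Let $u(x,t;y)$ be an $L$-periodic (in $x$) weak solution of $u_t=c(y)\,u_x$ on $[0,T]$ for almost every $y$, square integrable in $(x,y)\in\Omega_x\times(-1,1)$ at each time, where $\Omega_x=[0,L]$; let $\hat u_n(x,t)=\mathbb E[u(x,t;\cdot)P_n]$ be its exact gPC coefficients. For $N\ge 0$ let $\mathbf v=(\hat v_0,\dots,\hat v_N)^\top$ be the $L$-periodic weak solution of the Galerkin system $\mathbf v_t=A\mathbf v_x$, $A=(a_{nl})$, $a_{nl}=\mathbb E[c\,P_nP_l]$, $0\le n,l\le N$, with $\hat v_n(\cdot,0)=\hat u_n(\cdot,0)$, and assume that $\hat v_n(\cdot,t)$ lies in the periodic Sobolev space $H^{k+2}(\Omega_x)$ for $n=0,\dots,N$ and $t\in[0,T]$,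 where $k\ge0$. Let $S$ be orthogonal with $S^\top AS=\operatorname{diag}(\lambda_0,\dots,\lambda_N)$ and put $\mathbf q=S^\top\mathbf v$, so that $\partial_t q_n=\lambda_n\partial_x q_n$. Let $\{I_i\}$ be any partition of $[0,L]$ into cells of maximal length $h$, and let $q_{n,h}(\cdot,t)$, which is on every $I_i=[x_{i-1/2},x_{i+1/2}]$ a polynomial of degree at most $k$, be the periodic semidiscrete DG approximation of $q_n$: $$\int_{I_i}(q_{n,h})_t\varphi\,dx=\widetilde{\lambda_n q_{n,h}}\,\varphi\Big|_{x_{i+1/2}}-\widetilde{\lambda_n q_{n,h}}\,\varphi\Big|_{x_{i-1/2}}-\lambda_n\int_{I_i}q_{n,h}\varphi_x\,dx\qquad\text{for all polynomials }\varphi\text{ with }\deg\varphi\le k,$$ with the upwind flux ($\widetilde{\lambda_n q_{n,h}}=\lambda_nq_{n,h}^-$ if $\lambda_n\le0$, and $\lambda_nq_{n,h}^+$ if $\lambda_n>0$) and with $q_{n,h}(\cdot,0)$ the $L^2$-projection of $q_n(\cdot,0)$. Put $(\hat v_{0,h},\dots,\hat v_{N,h})^\top=S\mathbf q_h$ and $v_h(x,t;y)=\sum_{n=0}^N\hat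 v_{n,h}(x,t)P_n(y)$. Write $|f|_{H^{s}}=\|\partial_x^{s}f\|_{L^2(\Omega_x)}$ for the Sobolev seminorm and $|\mathbf v(\cdot,0)|^2_{H^{k+2}}=\sum_{n=0}^N|\hat v_n(\cdot,0)|^2_{H^{k+2}}$. Then there is a constant $C>0$, depending only on $k$, $T$, $L$ and $M$ (which bounds the speeds $|\lambda_n|$ in the numerical flux), such that the following holds. 1. For all $t\in[0,T]$ and $0\le n\le N$, $$\|(q_n-q_{n,h})(\cdot,t)\|_{L^2(\Omega_x)}\le C\,|q_n(\cdot,0)|_{H^{k+2}}\,h^{k+1},\qquad \|(\hat v_n-\hat v_{n,h})(\cdot,t)\|_{L^2(\Omega_x)}\le C\,|\mathbf v(\cdot,0)|_{H^{k+2}}\,h^{k+1}.$$ 2. Suppose moreover that there are $m>0$, $n_0\ge 0$ and $K_0$ with $\hat u_n(\cdot,t)\in H^1(\Omega_x)$ and $\|\hat u_n(\cdot,t)\|^2_{H^1(\Omega_x)}\le K_0\,n^{-2m}$ for all $n>n_0$ and $t\in[0,T]$. Then for every $t_0\in(0,T]$ there is a constant $K>0$, independent of $N$, of $k$, of the mesh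 and of $t$, such that for all $N\ge1$ and all $t\in[t_0,T]$ $$\mathbb E\big[\|(u-v_h)(\cdot,t;\cdot)\|^2_{L^2(\Omega_x)}\big]\le C\,|\mathbf v(\cdot,0)|^2_{H^{k+2}}\,h^{2(k+1)}+\frac{K\,t}{N^{2m-1}}.$$ -/

import Mathlib

open MeasureTheory Set
open scoped ContDiff Matrix Polynomial

noncomputable section

namespace DGgPC

/-! ### Periodic function spaces on the torus of length `L`

Functions on the periodic domain `[0, L]` are modelled as `L`-periodic functions on the line. -/

/-- `f` is `L`-periodic and square integrable over one period. -/
def PerL2 (L : ℝ) (f : ℝ → ℝ) : Prop :=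
  Function.Periodic f L ∧ MemLp f 2 (volume.restrict (Ioc 0 L))

/-- `g` is the weak (distributional) derivative of order `j` of `f` on the line. -/
def IsWeakDeriv (j : ℕ) (f g : ℝ → ℝ) : Prop :=
  ∀ φ : ℝ → ℝ, ContDiff ℝ ∞ φ → HasCompactSupport φ →
    ∫ x, f x * iteratedDeriv j φ x = (-1) ^ j * ∫ x, g x * φ x

/-- The periodic Sobolev space `H^s`: the weak derivatives of order at most `s` of the periodic
function `f` exist and are periodic and square integrable over a period. -/
def PerSobolev (L : ℝ) (s : ℕ) (f : ℝ → ℝ) : Prop :=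
  PerL2 L f ∧ ∀ j ≤ s, ∃ g, PerL2 L g ∧ IsWeakDeriv j f g

open Classical in
/-- The weak derivative of order `j` (unique almost everywhere; zero if there is none). -/
def weakDeriv (L : ℝ) (j : ℕ) (f : ℝ → ℝ) : ℝ → ℝ :=
  if H : ∃ g, PerL2 L g ∧ IsWeakDeriv j f g then H.choose else 0

/-- The norm of `L²(0, L)`. -/
def l2Norm (L : ℝ) (f : ℝ → ℝ) : ℝ := Real.sqrt (∫ x in (0 : ℝ)..L, f x ^ 2)

/-- The Sobolev seminorm `|f|_{H^s}`: the `L²` norm of the weak derivative of order `s`. -/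
def semi (L : ℝ) (s : ℕ) (f : ℝ → ℝ) : ℝ := l2Norm L (weakDeriv L s f)

/-- The square of the norm of `H^1(0, L)`. -/
def h1NormSq (L : ℝ) (f : ℝ → ℝ) : ℝ := l2Norm L f ^ 2 + semi L 1 f ^ 2

/-- The Sobolev seminorm of a vector-valued function. -/
def vecSemi {ι : Type} [Fintype ι] (L : ℝ) (s : ℕ) (f : ι → ℝ → ℝ) : ℝ :=
  Real.sqrt (∑ n, semi L s (f n) ^ 2)

/-! ### The random variable and the orthonormal polynomials -/

/-- The beta distribution, rescaled from `(0, 1)` to `(-1, 1)`. -/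
def yLaw (α β : ℝ) : Measure ℝ :=
  (ProbabilityTheory.betaMeasure α β).map (fun z => 2 * z - 1)

/-- `P` is the system of orthonormal polynomials of `μ` (the normalized Jacobi polynomials if `μ`
is a beta distribution); the conditions determine every `P n` up to its sign. -/
def IsOrthonormalPolynomials (μ : Measure ℝ) (P : ℕ → ℝ[X]) : Prop :=
  (∀ n, (P n).natDegree = n) ∧
    ∀ n l, ∫ y, (P n).eval y * (P l).eval y ∂μ = if n = l then 1 else 0

/-! ### The model equation, its gPC coefficients and the Galerkin system -/

/-- `w t x` is an `L`-periodic weak solution of `w_t = a w_x` on `[0, T]`: the moment against every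
smooth periodic test function is differentiable in time, with the derivative that the equation
dictates after an integration by parts in `x`. -/
def IsTransportSolution (L T a : ℝ) (w : ℝ → ℝ → ℝ) : Prop :=
  (∀ t ∈ Icc 0 T, PerL2 L (w t)) ∧
    ∀ φ : ℝ → ℝ, ContDiff ℝ ∞ φ → Function.Periodic φ L → ∀ t ∈ Icc 0 T,
      HasDerivWithinAt (fun s => ∫ x in (0 : ℝ)..L, w s x * φ x)
        (-(a * ∫ x in (0 : ℝ)..L, w t x * deriv φ x)) (Icc 0 T) t

/-- `w n t x` is an `L`-periodic weak solution of the system `w_t = A w_x` on `[0, T]`, in the same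
sense as for the scalar equation. -/
def IsSystemSolution {ι : Type} [Fintype ι] (L T : ℝ) (A : Matrix ι ι ℝ)
    (w : ι → ℝ → ℝ → ℝ) : Prop :=
  (∀ n, ∀ t ∈ Icc 0 T, PerL2 L (w n t)) ∧
    ∀ φ : ℝ → ℝ, ContDiff ℝ ∞ φ → Function.Periodic φ L → ∀ n, ∀ t ∈ Icc 0 T,
      HasDerivWithinAt (fun s => ∫ x in (0 : ℝ)..L, w n s x * φ x)
        (-∑ l, A n l * ∫ x in (0 : ℝ)..L, w l t x * deriv φ x) (Icc 0 T) t

/-- `u x t y` solves `u_t = c(y) u_x` with periodic boundary conditions on `[0, T]` for almost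
every value `y` of the random variable, and is square integrable in `(x, y)` at every time. -/
def IsModelSolution (L T : ℝ) (μ : Measure ℝ) (c : ℝ → ℝ) (u : ℝ → ℝ → ℝ → ℝ) : Prop :=
  (∀ᵐ y ∂μ, IsTransportSolution L T (c y) (fun t x => u x t y)) ∧
    ∀ t ∈ Icc 0 T, MemLp (fun p : ℝ × ℝ => u p.1 t p.2) 2 ((volume.restrict (Ioc 0 L)).prod μ)

/-- The exact gPC coefficient `û_n(x, t) = E[u(x, t; ·) P_n]`. -/
def gpcCoeff (μ : Measure ℝ) (P : ℕ → ℝ[X]) (u : ℝ → ℝ → ℝ → ℝ) (n : ℕ) (t x : ℝ) : ℝ :=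
  ∫ y, u x t y * (P n).eval y ∂μ

/-- The decay condition: `‖û_n(·, t)‖²_{H^1} ≤ K₀ / n^{2m}` for `n > n₀` and `t ∈ [0, T]`. -/
def DecayCondition (L T : ℝ) (μ : Measure ℝ) (P : ℕ → ℝ[X]) (u : ℝ → ℝ → ℝ → ℝ)
    (m : ℝ) (n₀ : ℕ) (K₀ : ℝ) : Prop :=
  ∀ n > n₀, ∀ t ∈ Icc 0 T, PerSobolev L 1 (gpcCoeff μ P u n t) ∧
    h1NormSq L (gpcCoeff μ P u n t) ≤ K₀ / (n : ℝ) ^ (2 * m)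

/-- The matrix `A = (a_{n,l})` with `a_{n,l} = E[c P_n P_l]`, for `0 ≤ n, l ≤ N`. -/
def gpcMatrix (μ : Measure ℝ) (c : ℝ → ℝ) (P : ℕ → ℝ[X]) (N : ℕ) :
    Matrix (Fin (N + 1)) (Fin (N + 1)) ℝ :=
  Matrix.of fun n l => ∫ y, c y * (P n).eval y * (P l).eval y ∂μ

/-! ### The discontinuous Galerkin method -/

/-- A partition of `[0, L]` into `last + 1` cells of positive length. -/
structure Mesh (L : ℝ) where
  last : ℕ
  node : Fin (last + 2) → ℝ
  strictMono : StrictMono node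
  node_first : node 0 = 0
  node_last : node (Fin.last (last + 1)) = L

namespace Mesh

variable {L : ℝ} (𝒯 : Mesh L)

/-- The left endpoint of a cell. -/
def left (i : Fin (𝒯.last + 1)) : ℝ := 𝒯.node i.castSucc

/-- The right endpoint of a cell. -/
def right (i : Fin (𝒯.last + 1)) : ℝ := 𝒯.node i.succ

/-- The mesh size `h`, the largest length of a cell. -/
def size : ℝ := Finset.univ.sup' Finset.univ_nonempty fun i => 𝒯.right i - 𝒯.left i

/-- A broken polynomial is given by one polynomial on each cell. -/
abbrev Broken : Type := Fin (𝒯.last + 1) → ℝ[X]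

/-- The function on `[0, L)` that a broken polynomial represents. -/
def toFun (p : 𝒯.Broken) (x : ℝ) : ℝ :=
  ∑ i, (Ico (𝒯.left i) (𝒯.right i)).indicator (fun z => (p i).eval z) x

/-- The upwind flux for `q_t = a q_x` at the right endpoint of the cell `i`. The addition on
`Fin` is cyclic, so that the cell after the last one is the first one (periodicity). -/
def flux (a : ℝ) (p : 𝒯.Broken) (i : Fin (𝒯.last + 1)) : ℝ :=
  if a ≤ 0 then a * (p i).eval (𝒯.right i) else a * (p (i + 1)).eval (𝒯.left (i + 1))

end Mesh

/-- `q t` is the semidiscrete DG approximation of degree `k` with upwind flux, on the mesh `𝒯`, for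
the periodic problem `q_t = a q_x`, started from the `L²` projection of `q₀`. -/
structure IsDGSolution {L : ℝ} (T : ℝ) (k : ℕ) (𝒯 : Mesh L) (a : ℝ) (q₀ : ℝ → ℝ)
    (q : ℝ → 𝒯.Broken) : Prop where
  degree : ∀ t ∈ Icc 0 T, ∀ i, (q t i).natDegree ≤ k
  scheme : ∀ t ∈ Icc 0 T, ∀ i, ∀ φ : ℝ[X], φ.natDegree ≤ k →
    HasDerivWithinAt (fun s => ∫ x in 𝒯.left i..𝒯.right i, (q s i).eval x * φ.eval x)
      (𝒯.flux a (q t) i * φ.eval (𝒯.right i) - 𝒯.flux a (q t) (i - 1) * φ.eval (𝒯.left i)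
        - a * ∫ x in 𝒯.left i..𝒯.right i, (q t i).eval x * φ.derivative.eval x) (Icc 0 T) t
  initial : ∀ i, ∀ φ : ℝ[X], φ.natDegree ≤ k →
    ∫ x in 𝒯.left i..𝒯.right i, (q 0 i).eval x * φ.eval x =
      ∫ x in 𝒯.left i..𝒯.right i, q₀ x * φ.eval x

/-- The characteristic variables `Sᵀ v`. -/
def charVar {N : ℕ} (S : Matrix (Fin (N + 1)) (Fin (N + 1)) ℝ) (v : Fin (N + 1) → ℝ → ℝ → ℝ)
    (n : Fin (N + 1)) (t x : ℝ) : ℝ :=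
  ∑ l, S l n * v l t x

/-- The DG approximation `v̂_{n,h}` of the gPC coefficient `v̂_n`: the component `n` of `S q_h`. -/
def dgCoeff {N : ℕ} {L : ℝ} {𝒯 : Mesh L} (S : Matrix (Fin (N + 1)) (Fin (N + 1)) ℝ)
    (qh : Fin (N + 1) → ℝ → 𝒯.Broken) (n : Fin (N + 1)) (t : ℝ) (x : ℝ) : ℝ :=
  ∑ l, S n l * 𝒯.toFun (qh l t) x

/-- The gPC Galerkin coefficients `v̂_0, …, v̂_N`, which start from the exact gPC coefficients of
`u` at time `0` and lie in `H^{k+2}`, an orthogonal diagonalization `Sᵀ A S = diag(lam)` of the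
Galerkin matrix, and the DG approximations `qh` of degree `k` of the characteristic variables. -/
structure IsDGgPC {L : ℝ} (T : ℝ) (k N : ℕ) (μ : Measure ℝ) (c : ℝ → ℝ) (P : ℕ → ℝ[X])
    (u : ℝ → ℝ → ℝ → ℝ) (𝒯 : Mesh L) (v : Fin (N + 1) → ℝ → ℝ → ℝ)
    (S : Matrix (Fin (N + 1)) (Fin (N + 1)) ℝ) (lam : Fin (N + 1) → ℝ)
    (qh : Fin (N + 1) → ℝ → 𝒯.Broken) : Prop where
  galerkin : IsSystemSolution L T (gpcMatrix μ c P N) v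
  initial : ∀ n, v n 0 =ᵐ[volume] gpcCoeff μ P u n 0
  smooth : ∀ n, ∀ t ∈ Icc 0 T, PerSobolev L (k + 2) (v n t)
  orthogonal : Sᵀ * S = 1
  diagonal : Sᵀ * gpcMatrix μ c P N * S = Matrix.diagonal lam
  dg : ∀ n, IsDGSolution T k 𝒯 (lam n) (charVar S v n 0) (qh n)

/-- The mean-square error `E[‖u(·, t; ·) - v_h(·, t; ·)‖²_{L²}]`, where
`v_h(x, t; y) = ∑ n, v̂_{n,h}(x, t) P_n(y)` is the DG-gPC expansion. -/
def meanSquareError {L : ℝ} {N : ℕ} (μ : Measure ℝ) (P : ℕ → ℝ[X]) (u : ℝ → ℝ → ℝ → ℝ)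
    {𝒯 : Mesh L} (S : Matrix (Fin (N + 1)) (Fin (N + 1)) ℝ)
    (qh : Fin (N + 1) → ℝ → 𝒯.Broken) (t : ℝ) : ℝ :=
  ∫ y, l2Norm L (fun x => u x t y - ∑ n : Fin (N + 1), dgCoeff S qh n t x * (P n).eval y) ^ 2 ∂μ

end DGgPC

end

/-!
The error of the DG-gPC method splits into three parts: the gPC coefficients beyond `N`, which the
expansion neglects, the difference between the first `N + 1` exact coefficients and the solution of
the Galerkin system, and the error of the DG method for that system. As the polynomials are
orthonormal, the mean-square error is the sum of the first part and of the squared distance of the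
coefficients (`integral_integral_sq_sub_expansion`, `meanSquareError_le`).

*The DG method.* An orthogonal change of variables decouples the Galerkin system into scalar
transport equations `q_t = a q_x`, and preserves the `L²` norms and the Sobolev seminorms. The speeds
are bounded by `M`, because the Galerkin matrix is a compression of the multiplication by `c`
(`abs_eigenvalue_le`). Fourier coefficients show that a weak solution is the translate `g(x + a t)`
of its initial value (`IsTransportSolution.ae_eq_translate`), and an initial value in `H^{k+2}` has a
`C^{k+1}` representative `g` (`PerSobolev.exists_regular_representative`). The DG solution is compared
with the Radau projection of `g(x + a t)`, which keeps the value at the upwind endpoint of each cell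
and the moments of order less than `k` (`exists_isRadauProjection`). For the difference, the flux
terms and the volume terms of the projection error vanish, so that only the projection error of the
time derivative acts as a source (`IsDGSolution.hasDerivWithinAt_error`). The upwind flux dissipates
the `L²` norm (`Mesh.flux_dissipative`), and Grönwall's inequality, Taylor approximation and
Poincaré's inequality give the order `k + 1` (`exists_dg_error_bound`). The projections are taken on
the reference cell, hence the constant does not depend on the mesh.

*The Galerkin truncation.* In a Fourier mode `m` in `x`, the exact coefficients satisfy the Galerkin
system up to the truncated part of the mode, multiplied by the frequency. In the energy balance of the
error its coupling with itself cancels, because the multiplication by `c` is symmetric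
(`mode_energy_rate_le`). Summed over modes, the source is at most `M² L` times the sum of the squared
`H^1` seminorms of the neglected coefficients (`sum_freq_sq_mul_residual_le`), so that Grönwall's
inequality bounds the error by `t e^T M²` times this sum (`sum_integral_sq_sub_galerkin_le`). By the
decay condition and `∑_{n > N} n^{-2m} ≤ N^{1-2m} / (2m - 1)`, this and the neglected part are of the
order `N^{1-2m}` if `m > 1/2` and `N ≥ n₀`. In all other cases `N^{2m-1}` is bounded, and the
conservation of energy suffices (`exists_truncation_bound`). The neglected part does not vanish with
`t`; it is absorbed into `K t` by means of `t ≥ t₀`.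
-/

namespace DGgPC

/-! ### Periodic square-integrable functions -/

section Periodic

variable {L : ℝ} {f g : ℝ → ℝ}

lemma PerL2.intervalIntegrable (hL : 0 < L) (hf : PerL2 L f) (a b : ℝ) :
    IntervalIntegrable f volume a b := by
  refine hf.1.intervalIntegrable₀ hL.ne' ?_ a b
  rw [intervalIntegrable_iff_integrableOn_Ioc_of_le hL.le]
  exact hf.2.integrable (by norm_num)

lemma PerL2.sq_intervalIntegrable (hL : 0 < L) (hf : PerL2 L f) (a b : ℝ) :
    IntervalIntegrable (fun x => f x ^ 2) volume a b := by
  have hp : Function.Periodic (fun x => f x ^ 2) L := fun x => by simp only [hf.1 x]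
  refine hp.intervalIntegrable₀ hL.ne' ?_ a b
  rw [intervalIntegrable_iff_integrableOn_Ioc_of_le hL.le]
  exact hf.2.integrable_sq

lemma PerL2.locallyIntegrable (hL : 0 < L) (hf : PerL2 L f) : LocallyIntegrable f := by
  intro x
  refine ⟨Ioc (x - 1) (x + 1), Ioc_mem_nhds (by linarith) (by linarith), ?_⟩
  exact (intervalIntegrable_iff_integrableOn_Ioc_of_le (by linarith)).1
    (hf.intervalIntegrable hL _ _)

lemma PerL2.aestronglyMeasurable (hL : 0 < L) (hf : PerL2 L f) :
    AEStronglyMeasurable f volume := (hf.locallyIntegrable hL).aestronglyMeasurable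

lemma PerL2.sub (hf : PerL2 L f) (hg : PerL2 L g) : PerL2 L (fun x => f x - g x) :=
  ⟨fun x => by simp only [hf.1 x, hg.1 x], hf.2.sub hg.2⟩

lemma PerL2.const_mul (c : ℝ) (hf : PerL2 L f) : PerL2 L (fun x => c * f x) :=
  ⟨fun x => by simp only [hf.1 x], hf.2.const_mul c⟩

lemma PerL2.sum {ι : Type*} (s : Finset ι) {f : ι → ℝ → ℝ} (hf : ∀ i ∈ s, PerL2 L (f i)) :
    PerL2 L (fun x => ∑ i ∈ s, f i x) := by
  refine ⟨fun x => Finset.sum_congr rfl fun i hi => (hf i hi).1 x, ?_⟩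
  exact memLp_finsetSum s fun i hi => (hf i hi).2

lemma PerL2.comp_add_const (hL : 0 < L) (hf : PerL2 L f) (c : ℝ) :
    PerL2 L (fun x => f (x + c)) := by
  refine ⟨fun x => ?_, ?_⟩
  · simp only [← hf.1 (x + c), add_right_comm x L c]
  · have hm : AEStronglyMeasurable (fun x => f (x + c)) volume :=
      (hf.aestronglyMeasurable hL).comp_measurePreserving (measurePreserving_add_right volume c)
    rw [memLp_two_iff_integrable_sq hm.restrict]
    have h := (hf.sq_intervalIntegrable hL (0 + c) (L + c)).comp_add_right c
    simp only [add_sub_cancel_right] at h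
    exact (intervalIntegrable_iff_integrableOn_Ioc_of_le hL.le).1 h

lemma PerL2.mul_continuous_intervalIntegrable (hL : 0 < L) (hf : PerL2 L f) {φ : ℝ → ℝ}
    (hφ : Continuous φ) (a b : ℝ) : IntervalIntegrable (fun x => f x * φ x) volume a b :=
  (hf.intervalIntegrable hL a b).mul_continuousOn hφ.continuousOn

lemma integral_periodic_comp_add (hp : Function.Periodic f L) (c : ℝ) :
    ∫ x in (0 : ℝ)..L, f (x + c) = ∫ x in (0 : ℝ)..L, f x := by
  rw [intervalIntegral.integral_comp_add_right (fun x => f x) c]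
  have := hp.intervalIntegral_add_eq c 0
  simpa [add_comm] using this

lemma l2Norm_sq (L : ℝ) (hL : 0 ≤ L) (f : ℝ → ℝ) :
    l2Norm L f ^ 2 = ∫ x in (0 : ℝ)..L, f x ^ 2 :=
  Real.sq_sqrt (intervalIntegral.integral_nonneg hL fun _ _ => sq_nonneg _)

lemma l2Norm_congr_ae (h : f =ᵐ[volume] g) : l2Norm L f = l2Norm L g := by
  unfold l2Norm
  congr 1
  refine intervalIntegral.integral_congr_ae ?_
  filter_upwards [h] with x hx _
  rw [hx]

lemma l2Norm_nonneg : 0 ≤ l2Norm L f := Real.sqrt_nonneg _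

end Periodic

/-! ### Fourier coefficients and Parseval's identity -/

/-- The angular frequency `2πm/L` of the mode `m`. -/
noncomputable def freq (L : ℝ) (m : ℤ) : ℝ := 2 * Real.pi * m / L

/-- The unnormalized cosine coefficient of the mode `m`. -/
noncomputable def cosCoeff (L : ℝ) (m : ℤ) (f : ℝ → ℝ) : ℝ :=
  ∫ x in (0 : ℝ)..L, f x * Real.cos (freq L m * x)

/-- The unnormalized sine coefficient of the mode `m`. -/
noncomputable def sinCoeff (L : ℝ) (m : ℤ) (f : ℝ → ℝ) : ℝ :=
  ∫ x in (0 : ℝ)..L, f x * Real.sin (freq L m * x)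

section Fourier

variable {L : ℝ} {f g : ℝ → ℝ}

lemma periodic_cos_freq (hL : L ≠ 0) (m : ℤ) :
    Function.Periodic (fun x => Real.cos (freq L m * x)) L := by
  intro x
  have : freq L m * (x + L) = freq L m * x + m * (2 * Real.pi) := by
    unfold freq; field_simp
  simp only [this, Real.cos_add_int_mul_two_pi]

lemma periodic_sin_freq (hL : L ≠ 0) (m : ℤ) :
    Function.Periodic (fun x => Real.sin (freq L m * x)) L := by
  intro x
  have : freq L m * (x + L) = freq L m * x + m * (2 * Real.pi) := by
    unfold freq; field_simp
  simp only [this, Real.sin_add_int_mul_two_pi]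

lemma fourierCoeffOn_ofReal (hL : 0 < L) (m : ℤ)
    (hf : IntervalIntegrable f volume 0 L) :
    fourierCoeffOn hL (fun x => (f x : ℂ)) m =
      ((L⁻¹ * cosCoeff L m f : ℝ) : ℂ) - ((L⁻¹ * sinCoeff L m f : ℝ) : ℂ) * Complex.I := by
  have hc : IntervalIntegrable (fun x => f x * Real.cos (freq L m * x)) volume 0 L :=
    hf.mul_continuousOn (by fun_prop)
  have hs : IntervalIntegrable (fun x => f x * Real.sin (freq L m * x)) volume 0 L :=
    hf.mul_continuousOn (by fun_prop)
  rw [fourierCoeffOn_eq_integral]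
  have h1 : ∀ x : ℝ, fourier (-m) (x : AddCircle (L - 0)) • ((f x : ℝ) : ℂ) =
      ((f x * Real.cos (freq L m * x) : ℝ) : ℂ)
        - ((f x * Real.sin (freq L m * x) : ℝ) : ℂ) * Complex.I := by
    intro x
    have : 2 * (Real.pi : ℂ) * Complex.I * ((-m : ℤ) : ℂ) * x / ((L - 0 : ℝ) : ℂ)
        = ((-(freq L m * x) : ℝ) : ℂ) * Complex.I := by
      unfold freq; push_cast; simp only [sub_zero]; ring
    rw [fourier_coe_apply, this, Complex.exp_mul_I, smul_eq_mul]
    push_cast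
    rw [Complex.cos_neg, Complex.sin_neg]
    ring
  simp_rw [h1]
  have hc' : IntervalIntegrable (fun x => ((f x * Real.cos (freq L m * x) : ℝ) : ℂ)) volume 0 L :=
    ⟨hc.1.ofReal, hc.2.ofReal⟩
  have hs' : IntervalIntegrable (fun x => ((f x * Real.sin (freq L m * x) : ℝ) : ℂ)) volume 0 L :=
    ⟨hs.1.ofReal, hs.2.ofReal⟩
  rw [intervalIntegral.integral_sub hc' (hs'.mul_const _),
    intervalIntegral.integral_mul_const, intervalIntegral.integral_ofReal,
    intervalIntegral.integral_ofReal]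
  simp only [cosCoeff, sinCoeff, sub_zero, one_div, Complex.real_smul]
  push_cast
  ring

/-- Parseval's identity in terms of the unnormalized real Fourier coefficients. -/
theorem hasSum_sq_cosCoeff_add_sq_sinCoeff (hL : 0 < L)
    (hf : MemLp f 2 (volume.restrict (Ioc 0 L))) :
    HasSum (fun m : ℤ => cosCoeff L m f ^ 2 + sinCoeff L m f ^ 2)
      (L * ∫ x in (0 : ℝ)..L, f x ^ 2) := by
  have hi : IntervalIntegrable f volume 0 L := by
    rw [intervalIntegrable_iff_integrableOn_Ioc_of_le hL.le]
    exact hf.integrable (by norm_num)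
  have h := (hasSum_sq_fourierCoeffOn (f := fun x => (f x : ℂ)) hL hf.ofReal).mul_left (L ^ 2)
  have e1 : (fun m : ℤ => L ^ 2 * ‖fourierCoeffOn hL (fun x => (f x : ℂ)) m‖ ^ 2)
      = fun m : ℤ => cosCoeff L m f ^ 2 + sinCoeff L m f ^ 2 := by
    funext m
    rw [fourierCoeffOn_ofReal hL m hi, ← Complex.normSq_eq_norm_sq, Complex.normSq_apply]
    simp only [Complex.sub_re, Complex.ofReal_re, Complex.mul_re, Complex.I_re, Complex.ofReal_im,
      Complex.I_im, Complex.sub_im, Complex.mul_im]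
    field_simp
    ring
  have e2 : L ^ 2 * ((L - 0)⁻¹ • ∫ x in (0 : ℝ)..L, ‖(f x : ℂ)‖ ^ 2)
      = L * ∫ x in (0 : ℝ)..L, f x ^ 2 := by
    simp only [sub_zero, Complex.norm_real, smul_eq_mul, Real.norm_eq_abs, sq_abs]
    field_simp
  rwa [e1, e2] at h

lemma cosCoeff_congr_ae (h : f =ᵐ[volume] g) (m : ℤ) : cosCoeff L m f = cosCoeff L m g := by
  refine intervalIntegral.integral_congr_ae ?_
  filter_upwards [h] with x hx _
  rw [hx]

lemma sinCoeff_congr_ae (h : f =ᵐ[volume] g) (m : ℤ) : sinCoeff L m f = sinCoeff L m g := by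
  refine intervalIntegral.integral_congr_ae ?_
  filter_upwards [h] with x hx _
  rw [hx]

lemma cosCoeff_sub (hL : 0 < L) (hf : PerL2 L f) (hg : PerL2 L g) (m : ℤ) :
    cosCoeff L m (fun x => f x - g x) = cosCoeff L m f - cosCoeff L m g := by
  unfold cosCoeff
  simp only [sub_mul]
  exact intervalIntegral.integral_sub
    (hf.mul_continuous_intervalIntegrable hL (by fun_prop) _ _)
    (hg.mul_continuous_intervalIntegrable hL (by fun_prop) _ _)

lemma sinCoeff_sub (hL : 0 < L) (hf : PerL2 L f) (hg : PerL2 L g) (m : ℤ) :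
    sinCoeff L m (fun x => f x - g x) = sinCoeff L m f - sinCoeff L m g := by
  unfold sinCoeff
  simp only [sub_mul]
  exact intervalIntegral.integral_sub
    (hf.mul_continuous_intervalIntegrable hL (by fun_prop) _ _)
    (hg.mul_continuous_intervalIntegrable hL (by fun_prop) _ _)

/-- Two periodic square-integrable functions with the same Fourier coefficients agree. -/
lemma PerL2.ae_eq_of_coeff_eq (hL : 0 < L) (hf : PerL2 L f) (hg : PerL2 L g)
    (hc : ∀ m, cosCoeff L m f = cosCoeff L m g) (hs : ∀ m, sinCoeff L m f = sinCoeff L m g) :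
    f =ᵐ[volume] g := by
  have hd := hf.sub hg
  have h := hasSum_sq_cosCoeff_add_sq_sinCoeff hL hd.2
  have h0 : (fun m : ℤ => cosCoeff L m (fun x => f x - g x) ^ 2
      + sinCoeff L m (fun x => f x - g x) ^ 2) = fun _ => 0 := by
    funext m
    rw [cosCoeff_sub hL hf hg, sinCoeff_sub hL hf hg, hc, hs]; simp
  rw [h0] at h
  have h1 : ∫ x in (0 : ℝ)..L, (f x - g x) ^ 2 = 0 := by
    have := h.unique hasSum_zero
    simpa [hL.ne'] using this
  have key : ∀ n : ℤ, ∀ᵐ x, x ∈ Ioc (n * L) (n * L + L) → f x = g x := by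
    intro n
    have hp : Function.Periodic (fun x => (f x - g x) ^ 2) L := fun x => by
      simp only [hf.1 x, hg.1 x]
    have h2 : ∫ x in (n * L)..(n * L + L), (f x - g x) ^ 2 = 0 := by
      rw [hp.intervalIntegral_add_eq (n * L) 0, zero_add, h1]
    rw [intervalIntegral.integral_of_le (by linarith),
      setIntegral_eq_zero_iff_of_nonneg_ae (Filter.Eventually.of_forall fun x => sq_nonneg _)
        ((intervalIntegrable_iff_integrableOn_Ioc_of_le (by linarith)).1
          (hd.sq_intervalIntegrable hL _ _))] at h2
    rw [Filter.EventuallyEq, ae_restrict_iff' measurableSet_Ioc] at h2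
    filter_upwards [h2] with x hx hxm
    have := hx hxm
    simp only [Pi.zero_apply] at this
    nlinarith [pow_eq_zero_iff (two_ne_zero) |>.1 this]
  filter_upwards [ae_all_iff.2 key] with x hx
  obtain ⟨n, hn, -⟩ := existsUnique_add_zsmul_mem_Ioc hL x 0
  refine hx (-n) ?_
  simp only [zsmul_eq_mul, zero_add, mem_Ioc] at hn
  push_cast
  exact ⟨by linarith, by linarith⟩

/-! ### Weak solutions of the scalar transport equation -/

/-- The solutions of the linear system `C' = b D`, `D' = -b C`. -/
lemma rotation_of_hasDerivWithinAt {T b : ℝ} {C D : ℝ → ℝ}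
    (hC : ∀ t ∈ Icc 0 T, HasDerivWithinAt C (b * D t) (Icc 0 T) t)
    (hD : ∀ t ∈ Icc 0 T, HasDerivWithinAt D (-(b * C t)) (Icc 0 T) t) :
    ∀ t ∈ Icc 0 T, C t = C 0 * Real.cos (b * t) + D 0 * Real.sin (b * t) ∧
      D t = D 0 * Real.cos (b * t) - C 0 * Real.sin (b * t) := by
  -- The inverse rotation of `(C, D)` has vanishing derivative.
  have hcos : ∀ t, HasDerivWithinAt (fun t => Real.cos (b * t)) (-Real.sin (b * t) * b)
      (Icc 0 T) t := fun t => by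
    simpa using (((hasDerivAt_id t).const_mul b).cos).hasDerivWithinAt
  have hsin : ∀ t, HasDerivWithinAt (fun t => Real.sin (b * t)) (Real.cos (b * t) * b)
      (Icc 0 T) t := fun t => by
    simpa using (((hasDerivAt_id t).const_mul b).sin).hasDerivWithinAt
  have hX : ∀ t ∈ Icc 0 T, HasDerivWithinAt
      (fun t => C t * Real.cos (b * t) - D t * Real.sin (b * t)) 0 (Icc 0 T) t := by
    intro t ht
    convert! ((hC t ht).mul (hcos t)).sub ((hD t ht).mul (hsin t)) using 1
    ring
  have hY : ∀ t ∈ Icc 0 T, HasDerivWithinAt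
      (fun t => C t * Real.sin (b * t) + D t * Real.cos (b * t)) 0 (Icc 0 T) t := by
    intro t ht
    convert! ((hC t ht).mul (hsin t)).add ((hD t ht).mul (hcos t)) using 1
    ring
  intro t ht
  have h0 : (0 : ℝ) ∈ Icc 0 T := ⟨le_rfl, ht.1.trans ht.2⟩
  have cX := (convex_Icc 0 T).norm_image_sub_le_of_norm_hasDerivWithin_le (C := 0) hX
    (fun x _ => by simp) h0 ht
  have cY := (convex_Icc 0 T).norm_image_sub_le_of_norm_hasDerivWithin_le (C := 0) hY
    (fun x _ => by simp) h0 ht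
  simp only [mul_zero, Real.cos_zero, mul_one, Real.sin_zero, sub_zero, zero_mul,
    norm_le_zero_iff, zero_add, sub_eq_zero] at cX cY
  have hcs := Real.sin_sq_add_cos_sq (b * t)
  constructor
  · rw [← cX, ← cY]; linear_combination (-(C t)) * hcs
  · rw [← cX, ← cY]; linear_combination (-(D t)) * hcs

lemma deriv_cos_freq (L : ℝ) (m : ℤ) :
    deriv (fun x => Real.cos (freq L m * x)) = fun x => -(freq L m * Real.sin (freq L m * x)) := by
  funext x
  have : HasDerivAt (fun x => Real.cos (freq L m * x)) (-Real.sin (freq L m * x) * freq L m) x := by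
    simpa using (((hasDerivAt_id x).const_mul (freq L m)).cos)
  rw [this.deriv]; ring

lemma deriv_sin_freq (L : ℝ) (m : ℤ) :
    deriv (fun x => Real.sin (freq L m * x)) = fun x => freq L m * Real.cos (freq L m * x) := by
  funext x
  have : HasDerivAt (fun x => Real.sin (freq L m * x)) (Real.cos (freq L m * x) * freq L m) x := by
    simpa using (((hasDerivAt_id x).const_mul (freq L m)).sin)
  rw [this.deriv]; ring

lemma integral_mul_deriv_cos (L : ℝ) (m : ℤ) (f : ℝ → ℝ) :
    ∫ x in (0 : ℝ)..L, f x * deriv (fun x => Real.cos (freq L m * x)) x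
      = -(freq L m * sinCoeff L m f) := by
  rw [deriv_cos_freq, sinCoeff, ← intervalIntegral.integral_const_mul,
    ← intervalIntegral.integral_neg]
  exact intervalIntegral.integral_congr fun x _ => by ring

lemma integral_mul_deriv_sin (L : ℝ) (m : ℤ) (f : ℝ → ℝ) :
    ∫ x in (0 : ℝ)..L, f x * deriv (fun x => Real.sin (freq L m * x)) x
      = freq L m * cosCoeff L m f := by
  rw [deriv_sin_freq, cosCoeff, ← intervalIntegral.integral_const_mul]
  exact intervalIntegral.integral_congr fun x _ => by ring

lemma contDiff_cos_freq (L : ℝ) (m : ℤ) : ContDiff ℝ ∞ fun x => Real.cos (freq L m * x) := by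
  fun_prop

lemma contDiff_sin_freq (L : ℝ) (m : ℤ) : ContDiff ℝ ∞ fun x => Real.sin (freq L m * x) := by
  fun_prop

/-- The pair of Fourier coefficients of a weak solution of `w_t = a w_x` rotates with angular
velocity `a · freq L m`. -/
lemma IsTransportSolution.coeff_eq {T a : ℝ} {w : ℝ → ℝ → ℝ} (hL : 0 < L)
    (hw : IsTransportSolution L T a w) (m : ℤ) {t : ℝ} (ht : t ∈ Icc 0 T) :
    cosCoeff L m (w t) = cosCoeff L m (w 0) * Real.cos (a * freq L m * t)
        + sinCoeff L m (w 0) * Real.sin (a * freq L m * t) ∧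
      sinCoeff L m (w t) = sinCoeff L m (w 0) * Real.cos (a * freq L m * t)
        - cosCoeff L m (w 0) * Real.sin (a * freq L m * t) := by
  refine rotation_of_hasDerivWithinAt (C := fun t => cosCoeff L m (w t))
    (D := fun t => sinCoeff L m (w t)) ?_ ?_ t ht
  · intro s hs
    have := hw.2 _ (contDiff_cos_freq L m) (periodic_cos_freq hL.ne' m) s hs
    rw [integral_mul_deriv_cos] at this
    convert! this using 1
    ring
  · intro s hs
    have := hw.2 _ (contDiff_sin_freq L m) (periodic_sin_freq hL.ne' m) s hs
    rw [integral_mul_deriv_sin] at this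
    convert! this using 1
    ring

lemma cosCoeff_comp_add (hL : 0 < L) (hf : PerL2 L f) (m : ℤ) (c : ℝ) :
    cosCoeff L m (fun x => f (x + c)) = cosCoeff L m f * Real.cos (freq L m * c)
        + sinCoeff L m f * Real.sin (freq L m * c) := by
  have hp : Function.Periodic (fun z => f z * Real.cos (freq L m * (z - c))) L := by
    intro z
    have := periodic_cos_freq hL.ne' m (z - c)
    simp only [hf.1 z] at this ⊢
    rw [← this]; ring_nf
  have h := integral_periodic_comp_add hp c
  simp only [add_sub_cancel_right] at h
  rw [cosCoeff, h, cosCoeff, sinCoeff, ← intervalIntegral.integral_mul_const,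
    ← intervalIntegral.integral_mul_const, ← intervalIntegral.integral_add
      ((hf.mul_continuous_intervalIntegrable hL (by fun_prop) _ _).mul_const _)
      ((hf.mul_continuous_intervalIntegrable hL (by fun_prop) _ _).mul_const _)]
  refine intervalIntegral.integral_congr fun x _ => ?_
  simp only [mul_sub, Real.cos_sub]; ring

lemma sinCoeff_comp_add (hL : 0 < L) (hf : PerL2 L f) (m : ℤ) (c : ℝ) :
    sinCoeff L m (fun x => f (x + c)) = sinCoeff L m f * Real.cos (freq L m * c)
        - cosCoeff L m f * Real.sin (freq L m * c) := by
  have hp : Function.Periodic (fun z => f z * Real.sin (freq L m * (z - c))) L := by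
    intro z
    have := periodic_sin_freq hL.ne' m (z - c)
    simp only [hf.1 z] at this ⊢
    rw [← this]; ring_nf
  have h := integral_periodic_comp_add hp c
  simp only [add_sub_cancel_right] at h
  rw [sinCoeff, h, cosCoeff, sinCoeff, ← intervalIntegral.integral_mul_const,
    ← intervalIntegral.integral_mul_const, ← intervalIntegral.integral_sub
      ((hf.mul_continuous_intervalIntegrable hL (by fun_prop) _ _).mul_const _)
      ((hf.mul_continuous_intervalIntegrable hL (by fun_prop) _ _).mul_const _)]
  refine intervalIntegral.integral_congr fun x _ => ?_
  simp only [mul_sub, Real.sin_sub]; ring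

/-- Weak solutions of the transport equation are translations of their initial values. -/
theorem IsTransportSolution.ae_eq_translate {T a : ℝ} {w : ℝ → ℝ → ℝ} (hL : 0 < L)
    (hw : IsTransportSolution L T a w) {t : ℝ} (ht : t ∈ Icc 0 T) :
    w t =ᵐ[volume] fun x => w 0 (x + a * t) := by
  have h0 : (0 : ℝ) ∈ Icc 0 T := ⟨le_rfl, ht.1.trans ht.2⟩
  refine (hw.1 t ht).ae_eq_of_coeff_eq hL ((hw.1 0 h0).comp_add_const hL _) ?_ ?_
  · intro m
    rw [(hw.coeff_eq hL m ht).1, cosCoeff_comp_add hL (hw.1 0 h0)]; ring_nf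
  · intro m
    rw [(hw.coeff_eq hL m ht).2, sinCoeff_comp_add hL (hw.1 0 h0)]; ring_nf

lemma IsTransportSolution.integral_sq_eq {T a : ℝ} {w : ℝ → ℝ → ℝ} (hL : 0 < L)
    (hw : IsTransportSolution L T a w) {t : ℝ} (ht : t ∈ Icc 0 T) :
    ∫ x in (0 : ℝ)..L, w t x ^ 2 = ∫ x in (0 : ℝ)..L, w 0 x ^ 2 := by
  have h0 : (0 : ℝ) ∈ Icc 0 T := ⟨le_rfl, ht.1.trans ht.2⟩
  have hp : Function.Periodic (fun x => w 0 x ^ 2) L := fun x => by simp only [(hw.1 0 h0).1 x]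
  rw [← integral_periodic_comp_add hp (a * t)]
  refine intervalIntegral.integral_congr_ae ?_
  filter_upwards [hw.ae_eq_translate hL ht] with x hx _
  rw [hx]

end Fourier

/-! ### Weak derivatives -/

section Weak

variable {L : ℝ} {f g : ℝ → ℝ}

lemma contDiff_iteratedDeriv {φ : ℝ → ℝ} (hφ : ContDiff ℝ ∞ φ) :
    ∀ j, ContDiff ℝ ∞ (iteratedDeriv j φ) := by
  intro j
  induction j with
  | zero => simpa using hφ
  | succ j ih => rw [iteratedDeriv_succ]; exact (contDiff_infty_iff_deriv.1 ih).2

lemma hasCompactSupport_iteratedDeriv {φ : ℝ → ℝ} (hφ : HasCompactSupport φ) :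
    ∀ j, HasCompactSupport (iteratedDeriv j φ) := by
  intro j
  induction j with
  | zero => simpa using hφ
  | succ j ih => rw [iteratedDeriv_succ]; exact ih.deriv

lemma integrable_mul_test (hf : LocallyIntegrable f) {φ : ℝ → ℝ} (hφ : Continuous φ)
    (hc : HasCompactSupport φ) : Integrable fun x => f x * φ x :=
  hf.integrable_smul_right_of_hasCompactSupport hφ hc

lemma exists_support_subset_Ioc {φ : ℝ → ℝ} (hc : HasCompactSupport φ) :
    ∃ R > 0, tsupport φ ⊆ Ioo (-R) R := by
  obtain ⟨R, hR, h⟩ := hc.isCompact.isBounded.subset_ball_lt 0 0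
  exact ⟨R, hR, by rwa [Real.ball_eq_Ioo, zero_sub, zero_add] at h⟩

/-- A weak derivative of order `j + 1` of `f` is a weak derivative of its derivative of order
`j`. -/
lemma IsWeakDeriv.of_succ {j : ℕ} {d d' : ℝ → ℝ} (h : IsWeakDeriv j f d)
    (h' : IsWeakDeriv (j + 1) f d') : IsWeakDeriv 1 d d' := by
  intro φ hφ hc
  have h1 := h (deriv φ) (contDiff_infty_iff_deriv.1 hφ).2 hc.deriv
  have h2 := h' φ hφ hc
  rw [iteratedDeriv_succ', h1, pow_succ] at h2
  rw [iteratedDeriv_one]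
  have : ((-1 : ℝ) ^ j) ≠ 0 := by positivity
  exact mul_left_cancel₀ this (by rw [h2]; ring)

lemma IsWeakDeriv.ae_eq {j : ℕ} {d d' : ℝ → ℝ} (hL : 0 < L) (hd : PerL2 L d) (hd' : PerL2 L d')
    (h : IsWeakDeriv j f d) (h' : IsWeakDeriv j f d') : d =ᵐ[volume] d' := by
  refine ae_eq_of_integral_contDiff_smul_eq (hd.locallyIntegrable hL) (hd'.locallyIntegrable hL) ?_
  intro φ hφ hc
  have := (h φ hφ hc).symm.trans (h' φ hφ hc)
  simp only [smul_eq_mul, mul_comm (φ _)]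
  exact mul_left_cancel₀ (by positivity) this

lemma IsWeakDeriv.zero_self (f : ℝ → ℝ) : IsWeakDeriv 0 f f := by
  intro φ _ _
  simp

lemma weakDeriv_spec {j : ℕ} (H : ∃ g, PerL2 L g ∧ IsWeakDeriv j f g) :
    PerL2 L (weakDeriv L j f) ∧ IsWeakDeriv j f (weakDeriv L j f) := by
  unfold weakDeriv
  rw [dif_pos H]
  exact H.choose_spec

lemma weakDeriv_ae_eq {j : ℕ} (hL : 0 < L) (hg : PerL2 L g) (h : IsWeakDeriv j f g) :
    weakDeriv L j f =ᵐ[volume] g :=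
  have H := weakDeriv_spec ⟨g, hg, h⟩
  H.2.ae_eq hL H.1 hg h

lemma semi_eq {j : ℕ} (hL : 0 < L) (hg : PerL2 L g) (h : IsWeakDeriv j f g) :
    semi L j f = l2Norm L g := l2Norm_congr_ae (weakDeriv_ae_eq hL hg h)

lemma IsWeakDeriv.sum {ι : Type*} [Fintype ι] {j : ℕ} (hL : 0 < L) {f d : ι → ℝ → ℝ} (c : ι → ℝ)
    (hf : ∀ i, PerL2 L (f i)) (hd : ∀ i, PerL2 L (d i)) (h : ∀ i, IsWeakDeriv j (f i) (d i)) :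
    IsWeakDeriv j (fun x => ∑ i, c i * f i x) (fun x => ∑ i, c i * d i x) := by
  intro φ hφ hc
  simp only [Finset.sum_mul]
  rw [integral_finsetSum, integral_finsetSum, Finset.mul_sum]
  · refine Finset.sum_congr rfl fun i _ => ?_
    simp only [mul_assoc]
    rw [integral_const_mul, integral_const_mul, h i φ hφ hc]; ring
  · exact fun i _ => integrable_mul_test (((hd i).const_mul (c i)).locallyIntegrable hL)
      hφ.continuous hc
  · exact fun i _ => integrable_mul_test (((hf i).const_mul (c i)).locallyIntegrable hL)
      (contDiff_iteratedDeriv hφ j).continuous (hasCompactSupport_iteratedDeriv hc j)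

/-- Integration by parts of a primitive of an integrable function against a `C^1` function. -/
lemma integral_primitive_mul_deriv {a b c : ℝ} (hg : ∀ a b, IntervalIntegrable g volume a b)
    {φ : ℝ → ℝ} (hφ : ContDiff ℝ 1 φ) :
    ∫ x in a..b, (c + ∫ s in (0 : ℝ)..x, g s) * deriv φ x
      = (c + ∫ s in (0 : ℝ)..b, g s) * φ b - (c + ∫ s in (0 : ℝ)..a, g s) * φ a
        - ∫ x in a..b, g x * φ x := by
  set F : ℝ → ℝ := fun x => c + ∫ s in (0 : ℝ)..x, g s with hF
  have hF' : F = fun x => F a + ∫ s in a..x, g s := by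
    funext x
    simp only [hF, add_assoc, intervalIntegral.integral_add_adjacent_intervals (hg _ _) (hg _ _)]
  have hac : AbsolutelyContinuousOnInterval F a b := by
    rw [hF']
    refine AbsolutelyContinuousOnInterval.add (f := fun _ => F a) ?_
      ((hg a b).absolutelyContinuousOnInterval_intervalIntegral left_mem_uIcc)
    exact contDiffOn_const.absolutelyContinuousOnInterval
  have hφac : AbsolutelyContinuousOnInterval φ a b :=
    hφ.contDiffOn.absolutelyContinuousOnInterval
  rw [hac.integral_mul_deriv_eq_deriv_mul hφac]
  congr 1
  refine intervalIntegral.integral_congr_ae ?_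
  filter_upwards [(hg a b).ae_hasDerivAt_integral] with x hx hxm
  have := (hx (uIoc_subset_uIcc hxm) a left_mem_uIcc).const_add (F a)
  rw [hF', this.deriv]

lemma integral_primitive_mul_deriv_test {c : ℝ} (hg : ∀ a b, IntervalIntegrable g volume a b)
    {φ : ℝ → ℝ} (hφ : ContDiff ℝ ∞ φ) (hc : HasCompactSupport φ) :
    ∫ x, (c + ∫ s in (0 : ℝ)..x, g s) * deriv φ x = -∫ x, g x * φ x := by
  obtain ⟨R, hR, hs⟩ := exists_support_subset_Ioc hc
  have hφ0 : ∀ x, x ∉ Ioo (-R) R → φ x = 0 := fun x hx =>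
    image_eq_zero_of_notMem_tsupport fun h => hx (hs h)
  have h1 : Function.support (fun x => (c + ∫ s in (0 : ℝ)..x, g s) * deriv φ x) ⊆ Ioc (-R) R := by
    refine (Function.support_mul_subset_right _ _).trans ?_
    exact (subset_closure.trans (tsupport_deriv_subset (𝕜 := ℝ) (f := φ))).trans
      (hs.trans Ioo_subset_Ioc_self)
  have h2 : Function.support (fun x => g x * φ x) ⊆ Ioc (-R) R :=
    (Function.support_mul_subset_right _ _).trans
      (subset_closure.trans (hs.trans Ioo_subset_Ioc_self))
  rw [← intervalIntegral.integral_eq_integral_of_support_subset h1,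
    ← intervalIntegral.integral_eq_integral_of_support_subset h2,
    integral_primitive_mul_deriv hg (hφ.of_le (by exact_mod_cast le_top)),
    hφ0 R (by simp), hφ0 (-R) (by simp)]
  ring

/-- A locally integrable function with vanishing weak derivative is constant. -/
lemma ae_eq_const_of_integral_mul_deriv_eq_zero {h : ℝ → ℝ} (hh : LocallyIntegrable h)
    (h0 : ∀ φ : ℝ → ℝ, ContDiff ℝ ∞ φ → HasCompactSupport φ → ∫ x, h x * deriv φ x = 0) :
    ∃ c : ℝ, h =ᵐ[volume] fun _ => c := by
  let bump : ContDiffBump (0 : ℝ) := ⟨1, 2, one_pos, one_lt_two⟩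
  set ψ : ℝ → ℝ := bump.normed volume with hψ
  have hψs : ContDiff ℝ ∞ ψ := bump.contDiff_normed
  have hψc : HasCompactSupport ψ := bump.hasCompactSupport_normed
  have hψ1 : ∫ x, ψ x = 1 := bump.integral_normed
  refine ⟨∫ x, h x * ψ x, ?_⟩
  refine ae_eq_of_integral_contDiff_smul_eq hh (locallyIntegrable_const _) ?_
  intro φ hφ hc
  -- A test function minus its integral times `ψ` is the derivative of a test function.
  set m : ℝ := ∫ x, φ x with hm
  set θ : ℝ → ℝ := fun x => φ x - m * ψ x with hθ
  have hθs : ContDiff ℝ ∞ θ := hφ.sub (contDiff_const.mul hψs)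
  have hθc : HasCompactSupport θ := by
    have : HasCompactSupport fun x => m * ψ x := hψc.mul_left
    exact hc.sub this
  have hφi : Integrable φ := hφ.continuous.integrable_of_hasCompactSupport hc
  have hψi : Integrable ψ := hψs.continuous.integrable_of_hasCompactSupport hψc
  have hθ0 : ∫ x, θ x = 0 := by
    rw [hθ, integral_sub hφi (hψi.const_mul m), integral_const_mul, hψ1, ← hm]; ring
  obtain ⟨R, hR, hs⟩ := exists_support_subset_Ioc hθc
  have hθz : ∀ x, x ∉ Ioo (-R) R → θ x = 0 := fun x hx =>
    image_eq_zero_of_notMem_tsupport fun h => hx (hs h)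
  set Θ : ℝ → ℝ := fun x => ∫ s in (-R)..x, θ s with hΘ
  have hΘd : ∀ x, HasDerivAt Θ (θ x) x := fun x =>
    intervalIntegral.integral_hasDerivAt_right (hθs.continuous.intervalIntegrable _ _)
      (hθs.continuous.stronglyMeasurableAtFilter _ _) hθs.continuous.continuousAt
  have hΘd' : deriv Θ = θ := funext fun x => (hΘd x).deriv
  have hΘs : ContDiff ℝ ∞ Θ := contDiff_infty_iff_deriv.2
    ⟨fun x => (hΘd x).differentiableAt, by rwa [hΘd']⟩
  have hΘc : HasCompactSupport Θ := by
    refine HasCompactSupport.intro (isCompact_Icc (a := -R) (b := R)) fun x hx => ?_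
    rcases lt_or_ge x (-R) with h1 | h1
    · change ∫ s in (-R)..x, θ s = 0
      rw [intervalIntegral.integral_congr (g := fun _ => 0)]
      · simp
      · intro s hs'
        rw [uIcc_of_ge h1.le] at hs'
        exact hθz s fun h => by linarith [h.1, hs'.2]
    · have h2 : R < x := by
        by_contra hcon
        exact hx ⟨h1, not_lt.1 hcon⟩
      have hsup : Function.support θ ⊆ Ioc (-R) x := fun s hs' => by
        have := hs (subset_closure hs')
        exact ⟨this.1, by linarith [this.2]⟩
      change ∫ s in (-R)..x, θ s = 0
      rw [intervalIntegral.integral_eq_integral_of_support_subset hsup, hθ0]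
  have key := h0 Θ hΘs hΘc
  rw [hΘd', hθ] at key
  simp only [mul_sub] at key
  have i1 := integrable_mul_test hh hφ.continuous hc
  have i2 := integrable_mul_test hh hψs.continuous hψc
  have e : ∀ x, h x * (m * ψ x) = m * (h x * ψ x) := fun x => by ring
  simp only [e] at key
  rw [integral_sub i1 (i2.const_mul m), integral_const_mul] at key
  simp only [smul_eq_mul, mul_comm (φ _)]
  rw [integral_const_mul, ← hm]
  linarith

/-- A periodic function with a weak derivative is a primitive of it. -/
theorem IsWeakDeriv.ae_eq_primitive (hL : 0 < L) (hf : PerL2 L f) (hg : PerL2 L g)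
    (h : IsWeakDeriv 1 f g) : ∃ c : ℝ, f =ᵐ[volume] fun x => c + ∫ s in (0 : ℝ)..x, g s := by
  have hgi := hg.intervalIntegrable hL
  have hFc : Continuous fun x => ∫ s in (0 : ℝ)..x, g s :=
    intervalIntegral.continuous_primitive hgi 0
  have hfl := hf.locallyIntegrable hL
  obtain ⟨c, hc⟩ := ae_eq_const_of_integral_mul_deriv_eq_zero
    (h := fun x => f x - ∫ s in (0 : ℝ)..x, g s) (hfl.sub hFc.locallyIntegrable) (by
      intro φ hφ hφc
      have hφ' := (contDiff_infty_iff_deriv.1 hφ).2.continuous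
      have h1 := h φ hφ hφc
      have h2 := integral_primitive_mul_deriv_test (c := 0) hgi hφ hφc
      simp only [zero_add] at h2
      simp only [iteratedDeriv_one, pow_one] at h1
      simp only [sub_mul]
      rw [integral_sub (integrable_mul_test hfl hφ' hφc.deriv)
        (integrable_mul_test hFc.locallyIntegrable hφ' hφc.deriv), h1, h2]
      ring)
  refine ⟨c, ?_⟩
  filter_upwards [hc] with x hx
  linarith

lemma periodic_of_continuous_ae_eq {F : ℝ → ℝ} (hF : Continuous F)
    (hf : Function.Periodic f L) (h : f =ᵐ[volume] F) : Function.Periodic F L := by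
  have h1 : (fun x => F (x + L)) =ᵐ[volume] F := by
    have h2 := (measurePreserving_add_right volume L).quasiMeasurePreserving.ae_eq_comp h
    filter_upwards [h, h2] with x hx hx2
    simp only [Function.comp_apply] at hx2
    rw [← hx2, hf x, hx]
  have := (Continuous.ae_eq_iff_eq volume (by fun_prop) hF).1 h1
  exact fun x => congrFun this x

/-- The regular representative of a function in the periodic Sobolev space `H^{r+1}`: it is `C^r`
(its derivatives are the functions `G j`) and its derivative of order `r` is a primitive of the weak
derivative of order `r + 1`. -/
theorem PerSobolev.exists_regular_representative {r : ℕ} (hL : 0 < L)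
    (hf : PerSobolev L (r + 1) f) :
    ∃ G : ℕ → ℝ → ℝ, (∀ j ≤ r, Continuous (G j) ∧ Function.Periodic (G j) L) ∧
      (∀ j < r, ∀ x, HasDerivAt (G j) (G (j + 1) x) x) ∧
      (∀ x y, G r y - G r x = ∫ s in x..y, weakDeriv L (r + 1) f s) ∧
      f =ᵐ[volume] G 0 := by
  set d : ℕ → ℝ → ℝ := fun j => weakDeriv L j f with hd
  have hs : ∀ j ≤ r + 1, PerL2 L (d j) ∧ IsWeakDeriv j f (d j) := fun j hj =>
    weakDeriv_spec (hf.2 j hj)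
  have hp : ∀ j, ∃ c : ℝ, j ≤ r → d j =ᵐ[volume] fun x => c + ∫ s in (0 : ℝ)..x, d (j + 1) s := by
    intro j
    by_cases hj : j ≤ r
    · have a := hs j (by omega)
      have b := hs (j + 1) (by omega)
      obtain ⟨c, hc⟩ := (a.2.of_succ b.2).ae_eq_primitive hL a.1 b.1
      exact ⟨c, fun _ => hc⟩
    · exact ⟨0, fun h => absurd h hj⟩
  choose c hc using hp
  set G : ℕ → ℝ → ℝ := fun j x => c j + ∫ s in (0 : ℝ)..x, d (j + 1) s with hG
  have hGc : ∀ j ≤ r, Continuous (G j) := fun j hj =>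
    continuous_const.add (intervalIntegral.continuous_primitive
      ((hs (j + 1) (by omega)).1.intervalIntegrable hL) 0)
  refine ⟨G, fun j hj => ⟨hGc j hj, ?_⟩, ?_, ?_, ?_⟩
  · exact periodic_of_continuous_ae_eq (hGc j hj) (hs j (by omega)).1.1 (hc j hj)
  · intro j hj x
    have he : G j = fun x => c j + ∫ s in (0 : ℝ)..x, G (j + 1) s := by
      funext x
      simp only [hG]
      congr 1
      refine intervalIntegral.integral_congr_ae ?_
      filter_upwards [hc (j + 1) (by omega)] with s hs' _
      exact hs'
    have hcont := hGc (j + 1) (by omega)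
    rw [he]
    exact (intervalIntegral.integral_hasDerivAt_right (hcont.intervalIntegrable _ _)
      (hcont.stronglyMeasurableAtFilter _ _) hcont.continuousAt).const_add _
  · intro x y
    have hi := (hs (r + 1) le_rfl).1.intervalIntegrable hL
    simp only [hG, add_sub_add_left_eq_sub]
    rw [intervalIntegral.integral_interval_sub_left (hi _ _) (hi _ _)]
  · exact (IsWeakDeriv.ae_eq hL hf.1 (hs 0 (by omega)).1 (IsWeakDeriv.zero_self f)
      (hs 0 (by omega)).2).trans (hc 0 (by omega))

/-- The Fourier coefficients of the weak derivative. -/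
lemma PerSobolev.coeff_weakDeriv (hL : 0 < L) (hf : PerSobolev L 1 f) (m : ℤ) :
    cosCoeff L m (weakDeriv L 1 f) = freq L m * sinCoeff L m f ∧
      sinCoeff L m (weakDeriv L 1 f) = -(freq L m * cosCoeff L m f) := by
  have hs := weakDeriv_spec (hf.2 1 le_rfl)
  set g := weakDeriv L 1 f
  obtain ⟨c, hc⟩ := hs.2.ae_eq_primitive hL hf.1 hs.1
  have hgi := hs.1.intervalIntegrable hL
  have hF : Continuous fun x => c + ∫ s in (0 : ℝ)..x, g s :=
    continuous_const.add (intervalIntegral.continuous_primitive hgi 0)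
  have hp := periodic_of_continuous_ae_eq hF hf.1.1 hc 0
  simp only [zero_add] at hp
  have aux : ∀ φ : ℝ → ℝ, ContDiff ℝ ∞ φ → Function.Periodic φ L →
      ∫ x in (0 : ℝ)..L, g x * φ x = -∫ x in (0 : ℝ)..L, f x * deriv φ x := by
    intro φ hφ hφp
    have h1 := integral_primitive_mul_deriv (a := 0) (b := L) (c := c) hgi
      (hφ.of_le (by exact_mod_cast le_top) : ContDiff ℝ 1 φ)
    have hφL : φ L = φ 0 := by simpa using hφp 0
    rw [hp, hφL, sub_self, zero_sub] at h1
    rw [← neg_eq_iff_eq_neg, ← h1]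
    refine intervalIntegral.integral_congr_ae ?_
    filter_upwards [hc] with x hx _
    rw [hx]
  constructor
  · rw [cosCoeff, aux _ (contDiff_cos_freq L m) (periodic_cos_freq hL.ne' m),
      integral_mul_deriv_cos, neg_neg]
  · rw [sinCoeff, aux _ (contDiff_sin_freq L m) (periodic_sin_freq hL.ne' m),
      integral_mul_deriv_sin]

end Weak

/-! ### Polynomials of bounded degree and Radau projections -/

section Radau

open Polynomial

lemma exists_eval_ne_zero {p : ℝ[X]} (hp : p ≠ 0) {a b : ℝ} (hab : a < b) :
    ∃ x ∈ Icc a b, p.eval x ≠ 0 := by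
  by_contra! h
  refine hp (p.eq_zero_of_infinite_isRoot ((Icc_infinite hab).mono fun x hx => ?_))
  exact h x hx

lemma eq_zero_of_integral_sq_eq_zero {p : ℝ[X]} {a b : ℝ} (hab : a < b)
    (h : ∫ x in a..b, p.eval x * p.eval x = 0) : p = 0 := by
  by_contra hp
  obtain ⟨c, hc, hpc⟩ := exists_eval_ne_zero hp hab
  refine (intervalIntegral.integral_pos (f := fun x => p.eval x * p.eval x) hab
    (by fun_prop) (fun x _ => mul_self_nonneg _) ⟨c, hc, ?_⟩).ne' h
  exact mul_self_pos.2 hpc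

/-- Unisolvent functionals on the polynomials of degree at most `k` have a dual basis. -/
lemma exists_dual_basis {ι : Type*} [Fintype ι] [DecidableEq ι] {k : ℕ}
    (hι : Fintype.card ι = k + 1) (ℓ : ι → ℝ[X] →ₗ[ℝ] ℝ)
    (hinj : ∀ p : ℝ[X], p.natDegree ≤ k → (∀ i, ℓ i p = 0) → p = 0) :
    ∃ b : ι → ℝ[X], (∀ j, (b j).natDegree ≤ k) ∧
      (∀ i j, ℓ i (b j) = if i = j then 1 else 0) ∧
      ∀ p : ℝ[X], p.natDegree ≤ k → p = ∑ j, C (ℓ j p) * b j := by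
  have hmem : ∀ p : ℝ[X], p ∈ degreeLT ℝ (k + 1) ↔ p.natDegree ≤ k := fun p => by
    rw [mem_degreeLT, degree_lt_iff_coeff_zero, natDegree_le_iff_coeff_eq_zero]
    rfl
  let F : degreeLT ℝ (k + 1) →ₗ[ℝ] (ι → ℝ) :=
    LinearMap.pi fun i => (ℓ i).comp (degreeLT ℝ (k + 1)).subtype
  have hF : Function.Injective F := by
    rw [← LinearMap.ker_eq_bot, LinearMap.ker_eq_bot']
    intro p hp
    refine Subtype.ext (hinj p ((hmem _).1 p.2) fun i => congrFun hp i)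
  have hrank : Module.finrank ℝ (degreeLT ℝ (k + 1)) = Module.finrank ℝ (ι → ℝ) := by
    rw [(degreeLTEquiv ℝ (k + 1)).finrank_eq, Module.finrank_fin_fun,
      Module.finrank_fintype_fun_eq_card, hι]
  let e := LinearEquiv.ofInjectiveOfFinrankEq F hF hrank
  have he : ∀ p, e p = F p := fun p => rfl
  have hb : ∀ i j, ℓ i (e.symm (Pi.single j 1) : degreeLT ℝ (k + 1)) = if i = j then 1 else 0 := by
    intro i j
    have := congrFun (e.apply_symm_apply (Pi.single j (1 : ℝ))) i
    rw [he, Pi.single_apply] at this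
    exact this
  refine ⟨fun j => (e.symm (Pi.single j 1) : degreeLT ℝ (k + 1)), fun j => (hmem _).1 (Subtype.prop _),
    hb, ?_⟩
  intro p hp
  rw [← sub_eq_zero]
  have hdeg : (∑ j, C (ℓ j p) * (e.symm (Pi.single j 1) : degreeLT ℝ (k + 1)).1).natDegree ≤ k :=
    natDegree_sum_le_of_forall_le _ _ fun j _ =>
      (natDegree_C_mul_le _ _).trans ((hmem _).1 (Subtype.prop _))
  refine hinj _ ((natDegree_sub_le _ _).trans (max_le hp hdeg)) fun i => ?_
  rw [map_sub, map_sum]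
  simp only [← smul_eq_C_mul, map_smul, hb, smul_eq_mul, mul_ite, mul_one, mul_zero,
    Finset.sum_ite_eq, Finset.mem_univ, if_true, sub_self]

/-- The functional `p ↦ ∫ p φ` on polynomials. -/
noncomputable def momentMap (a b : ℝ) (φ : ℝ[X]) : ℝ[X] →ₗ[ℝ] ℝ where
  toFun p := ∫ x in a..b, p.eval x * φ.eval x
  map_add' p q := by
    simp only [eval_add, add_mul]
    exact intervalIntegral.integral_add (Continuous.intervalIntegrable (by fun_prop) _ _)
      (Continuous.intervalIntegrable (by fun_prop) _ _)
  map_smul' c p := by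
    simp only [eval_smul, smul_eq_mul, mul_assoc, RingHom.id_apply]
    exact intervalIntegral.integral_const_mul _ _

lemma integral_mul_poly_eq_zero {k : ℕ} {a b : ℝ} {w : ℝ → ℝ} (hw : Continuous w)
    (h : ∀ j < k, ∫ x in a..b, w x * x ^ j = 0) {φ : ℝ[X]} (hφ : φ.degree < k) :
    ∫ x in a..b, w x * φ.eval x = 0 := by
  simp only [eval_eq_sum, Polynomial.sum_def, Finset.mul_sum]
  rw [intervalIntegral.integral_finsetSum fun i _ =>
    Continuous.intervalIntegrable (by fun_prop) _ _]
  refine Finset.sum_eq_zero fun i hi => ?_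
  have hik : i < k := by
    have := (le_degree_of_mem_supp i hi).trans_lt hφ
    exact_mod_cast this
  simp only [mul_left_comm (w _)]
  rw [intervalIntegral.integral_const_mul, h i hik, mul_zero]

/-- A polynomial of degree at most `k` is a fixed linear combination of its first `k + 1`
moments. -/
lemma exists_moment_dual_basis (k : ℕ) {a b : ℝ} (hab : a < b) :
    ∃ B : Fin (k + 1) → ℝ[X], (∀ j, (B j).natDegree ≤ k) ∧
      ∀ p : ℝ[X], p.natDegree ≤ k →
        p = ∑ j : Fin (k + 1), C (∫ x in a..b, p.eval x * x ^ (j : ℕ)) * B j := by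
  obtain ⟨B, h1, -, h3⟩ := exists_dual_basis (ι := Fin (k + 1)) (k := k) (by simp)
    (fun j => momentMap a b (X ^ (j : ℕ))) (by
      intro p hp h
      refine eq_zero_of_integral_sq_eq_zero hab
        (integral_mul_poly_eq_zero (k := k + 1) p.continuous (fun j hj => ?_)
          (by
            have := natDegree_le_iff_degree_le.1 hp
            exact this.trans_lt (by exact_mod_cast Nat.lt_succ_self k)))
      have := h ⟨j, hj⟩
      simpa [momentMap] using this)
  refine ⟨B, h1, fun p hp => ?_⟩
  have := h3 p hp
  simpa [momentMap] using this

/-- The derivative of `‖p(t)‖²` for a curve of polynomials of degree at most `k` all of whose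
moments are differentiable. -/
lemma hasDerivWithinAt_integral_sq {k : ℕ} {a b : ℝ} (hab : a < b) {s : Set ℝ} {t : ℝ}
    (hs : UniqueDiffWithinAt ℝ s t) (hts : t ∈ s) {p : ℝ → ℝ[X]} {D : ℝ[X] → ℝ}
    (hp : ∀ r ∈ s, (p r).natDegree ≤ k)
    (hD : ∀ φ : ℝ[X], φ.natDegree ≤ k →
      HasDerivWithinAt (fun r => ∫ x in a..b, (p r).eval x * φ.eval x) (D φ) s t) :
    HasDerivWithinAt (fun r => ∫ x in a..b, (p r).eval x * (p r).eval x) (2 * D (p t)) s t := by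
  obtain ⟨B, hB, hrep⟩ := exists_moment_dual_basis k hab
  set c : Fin (k + 1) → ℝ → ℝ := fun j r => ∫ x in a..b, (p r).eval x * x ^ (j : ℕ) with hc
  have hX : ∀ j : Fin (k + 1), (X ^ (j : ℕ) : ℝ[X]).natDegree ≤ k := fun j =>
    (natDegree_X_pow_le _).trans (Nat.lt_succ_iff.1 j.2)
  have hcd : ∀ j, HasDerivWithinAt (c j) (D (X ^ (j : ℕ))) s t := fun j => by
    simpa using hD _ (hX j)
  have expand : ∀ r ∈ s, ∀ q : ℝ[X], ∫ x in a..b, (p r).eval x * q.eval x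
      = ∑ j, c j r * ∫ x in a..b, (B j).eval x * q.eval x := by
    intro r hr q
    have h := hrep (p r) (hp r hr)
    have : ∀ x, (p r).eval x * q.eval x = ∑ j, c j r * ((B j).eval x * q.eval x) := by
      intro x
      conv_lhs => rw [h]
      simp only [eval_finsetSum, eval_mul, eval_C, Finset.sum_mul, hc, mul_assoc]
    simp only [this]
    rw [intervalIntegral.integral_finsetSum fun i _ =>
      Continuous.intervalIntegrable (by fun_prop) _ _]
    simp only [intervalIntegral.integral_const_mul]
  -- Both expansions of `∫ p(r) p(t)` are differentiated in `r`.
  have e1 : D (p t) = ∑ j : Fin (k + 1), D (X ^ (j : ℕ)) * ∫ x in a..b, (B j).eval x * (p t).eval x := by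
    refine hs.eq_deriv _ (hD _ (hp t hts)) ?_
    refine (HasDerivWithinAt.fun_sum (u := Finset.univ)
      fun (j : Fin (k + 1)) _ => (hcd j).mul_const (∫ x in a..b, (B j).eval x * (p t).eval x)).congr ?_ ?_
    · exact fun r hr => expand r hr _
    · exact expand t hts _
  have swap : ∀ q r : ℝ[X], ∫ x in a..b, q.eval x * r.eval x = ∫ x in a..b, r.eval x * q.eval x :=
    fun q r => by simp only [mul_comm]
  have e2 : D (p t) = ∑ j, c j t * D (B j) := by
    refine hs.eq_deriv _ (hD _ (hp t hts)) ?_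
    refine (HasDerivWithinAt.fun_sum (u := Finset.univ)
      fun (j : Fin (k + 1)) _ => (hD _ (hB j)).const_mul (c j t)).congr ?_ ?_
    · intro r hr
      rw [swap, expand t hts]
      exact Finset.sum_congr rfl fun j _ => by rw [swap]
    · rw [expand t hts]
      exact Finset.sum_congr rfl fun j _ => by rw [swap]
  have h := HasDerivWithinAt.fun_sum (u := Finset.univ)
    fun (j : Fin (k + 1)) _ => (hcd j).fun_mul (hD _ (hB j))
  refine (h.congr ?_ ?_).congr_deriv ?_
  · intro r hr
    rw [expand r hr]
    exact Finset.sum_congr rfl fun j _ => by rw [swap]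
  · rw [expand t hts]
    exact Finset.sum_congr rfl fun j _ => by rw [swap]
  · rw [Finset.sum_add_distrib, ← e2, two_mul]
    congr 1
    rw [e1]
    exact Finset.sum_congr rfl fun j _ => by rw [swap]

/-- The data that determine the Radau projection on the reference cell `[0, 1]`: the value at the
endpoint `σ` and the moments of order less than `k`. -/
noncomputable def radauData (k : ℕ) (σ : ℝ) (w : ℝ → ℝ) : Option (Fin k) → ℝ
  | none => w σ
  | some j => ∫ s in (0 : ℝ)..1, w s * s ^ (j : ℕ)

/-- If the data of `p` vanish, then `p = (X - σ) q` is orthogonal to `q`, so that the integral of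
`(s - σ) q(s)²`, which has a constant sign on `[0, 1]`, vanishes. -/
lemma radauData_unisolvent {k : ℕ} {σ : ℝ} (hσ : σ = 0 ∨ σ = 1) {p : ℝ[X]}
    (hp : p.natDegree ≤ k) (h : ∀ i, radauData k σ (fun s => p.eval s) i = 0) : p = 0 := by
  by_contra hp0
  have hroot : p.eval σ = 0 := h none
  obtain ⟨q, hq⟩ := dvd_iff_isRoot.2 hroot
  have hq0 : q ≠ 0 := by rintro rfl; simp at hq; exact hp0 hq
  have hdeg : q.degree < k := by
    have h1 : p.natDegree = 1 + q.natDegree := by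
      rw [hq, natDegree_mul (X_sub_C_ne_zero σ) hq0, natDegree_X_sub_C]
    rw [degree_eq_natDegree hq0]
    exact_mod_cast (by omega : q.natDegree < k)
  have hint : ∫ x in (0 : ℝ)..1, p.eval x * q.eval x = 0 :=
    integral_mul_poly_eq_zero p.continuous (fun j hj => h (some ⟨j, hj⟩)) hdeg
  obtain ⟨c, hc, hpc⟩ := exists_eval_ne_zero (mul_ne_zero hp0 hq0) (zero_lt_one' ℝ)
  have hform : ∀ x, (1 - 2 * σ) * (p.eval x * q.eval x)
      = ((1 - 2 * σ) * (x - σ)) * q.eval x ^ 2 := by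
    intro x; rw [hq]; simp only [eval_mul, eval_sub, eval_X, eval_C]; ring
  have hnn : ∀ x ∈ Icc (0 : ℝ) 1, 0 ≤ (1 - 2 * σ) * (p.eval x * q.eval x) := by
    intro x hx
    rw [hform]
    refine mul_nonneg ?_ (sq_nonneg _)
    rcases hσ with rfl | rfl
    · linarith [hx.1]
    · linarith [hx.2]
  have hpos := intervalIntegral.integral_pos
    (f := fun x => (1 - 2 * σ) * (p.eval x * q.eval x)) (zero_lt_one' ℝ) (by fun_prop)
    (fun x hx => hnn x (Ioc_subset_Icc_self hx)) ⟨c, hc, (hnn c hc).lt_of_ne' (by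
      rw [eval_mul] at hpc
      refine mul_ne_zero ?_ hpc
      rcases hσ with rfl | rfl <;> norm_num)⟩
  rw [intervalIntegral.integral_const_mul, hint, mul_zero] at hpos
  exact lt_irrefl _ hpos

lemma exists_radau_basis (k : ℕ) {σ : ℝ} (hσ : σ = 0 ∨ σ = 1) :
    ∃ B : Option (Fin k) → ℝ[X], (∀ j, (B j).natDegree ≤ k) ∧
      (∀ i j, radauData k σ (fun s => (B j).eval s) i = if i = j then 1 else 0) ∧
      ∀ p : ℝ[X], p.natDegree ≤ k → p = ∑ j, C (radauData k σ (fun s => p.eval s) j) * B j := by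
  let ℓ : Option (Fin k) → ℝ[X] →ₗ[ℝ] ℝ
    | none => leval σ
    | some j => momentMap 0 1 (X ^ (j : ℕ))
  have hℓ : ∀ i p, ℓ i p = radauData k σ (fun s => p.eval s) i := by
    rintro (_ | j) p
    · rfl
    · simp [ℓ, momentMap, radauData]
  obtain ⟨B, h1, h2, h3⟩ := exists_dual_basis (k := k) (by simp) ℓ
    (fun p hp h => radauData_unisolvent hσ hp fun i => by rw [← hℓ]; exact h i)
  exact ⟨B, h1, fun i j => by rw [← hℓ]; exact h2 i j, fun p hp => by
    simp only [← hℓ]; exact h3 p hp⟩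

end Radau

section RadauProjection

open Polynomial

/-- The time derivative of a moment of a travelling profile. -/
lemma hasDerivAt_integral_translate {g g' : ℝ → ℝ} (hg : ∀ x, HasDerivAt g (g' x) x)
    (hg' : Continuous g') {M : ℝ} (hM : ∀ x, |g' x| ≤ M) {f ψ : ℝ → ℝ} (hf : Continuous f)
    (hψ : Continuous ψ) (c d v t : ℝ) :
    HasDerivAt (fun t => ∫ s in c..d, g (f s + v * t) * ψ s)
      (v * ∫ s in c..d, g' (f s + v * t) * ψ s) t := by
  have hgc : Continuous g := continuous_iff_continuousAt.2 fun x => (hg x).continuousAt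
  have h := (intervalIntegral.hasDerivAt_integral_of_dominated_loc_of_deriv_le
    (μ := volume) (a := c) (b := d) (x₀ := t) (s := univ) (bound := fun s => |v| * M * |ψ s|)
    (F := fun t s => g (f s + v * t) * ψ s) (F' := fun t s => v * (g' (f s + v * t) * ψ s))
    Filter.univ_mem ?_ ?_ ?_ ?_ ?_ ?_).2
  · rwa [intervalIntegral.integral_const_mul] at h
  · exact Filter.Eventually.of_forall fun x => Continuous.aestronglyMeasurable (by fun_prop)
  · exact Continuous.intervalIntegrable (by fun_prop) _ _
  · exact Continuous.aestronglyMeasurable (by fun_prop)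
  · refine Filter.Eventually.of_forall fun s _ x _ => ?_
    rw [Real.norm_eq_abs, abs_mul, abs_mul, mul_assoc]
    gcongr
    exact hM _
  · exact Continuous.intervalIntegrable (by fun_prop) _ _
  · refine Filter.Eventually.of_forall fun s _ x _ => ?_
    have h1 : HasDerivAt (fun x => f s + v * x) v x := by
      simpa using ((hasDerivAt_id x).const_mul v).const_add (f s)
    have h2 := ((hg (f s + v * x)).comp x h1).mul_const (ψ s)
    exact h2.congr_deriv (by ring)

/-- `Q` is a projection onto the polynomials of degree at most `k` on the cell `[a, b]` which keeps
the value at the endpoint `e` and the moments of order less than `k`, has an approximation error of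
at most `K` times the best one in the maximum norm, and commutes with the time derivative of
travelling profiles. -/
structure IsRadauProjection (k : ℕ) (K a b e : ℝ) (Q : (ℝ → ℝ) → ℝ[X]) : Prop where
  natDegree_le : ∀ w, (Q w).natDegree ≤ k
  eval_end : ∀ w, (Q w).eval e = w e
  orthogonal : ∀ w, Continuous w → ∀ φ : ℝ[X], φ.degree < k →
    ∫ x in a..b, ((Q w).eval x - w x) * φ.eval x = 0
  error : ∀ w, Continuous w → ∀ p : ℝ[X], p.natDegree ≤ k → ∀ ε,
    (∀ x ∈ Icc a b, |w x - p.eval x| ≤ ε) → ∀ x ∈ Icc a b, |(Q w).eval x - w x| ≤ K * ε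
  hasDerivAt : ∀ g g' : ℝ → ℝ, (∀ x, HasDerivAt g (g' x) x) → Continuous g' →
    (∃ M, ∀ x, |g' x| ≤ M) → ∀ (v t : ℝ) (φ : ℝ[X]),
    HasDerivAt (fun t => ∫ x in a..b, (Q fun x => g (x + v * t)).eval x * φ.eval x)
      (v * ∫ x in a..b, (Q fun x => g' (x + v * t)).eval x * φ.eval x) t

lemma radauData_sub {k : ℕ} {σ : ℝ} {w z : ℝ → ℝ} (hw : Continuous w) (hz : Continuous z)
    (i : Option (Fin k)) :
    radauData k σ (fun s => w s - z s) i = radauData k σ w i - radauData k σ z i := by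
  cases i with
  | none => rfl
  | some j =>
    simp only [radauData, sub_mul]
    exact intervalIntegral.integral_sub (Continuous.intervalIntegrable (by fun_prop) _ _)
      (Continuous.intervalIntegrable (by fun_prop) _ _)

lemma radauData_sum {k : ℕ} {σ : ℝ} {ι : Type*} [Fintype ι] (c : ι → ℝ) {w : ι → ℝ → ℝ}
    (hw : ∀ j, Continuous (w j)) (i : Option (Fin k)) :
    radauData k σ (fun s => ∑ j, c j * w j s) i = ∑ j, c j * radauData k σ (w j) i := by
  cases i with
  | none => rfl
  | some j =>
    simp only [radauData, Finset.sum_mul, mul_assoc]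
    rw [intervalIntegral.integral_finsetSum fun i _ => by
      have := hw i
      exact Continuous.intervalIntegrable (by fun_prop) _ _]
    simp only [intervalIntegral.integral_const_mul]

lemma abs_radauData_le {k : ℕ} {σ : ℝ} (hσ : σ = 0 ∨ σ = 1) {w : ℝ → ℝ}
    {ε : ℝ} (h : ∀ s ∈ Icc (0 : ℝ) 1, |w s| ≤ ε) (i : Option (Fin k)) :
    |radauData k σ w i| ≤ ε := by
  cases i with
  | none => exact h σ (by rcases hσ with rfl | rfl <;> simp)
  | some j =>
    have := intervalIntegral.norm_integral_le_of_norm_le_const (a := 0) (b := 1) (C := ε)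
      (f := fun s => w s * s ^ (j : ℕ)) (by
        intro s hs
        rw [uIoc_of_le zero_le_one] at hs
        have h1 := h s (Ioc_subset_Icc_self hs)
        have h2 : |s ^ (j : ℕ)| ≤ 1 := by
          rw [abs_pow, abs_of_pos hs.1]
          exact pow_le_one₀ hs.1.le hs.2
        rw [Real.norm_eq_abs, abs_mul]
        calc |w s| * |s ^ (j : ℕ)| ≤ ε * 1 :=
              mul_le_mul h1 h2 (abs_nonneg _) ((abs_nonneg _).trans h1)
          _ = ε := mul_one ε)
    simpa [radauData] using this

lemma hasDerivAt_radauData {k : ℕ} {σ : ℝ} {g g' : ℝ → ℝ} (hg : ∀ x, HasDerivAt g (g' x) x)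
    (hg' : Continuous g') {M : ℝ} (hM : ∀ x, |g' x| ≤ M) {f : ℝ → ℝ} (hf : Continuous f)
    (v t : ℝ) (i : Option (Fin k)) :
    HasDerivAt (fun t => radauData k σ (fun s => g (f s + v * t)) i)
      (v * radauData k σ (fun s => g' (f s + v * t)) i) t := by
  cases i with
  | none =>
    have h1 : HasDerivAt (fun x => f σ + v * x) v t := by
      simpa using ((hasDerivAt_id t).const_mul v).const_add (f σ)
    exact ((hg (f σ + v * t)).comp t h1).congr_deriv (by simp only [radauData]; ring)
  | some j => exact hasDerivAt_integral_translate hg hg' hM hf (by fun_prop) 0 1 v t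

/-- The Radau projection on `[a, b]`, transported from the reference cell by an affine map. -/
lemma exists_isRadauProjection_of_reference (k : ℕ) {σ : ℝ} (hσ : σ = 0 ∨ σ = 1) :
    ∃ K > 0, ∀ a b : ℝ, a < b →
      ∃ Q, IsRadauProjection k K a b (a + (b - a) * σ) Q := by
  obtain ⟨B, hBd, hBdual, hBrep⟩ := exists_radau_basis k hσ
  have hbound : ∃ c ≥ 0, ∀ s ∈ Icc (0 : ℝ) 1, ∑ j, |(B j).eval s| ≤ c := by
    obtain ⟨c, hc⟩ := (isCompact_Icc (a := (0 : ℝ)) (b := 1)).exists_bound_of_continuousOn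
      (f := fun s => ∑ j, |(B j).eval s|) (by fun_prop)
    refine ⟨c, (norm_nonneg _).trans (hc 0 (by simp)), fun s hs => (le_abs_self _).trans (hc s hs)⟩
  obtain ⟨c, hc0, hc⟩ := hbound
  refine ⟨c + 1, by positivity, fun a b hab => ?_⟩
  have hba : b - a ≠ 0 := (sub_pos.2 hab).ne'
  set A : ℝ[X] := C (b - a)⁻¹ * (X - C a) with hA
  have hAe : ∀ x, A.eval x = (b - a)⁻¹ * (x - a) := fun x => by simp [hA]
  set F : ℝ → ℝ := fun s => a + (b - a) * s with hF
  have hAF : ∀ s, A.eval (F s) = s := fun s => by rw [hAe, hF]; field_simp; ring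
  have hFA : ∀ x, F (A.eval x) = x := fun x => by rw [hAe, hF]; field_simp; ring
  have hFc : Continuous F := by fun_prop
  have hAmem : ∀ x ∈ Icc a b, A.eval x ∈ Icc (0 : ℝ) 1 := by
    intro x hx
    rw [hAe, ← div_eq_inv_mul]
    exact ⟨div_nonneg (by linarith [hx.1]) (by linarith),
      (div_le_one (by linarith)).2 (by linarith [hx.2])⟩
  have hFmem : ∀ s ∈ Icc (0 : ℝ) 1, F s ∈ Icc a b := by
    intro s hs
    simp only [hF]
    constructor <;> nlinarith [hs.1, hs.2]
  let Q : (ℝ → ℝ) → ℝ[X] := fun w => ∑ j, C (radauData k σ (fun s => w (F s)) j) * (B j).comp A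
  have hQe : ∀ w x, (Q w).eval x = ∑ j, radauData k σ (fun s => w (F s)) j * (B j).eval (A.eval x) :=
    fun w x => by simp only [Q, eval_finsetSum, eval_mul, eval_C, eval_comp]
  have hQd : ∀ w i, radauData k σ (fun s => (Q w).eval (F s)) i
      = radauData k σ (fun s => w (F s)) i := by
    intro w i
    simp only [hQe, hAF]
    rw [radauData_sum _ fun j => (B j).continuous]
    simp only [hBdual, mul_ite, mul_one, mul_zero, Finset.sum_ite_eq, Finset.mem_univ, if_true]
  have hcomp : ∀ φ : ℝ[X], ∃ ψ : ℝ[X], ψ.natDegree ≤ φ.natDegree ∧ ∀ s, ψ.eval s = φ.eval (F s) := by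
    intro φ
    refine ⟨φ.comp (C (b - a) * X + C a), ?_, fun s => by simp [hF, add_comm]⟩
    refine natDegree_comp_le.trans ?_
    calc φ.natDegree * (C (b - a) * X + C a).natDegree ≤ φ.natDegree * 1 :=
          Nat.mul_le_mul_left _ natDegree_linear_le
      _ = φ.natDegree := mul_one _
  refine ⟨Q, ?_, ?_, ?_, ?_, ?_⟩
  · intro w
    refine natDegree_sum_le_of_forall_le _ _ fun j _ => (natDegree_C_mul_le _ _).trans ?_
    refine natDegree_comp_le.trans ?_
    calc (B j).natDegree * A.natDegree ≤ k * 1 :=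
          Nat.mul_le_mul (hBd j) ((natDegree_C_mul_le _ _).trans (natDegree_X_sub_C_le a))
      _ = k := mul_one k
  · intro w
    exact hQd w none
  · intro w hw φ hφ
    obtain ⟨ψ, hψd, hψ⟩ := hcomp φ
    have hψk : ψ.degree < k := by
      by_cases hφ0 : φ = 0
      · have : ψ = 0 := Polynomial.funext fun s => by rw [hψ, hφ0]; simp
        rw [this, degree_zero]; exact WithBot.bot_lt_coe k
      · rw [degree_eq_natDegree hφ0] at hφ
        exact degree_le_natDegree.trans_lt (lt_of_le_of_lt (by exact_mod_cast hψd) hφ)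
    have h0 : ∫ s in (0 : ℝ)..1, ((Q w).eval (F s) - w (F s)) * ψ.eval s = 0 := by
      refine integral_mul_poly_eq_zero (by fun_prop) (fun j hj => ?_) hψk
      have := radauData_sub (k := k) (σ := σ) (w := fun s => (Q w).eval (F s))
        (z := fun s => w (F s)) (by fun_prop) (by fun_prop) (some ⟨j, hj⟩)
      rw [hQd, sub_self] at this
      exact this
    have h1 := intervalIntegral.integral_comp_mul_add (E := ℝ) (a := 0) (b := 1)
      (fun x => ((Q w).eval x - w x) * φ.eval x) hba a
    simp only [mul_zero, zero_add, mul_one, sub_add_cancel] at h1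
    have h2 : ∫ s in (0 : ℝ)..1, ((Q w).eval ((b - a) * s + a) - w ((b - a) * s + a))
        * φ.eval ((b - a) * s + a) = 0 := by
      simp only [hψ, hF, add_comm a] at h0
      exact h0
    rw [h2] at h1
    exact (smul_eq_zero.1 h1.symm).resolve_left (inv_ne_zero hba)
  · intro w hw p hp ε hε x hx
    obtain ⟨ψ, hψd, hψ⟩ := hcomp p
    have hpx : p.eval x = ∑ j, radauData k σ (fun s => p.eval (F s)) j * (B j).eval (A.eval x) := by
      have h1 := congrArg (fun q => q.eval (A.eval x)) (hBrep ψ (hψd.trans hp))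
      simp only [eval_finsetSum, eval_mul, eval_C, hψ, hFA] at h1
      exact h1
    have hε0 : 0 ≤ ε := (abs_nonneg _).trans (hε x hx)
    have h1 : |(Q w).eval x - p.eval x| ≤ c * ε := by
      rw [hQe, hpx, ← Finset.sum_sub_distrib]
      calc |∑ j, (radauData k σ (fun s => w (F s)) j * (B j).eval (A.eval x)
              - radauData k σ (fun s => p.eval (F s)) j * (B j).eval (A.eval x))|
          ≤ ∑ j, ε * |(B j).eval (A.eval x)| := by
            refine (Finset.abs_sum_le_sum_abs _ _).trans (Finset.sum_le_sum fun j _ => ?_)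
            rw [← sub_mul, abs_mul, ← radauData_sub (by fun_prop) (by fun_prop)]
            gcongr
            exact abs_radauData_le hσ (fun s hs => hε _ (hFmem s hs)) j
        _ = (∑ j, |(B j).eval (A.eval x)|) * ε := by rw [← Finset.mul_sum, mul_comm]
        _ ≤ c * ε := by gcongr; exact hc _ (hAmem x hx)
    have h2 := hε x hx
    rw [abs_sub_comm] at h2
    calc |(Q w).eval x - w x| ≤ |(Q w).eval x - p.eval x| + |p.eval x - w x| :=
          abs_sub_le _ _ _
      _ ≤ (c + 1) * ε := by linarith
  · rintro g g' hg hg' ⟨M, hM⟩ v t φ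
    have hexp : ∀ w : ℝ → ℝ, ∫ x in a..b, (Q w).eval x * φ.eval x
        = ∑ j, radauData k σ (fun s => w (F s)) j
            * ∫ x in a..b, (B j).eval (A.eval x) * φ.eval x := by
      intro w
      simp only [hQe, Finset.sum_mul, mul_assoc]
      rw [intervalIntegral.integral_finsetSum fun i _ =>
        Continuous.intervalIntegrable (by fun_prop) _ _]
      simp only [intervalIntegral.integral_const_mul]
    simp only [hexp, Finset.mul_sum]
    refine HasDerivAt.fun_sum fun j _ => ?_
    exact ((hasDerivAt_radauData hg hg' hM hFc v t j).mul_const _).congr_deriv (by ring)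

/-- Radau projections exist on every cell, with a constant that depends on the degree only. -/
theorem exists_isRadauProjection (k : ℕ) :
    ∃ K > 0, ∀ a b e : ℝ, a < b → (e = a ∨ e = b) → ∃ Q, IsRadauProjection k K a b e Q := by
  obtain ⟨K₀, h₀, H₀⟩ := exists_isRadauProjection_of_reference k (σ := 0) (Or.inl rfl)
  obtain ⟨K₁, h₁, H₁⟩ := exists_isRadauProjection_of_reference k (σ := 1) (Or.inr rfl)
  have mono : ∀ {K K' a b e Q}, K ≤ K' → a < b → IsRadauProjection k K a b e Q →
      IsRadauProjection k K' a b e Q := by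
    intro K K' a b e Q hK hab h
    refine ⟨h.1, h.2, h.3, fun w hw p hp ε hε x hx => (h.4 w hw p hp ε hε x hx).trans ?_, h.5⟩
    exact mul_le_mul_of_nonneg_right hK ((abs_nonneg _).trans (hε x hx))
  refine ⟨max K₀ K₁, lt_max_of_lt_left h₀, fun a b e hab he => ?_⟩
  rcases he with rfl | rfl
  · obtain ⟨Q, hQ⟩ := H₀ e b hab
    rw [mul_zero, add_zero] at hQ
    exact ⟨Q, mono (le_max_left _ _) hab hQ⟩
  · obtain ⟨Q, hQ⟩ := H₁ a e hab
    rw [mul_one, add_sub_cancel] at hQ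
    exact ⟨Q, mono (le_max_right _ _) hab hQ⟩

/-! ### Taylor approximation -/

/-- Polynomials have polynomial antiderivatives. -/
lemma exists_derivative_eq (p : ℝ[X]) :
    ∃ q : ℝ[X], derivative q = p ∧ q.natDegree ≤ p.natDegree + 1 := by
  refine ⟨∑ i ∈ Finset.range (p.natDegree + 1), C (p.coeff i / (i + 1)) * X ^ (i + 1), ?_, ?_⟩
  · conv_rhs => rw [p.as_sum_range_C_mul_X_pow]
    rw [derivative_sum]
    refine Finset.sum_congr rfl fun i _ => ?_
    rw [derivative_C_mul_X_pow]
    congr 2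
    push_cast
    field_simp
  · refine natDegree_sum_le_of_forall_le _ _ fun i hi => ?_
    refine (natDegree_C_mul_X_pow_le _ _).trans ?_
    have := Finset.mem_range.1 hi
    omega

/-- A function with an integrable weak derivative `D` of order `n + 1` is approximated on a cell by
a polynomial of degree at most `n`. -/
lemma exists_taylor_approx (n : ℕ) {D : ℝ → ℝ} (hDi : ∀ x y, IntervalIntegrable D volume x y)
    {a b : ℝ} (hab : a < b) :
    ∀ G : ℕ → ℝ → ℝ, (∀ j < n, ∀ x, HasDerivAt (G j) (G (j + 1) x) x) →
      (∀ x y, G n y - G n x = ∫ s in x..y, D s) →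
      ∃ p : ℝ[X], p.natDegree ≤ n ∧
        ∀ x ∈ Icc a b, |G 0 x - p.eval x| ≤ (b - a) ^ n * ∫ s in a..b, |D s| := by
  induction n with
  | zero =>
    intro G _ hD
    refine ⟨C (G 0 a), by simp, fun x hx => ?_⟩
    rw [eval_C, hD a x, pow_zero, one_mul]
    refine (intervalIntegral.abs_integral_le_integral_abs hx.1).trans ?_
    rw [← intervalIntegral.integral_add_adjacent_intervals (hDi a x).abs (hDi x b).abs]
    linarith [intervalIntegral.integral_nonneg (μ := volume) (f := fun s => |D s|) hx.2 fun _ _ => abs_nonneg _]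
  | succ n ih =>
    intro G hG hD
    obtain ⟨p, hp, hpb⟩ := ih (fun j => G (j + 1)) (fun j hj => hG (j + 1) (by omega)) hD
    obtain ⟨q, hq, hqd⟩ := exists_derivative_eq p
    refine ⟨q + C (G 0 a - q.eval a), ?_, fun x hx => ?_⟩
    · refine (natDegree_add_C).le.trans (hqd.trans (by omega))
    · have hder : ∀ y ∈ Icc a b, HasDerivWithinAt
          (fun y => G 0 y - (q + C (G 0 a - q.eval a)).eval y) (G 1 y - p.eval y) (Icc a b) y := by
        intro y _
        have h1 := (hG 0 (by omega) y).sub ((q + C (G 0 a - q.eval a)).hasDerivAt y)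
        rw [derivative_add, derivative_C, add_zero, hq] at h1
        exact h1.hasDerivWithinAt
      have h := (convex_Icc a b).norm_image_sub_le_of_norm_hasDerivWithin_le hder
        (fun y hy => hpb y hy) (left_mem_Icc.2 hab.le) hx
      have h0 : G 0 a - (q + C (G 0 a - q.eval a)).eval a = 0 := by simp
      rw [h0, sub_zero, Real.norm_eq_abs, Real.norm_eq_abs,
        abs_of_nonneg (sub_nonneg.2 hx.1)] at h
      refine h.trans ?_
      have hI : 0 ≤ ∫ s in a..b, |D s| :=
        intervalIntegral.integral_nonneg hab.le fun _ _ => abs_nonneg _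
      calc (b - a) ^ n * (∫ s in a..b, |D s|) * (x - a)
          ≤ (b - a) ^ n * (∫ s in a..b, |D s|) * (b - a) := by
            have : 0 ≤ (b - a) ^ n := pow_nonneg (by linarith) _
            gcongr
            exact hx.2
        _ = (b - a) ^ (n + 1) * ∫ s in a..b, |D s| := by ring

/-- The Cauchy-Schwarz inequality, from the variance of `|D|`. -/
lemma sq_integral_abs_le {D : ℝ → ℝ} {a b : ℝ} (hab : a < b) (h1 : IntervalIntegrable D volume a b)
    (h2 : IntervalIntegrable (fun x => D x ^ 2) volume a b) :
    (∫ s in a..b, |D s|) ^ 2 ≤ (b - a) * ∫ s in a..b, D s ^ 2 := by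
  set I := ∫ s in a..b, |D s| with hI
  have hba : 0 < b - a := sub_pos.2 hab
  have h : 0 ≤ ∫ s in a..b, (|D s| - I / (b - a)) ^ 2 :=
    intervalIntegral.integral_nonneg hab.le fun _ _ => sq_nonneg _
  have e : ∀ s, (|D s| - I / (b - a)) ^ 2
      = D s ^ 2 - 2 * (I / (b - a)) * |D s| + (I / (b - a)) ^ 2 := fun s => by
    rw [sub_sq, sq_abs]; ring
  simp only [e] at h
  rw [intervalIntegral.integral_add (h2.sub (h1.abs.const_mul _)) intervalIntegrable_const,
    intervalIntegral.integral_sub h2 (h1.abs.const_mul _), intervalIntegral.integral_const_mul,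
    intervalIntegral.integral_const, ← hI, smul_eq_mul] at h
  have e2 : (∫ s in a..b, D s ^ 2) - 2 * (I / (b - a)) * I + (b - a) * (I / (b - a)) ^ 2
      = (∫ s in a..b, D s ^ 2) - I ^ 2 / (b - a) := by field_simp; ring
  rw [e2, sub_nonneg, div_le_iff₀ hba] at h
  linarith

/-- The approximation error of the Radau projection in `L²` of a cell. -/
lemma IsRadauProjection.integral_sq_error_le {k : ℕ} {K a b e : ℝ} {Q : (ℝ → ℝ) → ℝ[X]}
    (hQ : IsRadauProjection k K a b e Q) (hab : a < b) {G : ℕ → ℝ → ℝ} {D : ℝ → ℝ}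
    (hG0 : Continuous (G 0)) (hG : ∀ j < k, ∀ x, HasDerivAt (G j) (G (j + 1) x) x)
    (hD : ∀ x y, G k y - G k x = ∫ s in x..y, D s)
    (hDi : ∀ x y, IntervalIntegrable D volume x y)
    (hD2 : ∀ x y, IntervalIntegrable (fun x => D x ^ 2) volume x y) :
    ∫ x in a..b, ((Q (G 0)).eval x - G 0 x) ^ 2
      ≤ K ^ 2 * (b - a) ^ (2 * (k + 1)) * ∫ x in a..b, D x ^ 2 := by
  obtain ⟨p, hp, hpb⟩ := exists_taylor_approx k hDi hab G hG hD
  have herr := hQ.error (G 0) hG0 p hp _ hpb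
  set I := ∫ s in a..b, |D s| with hI
  have hba : 0 < b - a := sub_pos.2 hab
  have h1 : ∫ x in a..b, ((Q (G 0)).eval x - G 0 x) ^ 2
      ≤ ∫ _ in a..b, (K * ((b - a) ^ k * I)) ^ 2 := by
    refine intervalIntegral.integral_mono_on hab.le
      (Continuous.intervalIntegrable (by fun_prop) _ _) intervalIntegrable_const fun x hx => ?_
    rw [← sq_abs]
    exact pow_le_pow_left₀ (abs_nonneg _) (herr x hx) 2
  refine h1.trans ?_
  rw [intervalIntegral.integral_const, smul_eq_mul]
  have h2 := sq_integral_abs_le hab (hDi a b) (hD2 a b)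
  calc (b - a) * (K * ((b - a) ^ k * I)) ^ 2 = K ^ 2 * (b - a) ^ (2 * k + 1) * I ^ 2 := by ring
    _ ≤ K ^ 2 * (b - a) ^ (2 * k + 1) * ((b - a) * ∫ s in a..b, D s ^ 2) := by gcongr
    _ = _ := by ring

end RadauProjection

/-! ### A Grönwall inequality -/

lemma gronwall_add_const {T R : ℝ} {E E' : ℝ → ℝ}
    (hE : ∀ t ∈ Icc 0 T, HasDerivWithinAt E (E' t) (Icc 0 T) t)
    (hle : ∀ t ∈ Icc 0 T, E' t ≤ E t + R) :
    ∀ t ∈ Icc 0 T, E t + R ≤ Real.exp t * (E 0 + R) := by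
  have hd : ∀ t ∈ Icc 0 T, HasDerivWithinAt (fun t => Real.exp (-t) * (E t + R))
      (Real.exp (-t) * (E' t - (E t + R))) (Icc 0 T) t := by
    intro t ht
    have h1 : HasDerivWithinAt (fun t => Real.exp (-t)) (-Real.exp (-t)) (Icc 0 T) t := by
      simpa using ((hasDerivAt_neg t).exp).hasDerivWithinAt
    exact (h1.fun_mul ((hE t ht).add_const R)).congr_deriv (by ring)
  have hanti : AntitoneOn (fun t => Real.exp (-t) * (E t + R)) (Icc 0 T) := by
    refine antitoneOn_of_hasDerivWithinAt_nonpos (convex_Icc 0 T)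
      (fun t ht => (hd t ht).continuousWithinAt)
      (fun t ht => (hd t (interior_subset ht)).mono interior_subset) fun t ht => ?_
    exact mul_nonpos_of_nonneg_of_nonpos (Real.exp_pos _).le
      (by linarith [hle t (interior_subset ht)])
  intro t ht
  have h := hanti ⟨le_rfl, ht.1.trans ht.2⟩ ht ht.1
  simp only [neg_zero, Real.exp_zero, one_mul] at h
  calc E t + R = Real.exp t * (Real.exp (-t) * (E t + R)) := by
        rw [← mul_assoc, ← Real.exp_add]; simp
    _ ≤ _ := by gcongr

/-! ### Meshes and broken polynomials -/

namespace Mesh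

variable {L : ℝ} (𝒯 : Mesh L)

lemma left_lt_right (i : Fin (𝒯.last + 1)) : 𝒯.left i < 𝒯.right i :=
  𝒯.strictMono Fin.castSucc_lt_succ

lemma length_le_size (i : Fin (𝒯.last + 1)) : 𝒯.right i - 𝒯.left i ≤ 𝒯.size :=
  Finset.le_sup' (fun i => 𝒯.right i - 𝒯.left i) (Finset.mem_univ i)

lemma size_pos : 0 < 𝒯.size :=
  (sub_pos.2 (𝒯.left_lt_right 0)).trans_le (𝒯.length_le_size 0)

lemma right_le_left {i j : Fin (𝒯.last + 1)} (h : i < j) : 𝒯.right i ≤ 𝒯.left j :=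
  𝒯.strictMono.monotone (by
    rw [Fin.le_def, Fin.val_succ, Fin.val_castSucc]
    exact h)

lemma sum_integral_cells {f : ℝ → ℝ} (hf : ∀ a b, IntervalIntegrable f volume a b) :
    ∑ i, ∫ x in 𝒯.left i..𝒯.right i, f x = ∫ x in (0 : ℝ)..L, f x := by
  let a : ℕ → ℝ := fun n => if h : n < 𝒯.last + 2 then 𝒯.node ⟨n, h⟩ else 0
  have h := intervalIntegral.sum_integral_adjacent_intervals (a := a) (n := 𝒯.last + 1) (f := f)
    (μ := volume) fun n _ => hf _ _
  have h0 : a 0 = 0 := by simpa [a] using 𝒯.node_first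
  have h1 : a (𝒯.last + 1) = L := by
    simp only [a, dif_pos (Nat.lt_succ_self (𝒯.last + 1))]
    exact 𝒯.node_last
  rw [h0, h1, Finset.sum_range] at h
  rw [← h]
  refine Finset.sum_congr rfl fun i _ => ?_
  have e1 : a i = 𝒯.left i := by
    simp only [a, dif_pos (i.2.trans (Nat.lt_succ_self _))]
    rfl
  have e2 : a (i + 1) = 𝒯.right i := by
    simp only [a, dif_pos (Nat.succ_lt_succ i.2)]
    rfl
  rw [e1, e2]

lemma toFun_of_mem (p : 𝒯.Broken) {i : Fin (𝒯.last + 1)} {x : ℝ}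
    (hx : x ∈ Ico (𝒯.left i) (𝒯.right i)) : 𝒯.toFun p x = (p i).eval x := by
  unfold toFun
  rw [Finset.sum_eq_single i]
  · rw [indicator_of_mem hx]
  · intro j _ hj
    refine indicator_of_notMem (fun hxj => ?_) _
    rcases lt_or_gt_of_ne hj with h | h
    · exact (hxj.2.trans_le (𝒯.right_le_left h)).not_ge hx.1
    · exact (hx.2.trans_le (𝒯.right_le_left h)).not_ge hxj.1
  · simp

lemma memLp_toFun (p : 𝒯.Broken) : MemLp (𝒯.toFun p) 2 (volume.restrict (Ioc 0 L)) := by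
  unfold toFun
  refine memLp_finsetSum _ fun i _ => MemLp.indicator measurableSet_Ico ?_
  rw [memLp_two_iff_integrable_sq (p i).continuous.aestronglyMeasurable]
  exact (((p i).continuous.pow 2).integrableOn_Icc).mono_set Ioc_subset_Icc_self

lemma integral_sq_sub_toFun (hL : 0 < L) {w : ℝ → ℝ} (hw : PerL2 L w) (p : 𝒯.Broken) :
    ∫ x in (0 : ℝ)..L, (w x - 𝒯.toFun p x) ^ 2
      = ∑ i, ∫ x in 𝒯.left i..𝒯.right i, (w x - (p i).eval x) ^ 2 := by
  -- The integrand is replaced by one that is integrable on every interval.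
  have hint : ∀ a b, IntervalIntegrable
      ((Ioc 0 L).indicator fun x => (w x - 𝒯.toFun p x) ^ 2) volume a b := by
    intro a b
    have : Integrable ((Ioc 0 L).indicator fun x => (w x - 𝒯.toFun p x) ^ 2) :=
      (integrable_indicator_iff measurableSet_Ioc).2 (hw.2.sub (𝒯.memLp_toFun p)).integrable_sq
    exact this.intervalIntegrable
  have h1 : ∫ x in (0 : ℝ)..L, (w x - 𝒯.toFun p x) ^ 2
      = ∫ x in (0 : ℝ)..L, (Ioc 0 L).indicator (fun x => (w x - 𝒯.toFun p x) ^ 2) x := by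
    refine intervalIntegral.integral_congr_ae (Filter.Eventually.of_forall fun x hx => ?_)
    rw [uIoc_of_le hL.le] at hx
    rw [indicator_of_mem hx]
  rw [h1, ← 𝒯.sum_integral_cells hint]
  refine Finset.sum_congr rfl fun i _ => ?_
  refine intervalIntegral.integral_congr_Ioo_of_le (𝒯.left_lt_right i).le fun x hx => ?_
  have h0 : 0 ≤ 𝒯.left i := by
    rw [← 𝒯.node_first]; exact 𝒯.strictMono.monotone (Fin.zero_le _)
  have hl : 𝒯.right i ≤ L := by
    conv_rhs => rw [← 𝒯.node_last]
    exact 𝒯.strictMono.monotone (Fin.le_last _)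
  rw [indicator_of_mem (show x ∈ Ioc 0 L from ⟨h0.trans_lt hx.1, hx.2.le.trans hl⟩),
    𝒯.toFun_of_mem p (Ioo_subset_Ico_self hx)]

/-- At the left endpoint of the next cell (cyclically), a periodic function takes its value at the
right endpoint of the cell. -/
lemma periodic_left_add_one {g : ℝ → ℝ} (hg : Function.Periodic g L) (i : Fin (𝒯.last + 1)) :
    g (𝒯.left (i + 1)) = g (𝒯.right i) := by
  induction i using Fin.lastCases with
  | last =>
    rw [Fin.last_add_one]
    have h0 : 𝒯.left 0 = 0 := 𝒯.node_first
    have h1 : 𝒯.right (Fin.last _) = L := 𝒯.node_last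
    rw [h0, h1]
    simpa using (hg 0).symm
  | cast j =>
    rw [Fin.coeSucc_eq_succ]
    rfl

/-- The upwind fluxes dissipate the `L²` norm: after a cyclic shift of the index, half of the
squared jumps at the nodes remain, with the factor `-|a|`. -/
lemma flux_dissipative (a : ℝ) (p : 𝒯.Broken) :
    ∑ i, (𝒯.flux a p i * (p i).eval (𝒯.right i) - 𝒯.flux a p (i - 1) * (p i).eval (𝒯.left i)
      - a * ∫ x in 𝒯.left i..𝒯.right i, (p i).eval x * (p i).derivative.eval x) ≤ 0 := by
  have hint : ∀ i, ∫ x in 𝒯.left i..𝒯.right i, (p i).eval x * (p i).derivative.eval x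
      = ((p i).eval (𝒯.right i) ^ 2 - (p i).eval (𝒯.left i) ^ 2) / 2 := by
    intro i
    have : ∀ x, HasDerivAt (fun x => (p i).eval x ^ 2 / 2)
        ((p i).eval x * (p i).derivative.eval x) x := fun x =>
      (((p i).hasDerivAt x).fun_pow 2 |>.div_const 2).congr_deriv (by norm_num; ring)
    rw [intervalIntegral.integral_eq_sub_of_hasDerivAt (fun x _ => this x)
      (Continuous.intervalIntegrable (by fun_prop) _ _)]
    ring
  have shift : ∀ F : Fin (𝒯.last + 1) → ℝ, ∑ i, F (i - 1) = ∑ i, F i := fun F =>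
    Equiv.sum_comp (Equiv.subRight 1) F
  simp only [hint, flux]
  rcases le_or_gt a 0 with ha | ha
  · simp only [if_pos ha]
    have h := shift fun i => a / 2 * (p i).eval (𝒯.right i) ^ 2
    have e : ∑ i, (a * (p i).eval (𝒯.right i) * (p i).eval (𝒯.right i)
        - a * (p (i - 1)).eval (𝒯.right (i - 1)) * (p i).eval (𝒯.left i)
        - a * (((p i).eval (𝒯.right i) ^ 2 - (p i).eval (𝒯.left i) ^ 2) / 2))
        = ∑ i, a / 2 * ((p (i - 1)).eval (𝒯.right (i - 1)) - (p i).eval (𝒯.left i)) ^ 2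
          + (∑ i, a / 2 * (p i).eval (𝒯.right i) ^ 2
            - ∑ i, a / 2 * (p (i - 1)).eval (𝒯.right (i - 1)) ^ 2) := by
      rw [← Finset.sum_sub_distrib, ← Finset.sum_add_distrib]
      exact Finset.sum_congr rfl fun i _ => by ring
    rw [e, h, sub_self, add_zero]
    exact Finset.sum_nonpos fun i _ => mul_nonpos_of_nonpos_of_nonneg (by linarith) (sq_nonneg _)
  · simp only [if_neg ha.not_ge, sub_add_cancel]
    have h : ∑ i, a / 2 * (p (i + 1)).eval (𝒯.left (i + 1)) ^ 2
        = ∑ i, a / 2 * (p i).eval (𝒯.left i) ^ 2 :=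
      Equiv.sum_comp (Equiv.addRight 1) fun i => a / 2 * (p i).eval (𝒯.left i) ^ 2
    have e : ∑ i, (a * (p (i + 1)).eval (𝒯.left (i + 1)) * (p i).eval (𝒯.right i)
        - a * (p i).eval (𝒯.left i) * (p i).eval (𝒯.left i)
        - a * (((p i).eval (𝒯.right i) ^ 2 - (p i).eval (𝒯.left i) ^ 2) / 2))
        = ∑ i, -(a / 2) * ((p (i + 1)).eval (𝒯.left (i + 1)) - (p i).eval (𝒯.right i)) ^ 2
          + (∑ i, a / 2 * (p (i + 1)).eval (𝒯.left (i + 1)) ^ 2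
            - ∑ i, a / 2 * (p i).eval (𝒯.left i) ^ 2) := by
      rw [← Finset.sum_sub_distrib, ← Finset.sum_add_distrib]
      exact Finset.sum_congr rfl fun i _ => by ring
    rw [e, h, sub_self, add_zero]
    exact Finset.sum_nonpos fun i _ => mul_nonpos_of_nonpos_of_nonneg (by linarith) (sq_nonneg _)

/-- The endpoint of a cell whose value enters the upwind flux. -/
noncomputable def upwindEnd (a : ℝ) (i : Fin (𝒯.last + 1)) : ℝ := if a ≤ 0 then 𝒯.right i else 𝒯.left i

lemma flux_sub (a : ℝ) (p q : 𝒯.Broken) (i : Fin (𝒯.last + 1)) :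
    𝒯.flux a (fun j => p j - q j) i = 𝒯.flux a p i - 𝒯.flux a q i := by
  unfold flux
  split_ifs <;> simp only [Polynomial.eval_sub, mul_sub]

/-- The upwind flux of a broken polynomial that interpolates a periodic function at the upwind
endpoints is the exact flux. -/
lemma flux_of_interpolation {a : ℝ} {p : 𝒯.Broken} {g : ℝ → ℝ} (hg : Function.Periodic g L)
    (hp : ∀ i, (p i).eval (𝒯.upwindEnd a i) = g (𝒯.upwindEnd a i)) (i : Fin (𝒯.last + 1)) :
    𝒯.flux a p i = a * g (𝒯.right i) := by
  unfold flux upwindEnd at *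
  split_ifs at * with h
  · rw [hp]
  · rw [hp, 𝒯.periodic_left_add_one hg]

lemma periodic_right_sub_one {g : ℝ → ℝ} (hg : Function.Periodic g L) (i : Fin (𝒯.last + 1)) :
    g (𝒯.right (i - 1)) = g (𝒯.left i) := by
  rw [← 𝒯.periodic_left_add_one hg (i - 1), sub_add_cancel]

end Mesh

/-! ### The energy estimate for the semidiscrete scheme -/

section Energy

open Polynomial

variable {L T : ℝ} {k : ℕ} {𝒯 : Mesh L} {a : ℝ} {w₀ : ℝ → ℝ} {q : ℝ → 𝒯.Broken}

/-- The error equation of the scheme: the moments of the difference between the DG solution and the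
Radau projection of the exact solution `g(x + a t)`. The residual is the projection error of
`∂_t = a ∂_x` of the exact solution. -/
lemma IsDGSolution.hasDerivWithinAt_error {K : ℝ} (hq : IsDGSolution T k 𝒯 a w₀ q) {g g' : ℝ → ℝ}
    (hg : ∀ x, HasDerivAt g (g' x) x) (hg' : Continuous g') (hM : ∃ M, ∀ x, |g' x| ≤ M)
    (hper : Function.Periodic g L) {Q : Fin (𝒯.last + 1) → (ℝ → ℝ) → ℝ[X]}
    (hQ : ∀ i, IsRadauProjection k K (𝒯.left i) (𝒯.right i) (𝒯.upwindEnd a i) (Q i))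
    {t : ℝ} (ht : t ∈ Icc 0 T) (i : Fin (𝒯.last + 1)) {φ : ℝ[X]} (hφ : φ.natDegree ≤ k) :
    HasDerivWithinAt
      (fun s => ∫ x in 𝒯.left i..𝒯.right i,
        (q s i - Q i fun x => g (x + a * s)).eval x * φ.eval x)
      (𝒯.flux a (fun j => q t j - Q j fun x => g (x + a * t)) i * φ.eval (𝒯.right i)
        - 𝒯.flux a (fun j => q t j - Q j fun x => g (x + a * t)) (i - 1) * φ.eval (𝒯.left i)
        - a * (∫ x in 𝒯.left i..𝒯.right i,
            (q t i - Q i fun x => g (x + a * t)).eval x * φ.derivative.eval x)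
        + a * ∫ x in 𝒯.left i..𝒯.right i,
            (g' (x + a * t) - (Q i fun x => g' (x + a * t)).eval x) * φ.eval x)
      (Icc 0 T) t := by
  have hgc : Continuous g := continuous_iff_continuousAt.2 fun x => (hg x).continuousAt
  have hpt : Function.Periodic (fun x => g (x + a * t)) L := fun x => by
    simp only [add_right_comm x L, hper (x + a * t)]
  have h := (hq.scheme t ht i φ hφ).sub
    ((hQ i).hasDerivAt g g' hg hg' hM a t φ).hasDerivWithinAt
  have ii : ∀ {f : ℝ → ℝ}, Continuous f → IntervalIntegrable f volume (𝒯.left i) (𝒯.right i) :=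
    fun hf => hf.intervalIntegrable _ _
  have key : ∀ p r : ℝ[X], ∀ ψ : ℝ[X], ∫ x in 𝒯.left i..𝒯.right i, (p - r).eval x * ψ.eval x
      = (∫ x in 𝒯.left i..𝒯.right i, p.eval x * ψ.eval x)
        - ∫ x in 𝒯.left i..𝒯.right i, r.eval x * ψ.eval x := by
    intro p r ψ
    simp only [eval_sub, sub_mul]
    exact intervalIntegral.integral_sub (ii (by fun_prop)) (ii (by fun_prop))
  have hflux := 𝒯.flux_of_interpolation (a := a) (p := fun j => Q j fun x => g (x + a * t)) hpt
    fun j => (hQ j).eval_end _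
  have hprev := 𝒯.periodic_right_sub_one hpt i
  -- Against `φ'` the projection may be replaced by the exact solution.
  have horth : ∫ x in 𝒯.left i..𝒯.right i,
      (Q i fun x => g (x + a * t)).eval x * φ.derivative.eval x
      = ∫ x in 𝒯.left i..𝒯.right i, g (x + a * t) * φ.derivative.eval x := by
    have hdeg : φ.derivative.degree < k := by
      by_cases h0 : φ = 0
      · rw [h0, derivative_zero, degree_zero]; exact WithBot.bot_lt_coe k
      · exact (degree_derivative_lt h0).trans_le (natDegree_le_iff_degree_le.1 hφ)
    have := (hQ i).orthogonal (fun x => g (x + a * t)) (by fun_prop) _ hdeg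
    simp only [sub_mul] at this
    rw [intervalIntegral.integral_sub (ii (by fun_prop)) (ii (by fun_prop))] at this
    linarith
  have hparts : ∫ x in 𝒯.left i..𝒯.right i, g (x + a * t) * φ.derivative.eval x
      = g (𝒯.right i + a * t) * φ.eval (𝒯.right i) - g (𝒯.left i + a * t) * φ.eval (𝒯.left i)
        - ∫ x in 𝒯.left i..𝒯.right i, g' (x + a * t) * φ.eval x :=
    intervalIntegral.integral_mul_deriv_eq_deriv_mul
      (fun x _ => (hg (x + a * t)).comp_add_const x (a * t)) (fun x _ => φ.hasDerivAt x)
      (ii (by fun_prop)) (ii (by fun_prop))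
  have hres : ∫ x in 𝒯.left i..𝒯.right i,
      (g' (x + a * t) - (Q i fun x => g' (x + a * t)).eval x) * φ.eval x
      = (∫ x in 𝒯.left i..𝒯.right i, g' (x + a * t) * φ.eval x)
        - ∫ x in 𝒯.left i..𝒯.right i, (Q i fun x => g' (x + a * t)).eval x * φ.eval x := by
    simp only [sub_mul]
    exact intervalIntegral.integral_sub (ii (by fun_prop)) (ii (by fun_prop))
  simp only [key, 𝒯.flux_sub]
  refine h.congr_deriv ?_
  rw [hres, hflux, hflux, hprev, horth, hparts]
  ring

/-- The `L²` stability of the scheme: the distance of the DG solution to the Radau projection of the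
exact solution is controlled by the projection errors `A` of the initial value and `R` of the time
derivative. The fluxes dissipate, and the residual enters through Young's inequality. -/
lemma IsDGSolution.sum_integral_sq_error_le (hT : 0 < T) {K : ℝ}
    (hq : IsDGSolution T k 𝒯 a w₀ q)
    {g g' : ℝ → ℝ} (hw : w₀ =ᵐ[volume] g)
    (hg : ∀ x, HasDerivAt g (g' x) x) (hg' : Continuous g') (hM : ∃ M, ∀ x, |g' x| ≤ M)
    (hper : Function.Periodic g L) {Q : Fin (𝒯.last + 1) → (ℝ → ℝ) → ℝ[X]}
    (hQ : ∀ i, IsRadauProjection k K (𝒯.left i) (𝒯.right i) (𝒯.upwindEnd a i) (Q i))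
    {A R : ℝ}
    (hA : ∑ i, ∫ x in 𝒯.left i..𝒯.right i, ((Q i g).eval x - g x) ^ 2 ≤ A)
    (hR : ∀ t, ∑ i, a ^ 2 * ∫ x in 𝒯.left i..𝒯.right i,
      ((Q i fun x => g' (x + a * t)).eval x - g' (x + a * t)) ^ 2 ≤ R)
    {t : ℝ} (ht : t ∈ Icc 0 T) :
    ∑ i, ∫ x in 𝒯.left i..𝒯.right i, ((q t i - Q i fun x => g (x + a * t)).eval x) ^ 2
      ≤ Real.exp t * (A + R) := by
  have hgc : Continuous g := continuous_iff_continuousAt.2 fun x => (hg x).continuousAt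
  set ξ : ℝ → 𝒯.Broken := fun s i => q s i - Q i fun x => g (x + a * s) with hξ
  have hξd : ∀ s ∈ Icc 0 T, ∀ i, (ξ s i).natDegree ≤ k := fun s hs i =>
    (natDegree_sub_le _ _).trans (max_le (hq.degree s hs i) ((hQ i).natDegree_le _))
  have h0 : (0 : ℝ) ∈ Icc 0 T := ⟨le_rfl, hT.le⟩
  have hud := uniqueDiffOn_Icc hT
  set E : ℝ → ℝ := fun s => ∑ i, ∫ x in 𝒯.left i..𝒯.right i, (ξ s i).eval x * (ξ s i).eval x
    with hE
  have ii : ∀ {f : ℝ → ℝ}, Continuous f → ∀ i,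
      IntervalIntegrable f volume (𝒯.left i) (𝒯.right i) :=
    fun hf i => hf.intervalIntegrable _ _
  have young : ∀ (i : Fin (𝒯.last + 1)) (z : ℝ → ℝ) (p : ℝ[X]), Continuous z →
      2 * ∫ x in 𝒯.left i..𝒯.right i, z x * p.eval x
        ≤ (∫ x in 𝒯.left i..𝒯.right i, z x ^ 2)
          + ∫ x in 𝒯.left i..𝒯.right i, p.eval x * p.eval x := by
    intro i z p hz
    rw [← intervalIntegral.integral_add (ii (by fun_prop) i) (ii (by fun_prop) i),
      ← intervalIntegral.integral_const_mul]
    exact intervalIntegral.integral_mono_on (𝒯.left_lt_right i).le (ii (by fun_prop) i)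
      (ii (by fun_prop) i) fun x _ => by nlinarith [sq_nonneg (z x - p.eval x)]
  -- The initial error is bounded by the projection error.
  have hE0 : E 0 ≤ A := by
    refine le_trans (Finset.sum_le_sum fun i _ => ?_) hA
    have hini := hq.initial i (ξ 0 i) (hξd 0 h0 i)
    have hw' : ∫ x in 𝒯.left i..𝒯.right i, w₀ x * (ξ 0 i).eval x
        = ∫ x in 𝒯.left i..𝒯.right i, g x * (ξ 0 i).eval x := by
      refine intervalIntegral.integral_congr_ae ?_
      filter_upwards [hw] with x hx _
      rw [hx]
    have hξ0 : ∀ x, (ξ 0 i).eval x = (q 0 i).eval x - (Q i g).eval x := fun x => by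
      simp only [hξ, eval_sub, mul_zero, add_zero]
    have h1 : ∫ x in 𝒯.left i..𝒯.right i, (ξ 0 i).eval x * (ξ 0 i).eval x
        = ∫ x in 𝒯.left i..𝒯.right i, (g x - (Q i g).eval x) * (ξ 0 i).eval x := by
      have e1 : ∀ x, (ξ 0 i).eval x * (ξ 0 i).eval x
          = (q 0 i).eval x * (ξ 0 i).eval x - (Q i g).eval x * (ξ 0 i).eval x := fun x => by
        rw [← sub_mul, ← hξ0]
      simp only [e1, sub_mul]
      rw [intervalIntegral.integral_sub (ii (by fun_prop) i) (ii (by fun_prop) i),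
        intervalIntegral.integral_sub (ii (by fun_prop) i) (ii (by fun_prop) i), hini, hw']
    have h2 := young i (fun x => g x - (Q i g).eval x) (ξ 0 i) (by fun_prop)
    simp only [sub_sq_comm (g _)] at h2
    linarith
  set D : ℝ → Fin (𝒯.last + 1) → ℝ := fun s i =>
    𝒯.flux a (ξ s) i * (ξ s i).eval (𝒯.right i) - 𝒯.flux a (ξ s) (i - 1) * (ξ s i).eval (𝒯.left i)
        - a * (∫ x in 𝒯.left i..𝒯.right i, (ξ s i).eval x * (ξ s i).derivative.eval x) with hD
  set ρ : ℝ → Fin (𝒯.last + 1) → ℝ := fun s i => a * ∫ x in 𝒯.left i..𝒯.right i,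
            (g' (x + a * s) - (Q i fun x => g' (x + a * s)).eval x) * (ξ s i).eval x with hρ
  have hEd : ∀ s ∈ Icc 0 T, HasDerivWithinAt E (∑ i, 2 * (D s i + ρ s i)) (Icc 0 T) s := by
    intro s hs
    refine HasDerivWithinAt.fun_sum fun i _ => ?_
    exact hasDerivWithinAt_integral_sq (𝒯.left_lt_right i) (hud s hs) hs
      (fun r hr => hξd r hr i)
      (D := fun φ => 𝒯.flux a (ξ s) i * φ.eval (𝒯.right i)
        - 𝒯.flux a (ξ s) (i - 1) * φ.eval (𝒯.left i)
        - a * (∫ x in 𝒯.left i..𝒯.right i, (ξ s i).eval x * φ.derivative.eval x)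
        + a * ∫ x in 𝒯.left i..𝒯.right i,
            (g' (x + a * s) - (Q i fun x => g' (x + a * s)).eval x) * φ.eval x)
      (fun φ hφ => hq.hasDerivWithinAt_error hg hg' hM hper hQ hs i hφ)
  have hle : ∀ s ∈ Icc 0 T, ∑ i, 2 * (D s i + ρ s i) ≤ E s + R := by
    intro s _
    have hdis : ∑ i, D s i ≤ 0 := 𝒯.flux_dissipative a (ξ s)
    have hρi : ∀ i, 2 * ρ s i ≤ (∫ x in 𝒯.left i..𝒯.right i, (ξ s i).eval x * (ξ s i).eval x)
        + a ^ 2 * ∫ x in 𝒯.left i..𝒯.right i,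
          ((Q i fun x => g' (x + a * s)).eval x - g' (x + a * s)) ^ 2 := by
      intro i
      have h2 := young i (fun x => a * (g' (x + a * s) - (Q i fun x => g' (x + a * s)).eval x))
        (ξ s i) (by fun_prop)
      simp only [mul_assoc, mul_pow, intervalIntegral.integral_const_mul,
        sub_sq_comm (g' _)] at h2
      linarith
    have hsum : ∑ i, 2 * (D s i + ρ s i) = 2 * ∑ i, D s i + ∑ i, 2 * ρ s i := by
      rw [Finset.mul_sum, ← Finset.sum_add_distrib]
      exact Finset.sum_congr rfl fun i _ => by ring
    have hsum2 := Finset.sum_le_sum fun i (_ : i ∈ Finset.univ) => hρi i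
    rw [Finset.sum_add_distrib] at hsum2
    rw [hsum]
    linarith [hR s]
  have hR0 : 0 ≤ R := (Finset.sum_nonneg fun i _ => mul_nonneg (sq_nonneg a)
    (intervalIntegral.integral_nonneg (𝒯.left_lt_right i).le fun _ _ => sq_nonneg _)).trans (hR 0)
  have hfin := gronwall_add_const hEd hle t ht
  have hEt : ∑ i, ∫ x in 𝒯.left i..𝒯.right i, ((q t i - Q i fun x => g (x + a * t)).eval x) ^ 2
      = E t := by simp only [hE, hξ, pow_two]
  rw [hEt]
  have : Real.exp t * (E 0 + R) ≤ Real.exp t * (A + R) := by gcongr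
  linarith

end Energy

section ScalarError

open Polynomial

lemma exists_bound_of_continuous_periodic {L : ℝ} (hL : 0 < L) {g : ℝ → ℝ} (hg : Continuous g)
    (hp : Function.Periodic g L) : ∃ M, ∀ x, |g x| ≤ M := by
  obtain ⟨M, hM⟩ := (isCompact_Icc (a := 0) (b := L)).exists_bound_of_continuousOn hg.continuousOn
  refine ⟨M, fun x => ?_⟩
  obtain ⟨y, hy, hxy⟩ := hp.exists_mem_Ico₀ hL x
  rw [hxy]
  exact hM y (Ico_subset_Icc_self hy)

/-- Poincaré's inequality: a primitive of `D` which vanishes somewhere in the period is bounded by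
`D` in `L²`. -/
lemma integral_sq_primitive_le {L : ℝ} (hL : 0 < L) {F D : ℝ → ℝ} (hF : Continuous F)
    (hD : ∀ x y, F y - F x = ∫ s in x..y, D s) (hD1 : ∀ x y, IntervalIntegrable D volume x y)
    (hD2 : ∀ x y, IntervalIntegrable (fun x => D x ^ 2) volume x y)
    {c : ℝ} (hc : c ∈ Icc 0 L) (hFc : F c = 0) :
    ∫ x in (0 : ℝ)..L, F x ^ 2 ≤ L ^ 2 * ∫ x in (0 : ℝ)..L, D x ^ 2 := by
  have hI := sq_integral_abs_le hL (hD1 0 L) (hD2 0 L)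
  rw [sub_zero] at hI
  have hpt : ∀ x ∈ Icc 0 L, F x ^ 2 ≤ L * ∫ x in (0 : ℝ)..L, D x ^ 2 := by
    intro x hx
    have h1 : F x = ∫ s in c..x, D s := by rw [← hD, hFc, sub_zero]
    have h2 : |F x| ≤ ∫ s in (0 : ℝ)..L, |D s| := by
      rw [h1, intervalIntegral.abs_integral_eq_abs_integral_uIoc]
      refine (abs_integral_le_integral_abs).trans ?_
      rw [intervalIntegral.integral_of_le hL.le]
      refine setIntegral_mono_set ((intervalIntegrable_iff_integrableOn_Ioc_of_le hL.le).1
        (hD1 0 L).abs) (Filter.Eventually.of_forall fun _ => abs_nonneg _)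
        (LE.le.eventuallyLE ?_)
      exact Ioc_subset_Ioc (le_min hc.1 hx.1) (max_le hc.2 hx.2)
    calc F x ^ 2 = |F x| ^ 2 := (sq_abs _).symm
      _ ≤ (∫ s in (0 : ℝ)..L, |D s|) ^ 2 := pow_le_pow_left₀ (abs_nonneg _) h2 2
      _ ≤ _ := hI
  calc ∫ x in (0 : ℝ)..L, F x ^ 2
      ≤ ∫ _ in (0 : ℝ)..L, L * ∫ x in (0 : ℝ)..L, D x ^ 2 :=
        intervalIntegral.integral_mono_on hL.le (Continuous.intervalIntegrable (by fun_prop) _ _)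
          intervalIntegrable_const hpt
    _ = _ := by rw [intervalIntegral.integral_const, smul_eq_mul]; ring

/-- The Radau projections of a travelling regular profile converge of optimal order on every
mesh. -/
lemma sum_integral_sq_radau_error_le {L : ℝ} {k : ℕ} {K : ℝ} (𝒯 : Mesh L) {a : ℝ}
    {Q : Fin (𝒯.last + 1) → (ℝ → ℝ) → ℝ[X]}
    (hQ : ∀ i, IsRadauProjection k K (𝒯.left i) (𝒯.right i) (𝒯.upwindEnd a i) (Q i))
    {G : ℕ → ℝ → ℝ} {D : ℝ → ℝ} (hG0 : Continuous (G 0))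
    (hG : ∀ j < k, ∀ x, HasDerivAt (G j) (G (j + 1) x) x)
    (hD : ∀ x y, G k y - G k x = ∫ s in x..y, D s)
    (hD1 : ∀ x y, IntervalIntegrable D volume x y)
    (hD2 : ∀ x y, IntervalIntegrable (fun x => D x ^ 2) volume x y)
    (hDp : Function.Periodic D L) (z : ℝ) :
    ∑ i, ∫ x in 𝒯.left i..𝒯.right i, ((Q i fun x => G 0 (x + z)).eval x - G 0 (x + z)) ^ 2
      ≤ K ^ 2 * 𝒯.size ^ (2 * (k + 1)) * ∫ x in (0 : ℝ)..L, D x ^ 2 := by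
  have hi1 : ∀ x y, IntervalIntegrable (fun s => D (s + z)) volume x y := fun x y => by
    simpa using (hD1 (x + z) (y + z)).comp_add_right z
  have hi2 : ∀ x y, IntervalIntegrable (fun s => D (s + z) ^ 2) volume x y := fun x y => by
    simpa using (hD2 (x + z) (y + z)).comp_add_right z
  have hcell : ∀ i, ∫ x in 𝒯.left i..𝒯.right i,
      ((Q i fun x => G 0 (x + z)).eval x - G 0 (x + z)) ^ 2
      ≤ K ^ 2 * 𝒯.size ^ (2 * (k + 1)) * ∫ x in 𝒯.left i..𝒯.right i, D (x + z) ^ 2 := by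
    intro i
    have h := (hQ i).integral_sq_error_le (𝒯.left_lt_right i) (G := fun j x => G j (x + z))
      (D := fun x => D (x + z)) (by fun_prop)
      (fun j hj x => (hG j hj (x + z)).comp_add_const x z)
      (fun x y => by
        rw [hD, intervalIntegral.integral_comp_add_right (fun s => D s) z])
      hi1 hi2
    refine h.trans ?_
    have hpos := (sub_pos.2 (𝒯.left_lt_right i)).le
    have := intervalIntegral.integral_nonneg (μ := volume) (f := fun x => D (x + z) ^ 2)
      (𝒯.left_lt_right i).le fun _ _ => sq_nonneg _
    gcongr
    exact 𝒯.length_le_size i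
  refine (Finset.sum_le_sum fun i _ => hcell i).trans ?_
  rw [← Finset.mul_sum, 𝒯.sum_integral_cells hi2]
  have hp : Function.Periodic (fun x => D x ^ 2) L := fun x => by simp only [hDp x]
  rw [integral_periodic_comp_add hp z]

/-- The error estimate of the semidiscrete DG method with upwind flux for the scalar equation
`w_t = a w_x`, uniformly in the speeds `|a| ≤ M` and in the mesh. -/
theorem exists_dg_error_bound {L T M : ℝ} (hL : 0 < L) (hT : 0 < T) (k : ℕ) :
    ∃ C > 0, ∀ (𝒯 : Mesh L) (a : ℝ), |a| ≤ M → ∀ w : ℝ → ℝ → ℝ, IsTransportSolution L T a w →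
      PerSobolev L (k + 2) (w 0) → ∀ q : ℝ → 𝒯.Broken, IsDGSolution T k 𝒯 a (w 0) q →
      ∀ t ∈ Icc 0 T, l2Norm L (fun x => w t x - 𝒯.toFun (q t) x)
        ≤ C * semi L (k + 2) (w 0) * 𝒯.size ^ (k + 1) := by
  obtain ⟨K, hK, hproj⟩ := exists_isRadauProjection k
  set B : ℝ := 2 * K ^ 2 * L ^ 2 + 2 * (Real.exp T * (K ^ 2 * L ^ 2 + M ^ 2 * K ^ 2)) with hB
  have hBpos : 0 < B := by positivity
  refine ⟨Real.sqrt B, Real.sqrt_pos.2 hBpos, ?_⟩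
  intro 𝒯 a ha w hw hreg q hq t ht
  obtain ⟨G, hGcp, hGd, hGD, hw0⟩ := hreg.exists_regular_representative (r := k + 1) hL
  have hDspec := weakDeriv_spec (hreg.2 (k + 2) le_rfl)
  set D : ℝ → ℝ := weakDeriv L (k + 2) (w 0) with hDdef
  have hDI := hDspec.1.intervalIntegrable hL
  have hDI2 := hDspec.1.sq_intervalIntegrable hL
  set S : ℝ := ∫ x in (0 : ℝ)..L, D x ^ 2 with hS
  have hSsemi : semi L (k + 2) (w 0) ^ 2 = S := l2Norm_sq L hL.le D
  have hS0 : 0 ≤ S := by rw [← hSsemi]; positivity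
  have hGc : ∀ j ≤ k + 1, Continuous (G j) := fun j hj => (hGcp j hj).1
  have hGp : ∀ j ≤ k + 1, Function.Periodic (G j) L := fun j hj => (hGcp j hj).2
  have he : ∀ i, 𝒯.upwindEnd a i = 𝒯.left i ∨ 𝒯.upwindEnd a i = 𝒯.right i := by
    intro i
    unfold Mesh.upwindEnd
    split_ifs <;> simp
  choose Q hQ using fun i => hproj (𝒯.left i) (𝒯.right i) _ (𝒯.left_lt_right i) (he i)
  set h : ℝ := 𝒯.size ^ (2 * (k + 1)) with hh
  have hh0 : 0 ≤ h := pow_nonneg 𝒯.size_pos.le _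
  -- By Rolle's theorem the derivative of the periodic function `G k` vanishes somewhere.
  have hpoinc : ∫ x in (0 : ℝ)..L, G (k + 1) x ^ 2 ≤ L ^ 2 * S := by
    obtain ⟨c, hc, hc0⟩ := exists_hasDerivAt_eq_zero hL (hGc k (by omega)).continuousOn
      (by simpa using (hGp k (by omega) 0).symm) fun x _ => hGd k (by omega) x
    exact integral_sq_primitive_le hL (hGc _ le_rfl) hGD hDI hDI2 (Ioo_subset_Icc_self hc) hc0
  -- The profile itself is approximated with its derivative of order `k + 1`; Poincaré's inequality
  -- brings in the derivative of order `k + 2`, which its time derivative needs anyway.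
  have happ0 : ∀ z, ∑ i, ∫ x in 𝒯.left i..𝒯.right i,
      ((Q i fun x => G 0 (x + z)).eval x - G 0 (x + z)) ^ 2 ≤ K ^ 2 * h * (L ^ 2 * S) := by
    intro z
    have hc := hGc (k + 1) le_rfl
    have h1 := sum_integral_sq_radau_error_le 𝒯 hQ (G := G) (D := G (k + 1))
      (hGc 0 (by omega)) (fun j hj => hGd j (by omega))
      (fun x y => (intervalIntegral.integral_eq_sub_of_hasDerivAt
        (fun x _ => hGd k (by omega) x) (hc.intervalIntegrable _ _)).symm)
      (fun x y => hc.intervalIntegrable _ _) (fun x y => (hc.pow 2).intervalIntegrable _ _)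
      (hGp _ le_rfl) z
    exact h1.trans (by gcongr)
  have happ1 : ∀ z, ∑ i, ∫ x in 𝒯.left i..𝒯.right i,
      ((Q i fun x => G 1 (x + z)).eval x - G 1 (x + z)) ^ 2 ≤ K ^ 2 * h * S := fun z =>
    sum_integral_sq_radau_error_le 𝒯 hQ (G := fun j => G (j + 1)) (D := D)
      (hGc 1 (by omega)) (fun j hj => hGd (j + 1) (by omega)) hGD hDI hDI2 hDspec.1.1 z
  have ha2 : a ^ 2 ≤ M ^ 2 := by
    rw [← sq_abs]; exact pow_le_pow_left₀ (abs_nonneg _) ha 2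
  have hstab := hq.sum_integral_sq_error_le hT hw0 (fun x => hGd 0 (by omega) x)
    (hGc 1 (by omega)) (exists_bound_of_continuous_periodic hL (hGc 1 (by omega))
      (hGp 1 (by omega))) (hGp 0 (by omega)) hQ
    (A := K ^ 2 * h * (L ^ 2 * S)) (R := M ^ 2 * (K ^ 2 * h * S))
    (by simpa using happ0 0)
    (fun s => by
      rw [← Finset.mul_sum]
      exact mul_le_mul ha2 (happ1 (a * s)) (Finset.sum_nonneg fun i _ =>
        intervalIntegral.integral_nonneg (𝒯.left_lt_right i).le fun _ _ => sq_nonneg _)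
        (sq_nonneg _)) ht
  have h0 : (0 : ℝ) ∈ Icc 0 T := ⟨le_rfl, hT.le⟩
  have hG0c := hGc 0 (by omega)
  -- The exact solution is the translate of the regular representative of the initial value.
  have hwt : w t =ᵐ[volume] fun x => G 0 (x + a * t) := by
    refine (hw.ae_eq_translate hL ht).trans ?_
    exact (measurePreserving_add_right volume (a * t)).quasiMeasurePreserving.ae_eq_comp hw0
  have hmain : ∫ x in (0 : ℝ)..L, (w t x - 𝒯.toFun (q t) x) ^ 2 ≤ B * S * h := by
    rw [𝒯.integral_sq_sub_toFun hL (hw.1 t ht)]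
    have hcell : ∀ i, ∫ x in 𝒯.left i..𝒯.right i, (w t x - (q t i).eval x) ^ 2
        ≤ 2 * (∫ x in 𝒯.left i..𝒯.right i,
            ((Q i fun x => G 0 (x + a * t)).eval x - G 0 (x + a * t)) ^ 2)
          + 2 * ∫ x in 𝒯.left i..𝒯.right i,
            ((q t i - Q i fun x => G 0 (x + a * t)).eval x) ^ 2 := by
      intro i
      have e1 : ∫ x in 𝒯.left i..𝒯.right i, (w t x - (q t i).eval x) ^ 2
          = ∫ x in 𝒯.left i..𝒯.right i, (G 0 (x + a * t) - (q t i).eval x) ^ 2 := by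
        refine intervalIntegral.integral_congr_ae ?_
        filter_upwards [hwt] with x hx _
        rw [hx]
      rw [e1, ← intervalIntegral.integral_const_mul, ← intervalIntegral.integral_const_mul,
        ← intervalIntegral.integral_add (Continuous.intervalIntegrable (by fun_prop) _ _)
          (Continuous.intervalIntegrable (by fun_prop) _ _)]
      refine intervalIntegral.integral_mono_on (𝒯.left_lt_right i).le
        (Continuous.intervalIntegrable (by fun_prop) _ _)
        (Continuous.intervalIntegrable (by fun_prop) _ _) fun x _ => ?_
      rw [eval_sub]
      nlinarith [sq_nonneg (((Q i fun x => G 0 (x + a * t)).eval x - G 0 (x + a * t))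
        - ((q t i).eval x - (Q i fun x => G 0 (x + a * t)).eval x))]
    refine (Finset.sum_le_sum fun i _ => hcell i).trans ?_
    rw [Finset.sum_add_distrib, ← Finset.mul_sum, ← Finset.mul_sum]
    have hexp : Real.exp t * (K ^ 2 * h * (L ^ 2 * S) + M ^ 2 * (K ^ 2 * h * S))
        ≤ Real.exp T * (K ^ 2 * h * (L ^ 2 * S) + M ^ 2 * (K ^ 2 * h * S)) := by
      gcongr
      exact ht.2
    calc _ ≤ 2 * (K ^ 2 * h * (L ^ 2 * S))
          + 2 * (Real.exp T * (K ^ 2 * h * (L ^ 2 * S) + M ^ 2 * (K ^ 2 * h * S))) := by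
          gcongr
          · exact happ0 _
          · exact hstab.trans hexp
      _ = B * S * h := by rw [hB]; ring
  have hsemi0 : 0 ≤ semi L (k + 2) (w 0) := l2Norm_nonneg
  unfold l2Norm
  rw [Real.sqrt_le_left (by have := 𝒯.size_pos; positivity)]
  calc _ ≤ B * S * h := hmain
    _ = _ := by
      rw [mul_pow, mul_pow, Real.sq_sqrt hBpos.le, hSsemi, hh]
      ring

end ScalarError

/-! ### The rescaled beta distribution -/

section Law

variable {α β : ℝ}

lemma isProbabilityMeasure_yLaw (hα : 0 < α) (hβ : 0 < β) : IsProbabilityMeasure (yLaw α β) := by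
  have := ProbabilityTheory.isProbabilityMeasureBeta hα hβ
  exact Measure.isProbabilityMeasure_map (by fun_prop)

lemma ae_mem_Ioo_yLaw : ∀ᵐ y ∂yLaw α β, y ∈ Ioo (-1 : ℝ) 1 := by
  have hm : Measurable fun z : ℝ => 2 * z - 1 := by fun_prop
  refine (ae_map_iff (p := fun y => y ∈ Ioo (-1 : ℝ) 1) hm.aemeasurable measurableSet_Ioo).2 ?_
  have hpdf : Measurable (ProbabilityTheory.betaPDF α β) :=
    (ProbabilityTheory.measurable_betaPDFReal α β).ennreal_ofReal
  rw [ProbabilityTheory.betaMeasure, ae_withDensity_iff hpdf]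
  refine Filter.Eventually.of_forall fun z hz => ?_
  have h0 : 0 < z := by
    by_contra h
    exact hz (ProbabilityTheory.betaPDF_eq_zero_of_nonpos (not_lt.1 h))
  have h1 : z < 1 := by
    by_contra h
    exact hz (ProbabilityTheory.betaPDF_eq_zero_of_one_le (not_lt.1 h))
  exact ⟨by linarith, by linarith⟩

end Law

/-! ### Orthonormal polynomials -/

section Orthonormal

open Polynomial

variable {μ : Measure ℝ} {P : ℕ → ℝ[X]}

lemma integrable_mul_of_memLp {f g : ℝ → ℝ} (hf : MemLp f 2 μ) (hg : MemLp g 2 μ) :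
    Integrable (fun y => f y * g y) μ := hf.integrable_mul hg

lemma integrable_coeff_mul {c : ℝ → ℝ} {M : ℝ} (hc : Measurable c) (hM : ∀ᵐ y ∂μ, |c y| ≤ M) {f g : ℝ → ℝ}
    (hf : MemLp f 2 μ) (hg : MemLp g 2 μ) : Integrable (fun y => c y * (f y * g y)) μ :=
  (integrable_mul_of_memLp hf hg).bdd_mul (c := M) hc.aestronglyMeasurable hM

/-- Every polynomial is a combination of the polynomials `P n`. -/
lemma exists_expansion (hP : IsOrthonormalPolynomials μ P) :
    ∀ (N : ℕ) (p : ℝ[X]), p.natDegree < N → ∃ c : Fin N → ℝ, p = ∑ n, C (c n) * P n := by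
  intro N
  induction N with
  | zero => intro p hp; omega
  | succ N ih =>
    intro p hp
    have hN : (P N).coeff N ≠ 0 := by
      have hne : P N ≠ 0 := by
        intro h0
        have := hP.2 N N
        simp [h0] at this
      have := leadingCoeff_ne_zero.2 hne
      rwa [leadingCoeff, hP.1 N] at this
    set r := p - C (p.coeff N / (P N).coeff N) * P N with hr
    have hrdeg : r.natDegree ≤ N :=
      (natDegree_sub_le _ _).trans (max_le (by omega)
        ((natDegree_C_mul_le _ _).trans (hP.1 N).le))
    have hrN : r.coeff N = 0 := by
      rw [hr, coeff_sub, coeff_C_mul]; field_simp; simp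
    rcases Nat.eq_zero_or_pos N with rfl | hpos
    · refine ⟨fun _ => p.coeff 0 / (P 0).coeff 0, ?_⟩
      have : r = 0 := by
        rw [eq_C_of_natDegree_le_zero hrdeg, hrN, C_0]
      rw [hr, sub_eq_zero] at this
      simpa using this
    · have hlt : r.natDegree < N := by
        refine lt_of_le_of_ne hrdeg fun h => ?_
        have h0 : r.leadingCoeff = 0 := by rw [leadingCoeff, h, hrN]
        rw [leadingCoeff_eq_zero] at h0
        rw [h0, natDegree_zero] at h
        omega
      obtain ⟨c, hc⟩ := ih r hlt
      refine ⟨Fin.snoc c (p.coeff N / (P N).coeff N), ?_⟩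
      rw [Fin.sum_univ_castSucc]
      simp only [Fin.snoc_castSucc, Fin.snoc_last, Fin.val_castSucc, Fin.val_last]
      rw [← hc, hr]
      ring

variable [IsProbabilityMeasure μ]

lemma memLp_of_continuous (hμ : ∀ᵐ y ∂μ, y ∈ Ioo (-1 : ℝ) 1) {f : ℝ → ℝ} (hf : Continuous f) :
    MemLp f 2 μ := by
  obtain ⟨C, hC⟩ := (isCompact_Icc (a := (-1 : ℝ)) (b := 1)).exists_bound_of_continuousOn
    hf.continuousOn
  refine MemLp.of_bound hf.aestronglyMeasurable C ?_
  filter_upwards [hμ] with y hy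
  exact hC y (Ioo_subset_Icc_self hy)

/-- The mean-square distance of `f` to a combination of orthonormal polynomials. -/
lemma integral_sq_sub_sum (hμ : ∀ᵐ y ∂μ, y ∈ Ioo (-1 : ℝ) 1) (hP : IsOrthonormalPolynomials μ P)
    {ι : Type*} [Fintype ι] {e : ι → ℕ} (he : Function.Injective e) {f : ℝ → ℝ}
    (hf : MemLp f 2 μ) (d : ι → ℝ) :
    ∫ y, (f y - ∑ i, d i * (P (e i)).eval y) ^ 2 ∂μ
      = (∫ y, f y ^ 2 ∂μ) - ∑ i, (∫ y, f y * (P (e i)).eval y ∂μ) ^ 2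
        + ∑ i, ((∫ y, f y * (P (e i)).eval y ∂μ) - d i) ^ 2 := by
  classical
  have hPm : ∀ n, MemLp (fun y => (P n).eval y) 2 μ := fun n =>
    memLp_of_continuous hμ (P n).continuous
  have h1 : ∀ y, (f y - ∑ i, d i * (P (e i)).eval y) ^ 2
      = f y ^ 2 - ∑ i, 2 * d i * (f y * (P (e i)).eval y)
        + ∑ i, ∑ j, d i * d j * ((P (e i)).eval y * (P (e j)).eval y) := by
    intro y
    rw [sub_sq, pow_two (∑ i, d i * (P (e i)).eval y), Finset.sum_mul_sum, Finset.mul_sum]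
    congr 1
    · congr 1
      exact Finset.sum_congr rfl fun i _ => by ring
    · exact Finset.sum_congr rfl fun i _ => Finset.sum_congr rfl fun j _ => by ring
  have i1 : ∀ i, Integrable (fun y => 2 * d i * (f y * (P (e i)).eval y)) μ := fun i =>
    (integrable_mul_of_memLp hf (hPm _)).const_mul _
  have i2 : ∀ i j, Integrable (fun y => d i * d j * ((P (e i)).eval y * (P (e j)).eval y)) μ :=
    fun i j => (integrable_mul_of_memLp (hPm _) (hPm _)).const_mul _
  have i3 : Integrable (fun y => f y ^ 2 - ∑ i, 2 * d i * (f y * (P (e i)).eval y)) μ :=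
    hf.integrable_sq.sub (integrable_finsetSum _ fun i _ => i1 i)
  simp only [h1]
  rw [integral_add i3 (integrable_finsetSum _ fun i _ => integrable_finsetSum _ fun j _ => i2 i j),
    integral_sub hf.integrable_sq (integrable_finsetSum _ fun i _ => i1 i),
    integral_finsetSum _ fun i _ => i1 i,
    integral_finsetSum _ fun i _ => integrable_finsetSum _ fun j _ => i2 i j]
  have h2 : ∀ i, ∫ y, ∑ j, d i * d j * ((P (e i)).eval y * (P (e j)).eval y) ∂μ = d i ^ 2 := by
    intro i
    rw [integral_finsetSum _ fun j _ => i2 i j]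
    simp only [integral_const_mul, hP.2, he.eq_iff, mul_ite, mul_one, mul_zero,
      Finset.sum_ite_eq, Finset.mem_univ, if_true]
    ring
  simp only [h2, integral_const_mul]
  rw [sub_add, sub_add, ← Finset.sum_sub_distrib, ← Finset.sum_sub_distrib]
  congr 1
  exact Finset.sum_congr rfl fun i _ => by ring

lemma integral_sq_sum (hμ : ∀ᵐ y ∂μ, y ∈ Ioo (-1 : ℝ) 1) (hP : IsOrthonormalPolynomials μ P)
    {ι : Type*} [Fintype ι] {e : ι → ℕ} (he : Function.Injective e) (d : ι → ℝ) :
    ∫ y, (∑ i, d i * (P (e i)).eval y) ^ 2 ∂μ = ∑ i, d i ^ 2 := by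
  have h := integral_sq_sub_sum hμ hP he (f := fun _ => 0) (memLp_of_continuous hμ (by fun_prop)) d
  simpa using h

/-- Bessel's inequality. -/
lemma sum_sq_integral_mul_le (hμ : ∀ᵐ y ∂μ, y ∈ Ioo (-1 : ℝ) 1)
    (hP : IsOrthonormalPolynomials μ P) {ι : Type*} [Fintype ι] {e : ι → ℕ}
    (he : Function.Injective e) {f : ℝ → ℝ} (hf : MemLp f 2 μ) :
    ∑ i, (∫ y, f y * (P (e i)).eval y ∂μ) ^ 2 ≤ ∫ y, f y ^ 2 ∂μ := by
  have h := integral_sq_sub_sum hμ hP he hf fun i => ∫ y, f y * (P (e i)).eval y ∂μ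
  have h0 : 0 ≤ ∫ y, (f y - ∑ i, (∫ y, f y * (P (e i)).eval y ∂μ) * (P (e i)).eval y) ^ 2 ∂μ :=
    integral_nonneg fun _ => sq_nonneg _
  simp only [sub_self, ne_eq, OfNat.ofNat_ne_zero, not_false_eq_true, zero_pow,
    Finset.sum_const_zero, add_zero] at h
  linarith

/-- Polynomials are dense in `L²` of a probability measure on `(-1, 1)`. -/
lemma exists_polynomial_integral_sq_sub_le (hμ : ∀ᵐ y ∂μ, y ∈ Ioo (-1 : ℝ) 1) {f : ℝ → ℝ}
    (hf : MemLp f 2 μ) {ε : ℝ} (hε : 0 < ε) :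
    ∃ p : ℝ[X], ∫ y, (f y - p.eval y) ^ 2 ∂μ ≤ ε := by
  have h2 : ENNReal.ofReal 2 = 2 := by norm_num
  obtain ⟨g, hg, hgm⟩ := MemLp.exists_boundedContinuous_integral_rpow_sub_le (μ := μ) (p := 2)
    two_pos (f := f) (by rwa [h2]) (ε := ε / 4) (by positivity)
  rw [h2] at hgm
  obtain ⟨p, hp⟩ := exists_polynomial_near_of_continuousOn (-1) 1 g g.continuous.continuousOn
    (Real.sqrt (ε / 4)) (Real.sqrt_pos.2 (by positivity))
  refine ⟨p, ?_⟩
  have hpm : MemLp (fun y => p.eval y) 2 μ := memLp_of_continuous hμ p.continuous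
  have hg' : ∫ y, (f y - g y) ^ 2 ∂μ ≤ ε / 4 := by
    refine le_trans (le_of_eq ?_) hg
    exact integral_congr_ae (Filter.Eventually.of_forall fun y => by simp)
  have i1 : Integrable (fun y => 2 * (f y - g y) ^ 2) μ := (hf.sub hgm).integrable_sq.const_mul 2
  calc ∫ y, (f y - p.eval y) ^ 2 ∂μ ≤ ∫ y, (2 * (f y - g y) ^ 2 + 2 * (ε / 4)) ∂μ := by
        refine integral_mono_ae (hf.sub hpm).integrable_sq (i1.add (integrable_const _)) ?_
        filter_upwards [hμ] with y hy
        have h3 := hp y (Ioo_subset_Icc_self hy)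
        have h4 : (p.eval y - g y) ^ 2 ≤ ε / 4 := by
          rw [← sq_abs, ← Real.sq_sqrt (show 0 ≤ ε / 4 by positivity)]
          exact pow_le_pow_left₀ (abs_nonneg _) h3.le 2
        nlinarith [sq_nonneg ((f y - g y) + (p.eval y - g y))]
    _ = 2 * (∫ y, (f y - g y) ^ 2 ∂μ) + 2 * (ε / 4) := by
        rw [integral_add i1 (integrable_const _), integral_const_mul, integral_const]
        simp
    _ ≤ ε := by linarith

/-- Parseval's identity for the expansion in orthonormal polynomials. -/
theorem hasSum_sq_integral_mul (hμ : ∀ᵐ y ∂μ, y ∈ Ioo (-1 : ℝ) 1)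
    (hP : IsOrthonormalPolynomials μ P) {f : ℝ → ℝ} (hf : MemLp f 2 μ) :
    HasSum (fun n => (∫ y, f y * (P n).eval y ∂μ) ^ 2) (∫ y, f y ^ 2 ∂μ) := by
  rw [hasSum_iff_tendsto_nat_of_nonneg fun _ => sq_nonneg _]
  have hmono : Monotone fun N => ∑ n ∈ Finset.range N, (∫ y, f y * (P n).eval y ∂μ) ^ 2 :=
    fun a b hab => Finset.sum_le_sum_of_subset_of_nonneg
      (Finset.range_subset_range.2 hab) fun _ _ _ => sq_nonneg _
  refine tendsto_atTop_isLUB hmono ⟨?_, ?_⟩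
  · rintro _ ⟨N, rfl⟩
    simp only [Finset.sum_range]
    exact sum_sq_integral_mul_le hμ hP (e := fun i : Fin N => (i : ℕ)) Fin.val_injective hf
  · intro b hb
    refine le_of_forall_pos_le_add fun ε hε => ?_
    obtain ⟨p, hp⟩ := exists_polynomial_integral_sq_sub_le hμ hf hε
    obtain ⟨c, hc⟩ := exists_expansion hP (p.natDegree + 1) p (Nat.lt_succ_self _)
    have h := integral_sq_sub_sum hμ hP (e := fun i : Fin (p.natDegree + 1) => (i : ℕ))
      Fin.val_injective hf c
    have he : ∀ y, ∑ i, c i * (P i).eval y = p.eval y := fun y => by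
      conv_rhs => rw [hc]
      simp [eval_finsetSum]
    simp only [he] at h
    have hb' := hb ⟨p.natDegree + 1, rfl⟩
    simp only [Finset.sum_range] at hb'
    have hnn : 0 ≤ ∑ i : Fin (p.natDegree + 1), ((∫ y, f y * (P i).eval y ∂μ) - c i) ^ 2 :=
      Finset.sum_nonneg fun _ _ => sq_nonneg _
    linarith

/-! ### The Galerkin matrix -/

variable {c : ℝ → ℝ} {M : ℝ}

/-- The Galerkin matrix is the compression of the multiplication by `c`. -/
lemma sum_gpcMatrix_mul (hμ : ∀ᵐ y ∂μ, y ∈ Ioo (-1 : ℝ) 1) (hc : Measurable c)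
    (hM : ∀ᵐ y ∂μ, |c y| ≤ M) {N : ℕ} (n : Fin (N + 1)) (z : Fin (N + 1) → ℝ) :
    ∑ l, gpcMatrix μ c P N n l * z l
      = ∫ y, c y * ((P n).eval y * ∑ l : Fin (N + 1), z l * (P l).eval y) ∂μ := by
  have hPm : ∀ n, MemLp (fun y => (P n).eval y) 2 μ := fun n =>
    memLp_of_continuous hμ (P n).continuous
  have e : ∀ y, c y * ((P n).eval y * ∑ l : Fin (N + 1), z l * (P l).eval y)
      = ∑ l : Fin (N + 1), (c y * ((P n).eval y * (P l).eval y)) * z l := by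
    intro y
    rw [Finset.mul_sum, Finset.mul_sum]
    exact Finset.sum_congr rfl fun l _ => by ring
  simp only [e]
  rw [integral_finsetSum _ fun l _ => (integrable_coeff_mul hc hM (hPm _) (hPm _)).mul_const _]
  refine Finset.sum_congr rfl fun l _ => ?_
  rw [integral_mul_const]
  simp only [gpcMatrix, Matrix.of_apply, mul_assoc]

/-- The eigenvalues of the Galerkin matrix are bounded by the bound of the speed `c`. -/
lemma abs_eigenvalue_le (hμ : ∀ᵐ y ∂μ, y ∈ Ioo (-1 : ℝ) 1) (hP : IsOrthonormalPolynomials μ P)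
    (hc : Measurable c) (hM : ∀ᵐ y ∂μ, |c y| ≤ M) {N : ℕ}
    {S : Matrix (Fin (N + 1)) (Fin (N + 1)) ℝ} {lam : Fin (N + 1) → ℝ} (hS : Sᵀ * S = 1)
    (hD : Sᵀ * gpcMatrix μ c P N * S = Matrix.diagonal lam) (n : Fin (N + 1)) :
    |lam n| ≤ M := by
  set z : ℝ → ℝ := fun y => ∑ l : Fin (N + 1), S l n * (P l).eval y with hz
  have hPm : ∀ n, MemLp (fun y => (P n).eval y) 2 μ := fun n =>
    memLp_of_continuous hμ (P n).continuous
  have hzm : MemLp z 2 μ := memLp_of_continuous hμ (by fun_prop)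
  have h1 : lam n = ∫ y, c y * (z y * z y) ∂μ := by
    have h := congrFun (congrFun hD n) n
    rw [Matrix.diagonal_apply_eq, Matrix.mul_assoc] at h
    rw [← h, Matrix.mul_apply]
    simp only [Matrix.mul_apply, Matrix.transpose_apply,
      sum_gpcMatrix_mul hμ hc hM _ fun l => S l n]
    have e : ∀ y, c y * (z y * z y) = ∑ i : Fin (N + 1), S i n * (c y * ((P i).eval y * z y)) := by
      intro y
      have hzy : z y = ∑ l : Fin (N + 1), S l n * (P l).eval y := rfl
      nth_rewrite 1 [hzy]
      rw [Finset.sum_mul, Finset.mul_sum]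
      exact Finset.sum_congr rfl fun l _ => by ring
    simp only [e]
    rw [integral_finsetSum _ fun l _ => (integrable_coeff_mul hc hM (hPm _) hzm).const_mul _]
    simp only [integral_const_mul]
    rfl
  have h2 : ∫ y, z y ^ 2 ∂μ = 1 := by
    rw [hz, integral_sq_sum hμ hP (e := fun i : Fin (N + 1) => (i : ℕ)) Fin.val_injective]
    have h := congrFun (congrFun hS n) n
    simpa [Matrix.mul_apply, pow_two] using h
  rw [h1]
  calc |∫ y, c y * (z y * z y) ∂μ| ≤ ∫ y, M * z y ^ 2 ∂μ := by
        refine abs_integral_le_integral_abs.trans ?_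
        refine integral_mono_ae (integrable_coeff_mul hc hM hzm hzm).abs
          (hzm.integrable_sq.const_mul M) ?_
        filter_upwards [hM] with y hy
        rw [abs_mul, ← pow_two, abs_of_nonneg (sq_nonneg (z y))]
        exact mul_le_mul_of_nonneg_right hy (sq_nonneg _)
    _ = M := by rw [integral_const_mul, h2, mul_one]

end Orthonormal

/-! ### Characteristic variables -/

section Characteristic

variable {L T : ℝ} {N : ℕ} {S : Matrix (Fin (N + 1)) (Fin (N + 1)) ℝ}

lemma sum_sq_orthogonal (hS : Sᵀ * S = 1) (x : Fin (N + 1) → ℝ) :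
    ∑ n, (∑ l, S n l * x l) ^ 2 = ∑ l, x l ^ 2 := by
  have h : (S *ᵥ x) ⬝ᵥ (S *ᵥ x) = x ⬝ᵥ x := by
    rw [Matrix.dotProduct_mulVec, Matrix.vecMul_mulVec, hS, Matrix.vecMul_one]
  simpa [dotProduct, Matrix.mulVec, pow_two] using h

lemma sum_sq_orthogonal_transpose (hS : Sᵀ * S = 1) (x : Fin (N + 1) → ℝ) :
    ∑ n, (∑ l, S l n * x l) ^ 2 = ∑ l, x l ^ 2 := by
  have hS' : (Sᵀ)ᵀ * Sᵀ = 1 := by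
    rw [Matrix.transpose_transpose]; exact mul_eq_one_comm.1 hS
  exact sum_sq_orthogonal hS' x

lemma sum_charVar (hS : Sᵀ * S = 1) (v : Fin (N + 1) → ℝ → ℝ → ℝ) (n : Fin (N + 1)) (t x : ℝ) :
    ∑ l, S n l * charVar S v l t x = v n t x := by
  have hS' : S * Sᵀ = 1 := mul_eq_one_comm.1 hS
  have h := congrFun (Matrix.mulVec_mulVec (fun j => v j t x) S Sᵀ) n
  rw [hS', Matrix.one_mulVec] at h
  exact h

/-- The characteristic variables solve decoupled scalar transport equations. -/
lemma IsSystemSolution.charVar {A : Matrix (Fin (N + 1)) (Fin (N + 1)) ℝ}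
    {lam : Fin (N + 1) → ℝ} {v : Fin (N + 1) → ℝ → ℝ → ℝ} (hL : 0 < L)
    (hv : IsSystemSolution L T A v)
    (hS : Sᵀ * S = 1) (hD : Sᵀ * A * S = Matrix.diagonal lam) (n : Fin (N + 1)) :
    IsTransportSolution L T (lam n) (charVar S v n) := by
  have hSA : Sᵀ * A = Matrix.diagonal lam * Sᵀ := by
    rw [← hD, Matrix.mul_assoc (Sᵀ * A), mul_eq_one_comm.1 hS, Matrix.mul_one]
  have hint : ∀ t ∈ Icc 0 T, ∀ ψ : ℝ → ℝ, Continuous ψ →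
      ∫ x in (0 : ℝ)..L, DGgPC.charVar S v n t x * ψ x
        = ∑ l, S l n * ∫ x in (0 : ℝ)..L, v l t x * ψ x := by
    intro t ht ψ hψ
    simp only [DGgPC.charVar, Finset.sum_mul, mul_assoc]
    rw [intervalIntegral.integral_finsetSum fun l _ =>
      ((hv.1 l t ht).mul_continuous_intervalIntegrable hL hψ _ _).const_mul _]
    simp only [intervalIntegral.integral_const_mul]
  refine ⟨fun t ht => PerL2.sum _ fun l _ => (hv.1 l t ht).const_mul _, ?_⟩
  intro φ hφ hp t ht
  have hφ' : Continuous (deriv φ) := (contDiff_infty_iff_deriv.1 hφ).2.continuous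
  have h := HasDerivWithinAt.fun_sum (u := Finset.univ) fun (l : Fin (N + 1)) _ =>
    (hv.2 φ hφ hp l t ht).const_mul (S l n)
  refine (h.congr (fun s hs => hint s hs φ hφ.continuous) (hint t ht φ hφ.continuous)).congr_deriv ?_
  rw [hint t ht _ hφ']
  simp only [mul_neg, Finset.sum_neg_distrib, neg_inj, Finset.mul_sum]
  rw [Finset.sum_comm]
  refine Finset.sum_congr rfl fun j _ => ?_
  have h2 := congrFun (congrFun hSA n) j
  rw [Matrix.diagonal_mul, Matrix.mul_apply] at h2
  simp only [Matrix.transpose_apply] at h2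
  rw [← mul_assoc, ← h2, Finset.sum_mul]
  exact Finset.sum_congr rfl fun l _ => by ring

lemma PerSobolev.charVar {s : ℕ} (hL : 0 < L) {v : Fin (N + 1) → ℝ → ℝ → ℝ} {t : ℝ}
    (hv : ∀ l, PerSobolev L s (v l t)) (n : Fin (N + 1)) :
    PerSobolev L s (charVar S v n t) := by
  refine ⟨PerL2.sum _ fun l _ => (hv l).1.const_mul _, fun j hj => ?_⟩
  have h := fun l => weakDeriv_spec ((hv l).2 j hj)
  exact ⟨_, PerL2.sum Finset.univ fun l _ => (h l).1.const_mul (S l n),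
    IsWeakDeriv.sum hL _ (fun l => (hv l).1) (fun l => (h l).1) fun l => (h l).2⟩

lemma vecSemi_sq {ι : Type} [Fintype ι] (L : ℝ) (s : ℕ) (f : ι → ℝ → ℝ) :
    vecSemi L s f ^ 2 = ∑ n, semi L s (f n) ^ 2 :=
  Real.sq_sqrt (Finset.sum_nonneg fun _ _ => sq_nonneg _)

/-- An orthogonal change of variables preserves the Sobolev seminorm. -/
lemma sum_semi_sq_charVar {s : ℕ} (hL : 0 < L) (hS : Sᵀ * S = 1)
    {v : Fin (N + 1) → ℝ → ℝ → ℝ} {t : ℝ}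
    (hv : ∀ l, PerSobolev L s (v l t)) :
    ∑ n, semi L s (charVar S v n t) ^ 2 = vecSemi L s (fun l => v l t) ^ 2 := by
  have h := fun l => weakDeriv_spec ((hv l).2 s le_rfl)
  set d : Fin (N + 1) → ℝ → ℝ := fun l => weakDeriv L s (v l t) with hd
  have hdn : ∀ n, PerL2 L (fun x => ∑ l, S l n * d l x) := fun n =>
    PerL2.sum Finset.univ fun l _ => (h l).1.const_mul (S l n)
  have h1 : ∀ n, semi L s (charVar S v n t) ^ 2 = ∫ x in (0 : ℝ)..L, (∑ l, S l n * d l x) ^ 2 := by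
    intro n
    rw [← l2Norm_sq L hL.le]
    congr 1
    exact semi_eq hL (hdn n)
      (IsWeakDeriv.sum hL _ (fun l => (hv l).1) (fun l => (h l).1) fun l => (h l).2)
  have h2 : ∀ n, semi L s (v n t) ^ 2 = ∫ x in (0 : ℝ)..L, d n x ^ 2 := fun n =>
    l2Norm_sq L hL.le _
  rw [vecSemi_sq]
  simp only [h1, h2]
  rw [← intervalIntegral.integral_finsetSum fun n _ => (hdn n).sq_intervalIntegrable hL _ _,
    ← intervalIntegral.integral_finsetSum fun n _ => (h n).1.sq_intervalIntegrable hL _ _]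
  simp only [sum_sq_orthogonal_transpose hS, hd]

variable {𝒯 : Mesh L} {v : Fin (N + 1) → ℝ → ℝ → ℝ} {qh : Fin (N + 1) → ℝ → 𝒯.Broken}

lemma memLp_dgCoeff (n : Fin (N + 1)) (t : ℝ) :
    MemLp (dgCoeff S qh n t) 2 (volume.restrict (Ioc 0 L)) :=
  memLp_finsetSum _ fun l _ => (𝒯.memLp_toFun (qh l t)).const_mul (S n l)

/-- An orthogonal change of variables preserves the `L²` error. -/
lemma sum_integral_sq_sub_dgCoeff (hL : 0 < L) (hS : Sᵀ * S = 1) {t : ℝ}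
    (hv : ∀ n, PerL2 L (v n t)) :
    ∑ n, ∫ x in (0 : ℝ)..L, (v n t x - dgCoeff S qh n t x) ^ 2
      = ∑ n, ∫ x in (0 : ℝ)..L, (charVar S v n t x - 𝒯.toFun (qh n t) x) ^ 2 := by
  have i1 : ∀ n, IntervalIntegrable (fun x => (v n t x - dgCoeff S qh n t x) ^ 2) volume 0 L :=
    fun n => (intervalIntegrable_iff_integrableOn_Ioc_of_le hL.le).2
      ((hv n).2.sub (memLp_dgCoeff n t)).integrable_sq
  have i2 : ∀ n, IntervalIntegrable
      (fun x => (charVar S v n t x - 𝒯.toFun (qh n t) x) ^ 2) volume 0 L :=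
    fun n => (intervalIntegrable_iff_integrableOn_Ioc_of_le hL.le).2
      (((PerL2.sum Finset.univ fun l _ => (hv l).const_mul (S l n)).2.sub
        (𝒯.memLp_toFun (qh n t))).integrable_sq)
  rw [← intervalIntegral.integral_finsetSum fun n _ => i1 n,
    ← intervalIntegral.integral_finsetSum fun n _ => i2 n]
  refine intervalIntegral.integral_congr fun x _ => ?_
  refine Eq.trans ?_ (sum_sq_orthogonal hS fun l => charVar S v l t x - 𝒯.toFun (qh l t) x)
  refine Finset.sum_congr rfl fun n _ => ?_
  rw [← sum_charVar hS v n t x, dgCoeff, ← Finset.sum_sub_distrib]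
  simp only [mul_sub]

end Characteristic

/-! ### The error of the DG method for the Galerkin system -/

section SystemError

variable {L T M : ℝ} {α β : ℝ} {c : ℝ → ℝ} {P : ℕ → ℝ[X]} {u : ℝ → ℝ → ℝ → ℝ} {k N : ℕ}
  {𝒯 : Mesh L} {v : Fin (N + 1) → ℝ → ℝ → ℝ} {S : Matrix (Fin (N + 1)) (Fin (N + 1)) ℝ}
  {lam : Fin (N + 1) → ℝ} {qh : Fin (N + 1) → ℝ → 𝒯.Broken}

lemma ae_abs_le_of_forall_Ioo (hM : ∀ y ∈ Ioo (-1 : ℝ) 1, |c y| ≤ M) :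
    ∀ᵐ y ∂yLaw α β, |c y| ≤ M := by
  filter_upwards [ae_mem_Ioo_yLaw] with y hy using hM y hy

/-- The error estimates for the characteristic variables, and for the gPC coefficients in the
sum over all components. The constant `C` is that of the scalar estimate. -/
lemma IsDGgPC.error_le {C : ℝ} (hL : 0 < L) (hT : 0 < T) (hα : 0 < α) (hβ : 0 < β)
    (hc : Measurable c) (hM : ∀ y ∈ Ioo (-1 : ℝ) 1, |c y| ≤ M)
    (hP : IsOrthonormalPolynomials (yLaw α β) P)
    (hC : ∀ (𝒯 : Mesh L) (a : ℝ), |a| ≤ M → ∀ w : ℝ → ℝ → ℝ, IsTransportSolution L T a w →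
      PerSobolev L (k + 2) (w 0) → ∀ q : ℝ → 𝒯.Broken, IsDGSolution T k 𝒯 a (w 0) q →
      ∀ t ∈ Icc 0 T, l2Norm L (fun x => w t x - 𝒯.toFun (q t) x)
        ≤ C * semi L (k + 2) (w 0) * 𝒯.size ^ (k + 1))
    (h : IsDGgPC T k N (yLaw α β) c P u 𝒯 v S lam qh) {t : ℝ} (ht : t ∈ Icc 0 T) :
    (∀ n, l2Norm L (fun x => charVar S v n t x - 𝒯.toFun (qh n t) x)
      ≤ C * semi L (k + 2) (charVar S v n 0) * 𝒯.size ^ (k + 1)) ∧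
    ∑ n, ∫ x in (0 : ℝ)..L, (v n t x - dgCoeff S qh n t x) ^ 2
      ≤ C ^ 2 * vecSemi L (k + 2) (fun l => v l 0) ^ 2 * 𝒯.size ^ (2 * (k + 1)) := by
  have := isProbabilityMeasure_yLaw hα hβ
  have h0 : (0 : ℝ) ∈ Icc 0 T := ⟨le_rfl, hT.le⟩
  have hscalar : ∀ n, l2Norm L (fun x => charVar S v n t x - 𝒯.toFun (qh n t) x)
      ≤ C * semi L (k + 2) (charVar S v n 0) * 𝒯.size ^ (k + 1) := fun n =>
    hC 𝒯 (lam n) (abs_eigenvalue_le ae_mem_Ioo_yLaw hP hc (ae_abs_le_of_forall_Ioo hM)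
      h.orthogonal h.diagonal n) _ (h.galerkin.charVar hL h.orthogonal h.diagonal n)
      (PerSobolev.charVar hL (fun l => h.smooth l 0 h0) n) _ (h.dg n) t ht
  refine ⟨hscalar, ?_⟩
  rw [sum_integral_sq_sub_dgCoeff hL h.orthogonal fun n => h.galerkin.1 n t ht,
    ← sum_semi_sq_charVar hL h.orthogonal fun l => h.smooth l 0 h0, Finset.mul_sum,
    Finset.sum_mul]
  refine Finset.sum_le_sum fun n _ => ?_
  rw [← l2Norm_sq L hL.le]
  calc _ ≤ (C * semi L (k + 2) (charVar S v n 0) * 𝒯.size ^ (k + 1)) ^ 2 :=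
        pow_le_pow_left₀ l2Norm_nonneg (hscalar n) 2
    _ = _ := by ring

lemma IsDGgPC.coeff_error_le {C : ℝ} (hL : 0 < L) (hC0 : 0 ≤ C)
    (n : Fin (N + 1)) {t : ℝ}
    (h : ∑ n, ∫ x in (0 : ℝ)..L, (v n t x - dgCoeff S qh n t x) ^ 2
      ≤ C ^ 2 * vecSemi L (k + 2) (fun l => v l 0) ^ 2 * 𝒯.size ^ (2 * (k + 1))) :
    l2Norm L (fun x => v n t x - dgCoeff S qh n t x)
      ≤ C * vecSemi L (k + 2) (fun l => v l 0) * 𝒯.size ^ (k + 1) := by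
  have hs : 0 ≤ 𝒯.size := 𝒯.size_pos.le
  have hv : 0 ≤ vecSemi L (k + 2) (fun l => v l 0) := Real.sqrt_nonneg _
  unfold l2Norm
  rw [Real.sqrt_le_left (by positivity)]
  refine (Finset.single_le_sum (f := fun n => ∫ x in (0 : ℝ)..L,
    (v n t x - dgCoeff S qh n t x) ^ 2) (fun n _ => intervalIntegral.integral_nonneg hL.le
      fun _ _ => sq_nonneg _) (Finset.mem_univ n)).trans (h.trans (le_of_eq ?_))
  ring

end SystemError

/-! ### Square-integrable functions of space and of the random variable -/

section Product

variable {L : ℝ} {μ : Measure ℝ} {w : ℝ → ℝ → ℝ}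

lemma integrable_mul_mul_of_memLp (hw : MemLp (fun p : ℝ × ℝ => w p.1 p.2) 2
    ((volume.restrict (Ioc 0 L)).prod μ)) {f g : ℝ → ℝ}
    (hf : MemLp f 2 (volume.restrict (Ioc 0 L))) (hg : MemLp g 2 μ) :
    Integrable (fun p : ℝ × ℝ => w p.1 p.2 * (f p.1 * g p.2))
      ((volume.restrict (Ioc 0 L)).prod μ) := by
  have h2 : MemLp (fun p : ℝ × ℝ => f p.1 * g p.2) 2 ((volume.restrict (Ioc 0 L)).prod μ) := by
    have hm : AEStronglyMeasurable (fun p : ℝ × ℝ => f p.1 * g p.2)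
        ((volume.restrict (Ioc 0 L)).prod μ) := hf.1.comp_fst.mul hg.1.comp_snd
    rw [memLp_two_iff_integrable_sq hm]
    simp only [mul_pow]
    exact hf.integrable_sq.mul_prod hg.integrable_sq
  exact hw.integrable_mul h2

variable [IsProbabilityMeasure μ]

lemma ae_memLp_section (hw : MemLp (fun p : ℝ × ℝ => w p.1 p.2) 2
    ((volume.restrict (Ioc 0 L)).prod μ)) :
    ∀ᵐ x ∂volume.restrict (Ioc 0 L), MemLp (w x) 2 μ := by
  filter_upwards [hw.1.prodMk_left, hw.integrable_sq.prod_right_ae] with x h1 h2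
  exact (memLp_two_iff_integrable_sq h1).2 h2

lemma intervalIntegral_eq_integral_restrict (hL : 0 < L) (f : ℝ → ℝ) :
    ∫ x in (0 : ℝ)..L, f x = ∫ x, f x ∂volume.restrict (Ioc 0 L) :=
  intervalIntegral.integral_of_le hL.le

/-- The moment of `w(·, y)` against a bounded test function is square integrable in `y`. -/
lemma memLp_spatial_moment (hL : 0 < L) (hw : MemLp (fun p : ℝ × ℝ => w p.1 p.2) 2
    ((volume.restrict (Ioc 0 L)).prod μ)) {ψ : ℝ → ℝ} (hψ : Continuous ψ) (hb : ∀ x, |ψ x| ≤ 1) :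
    MemLp (fun y => ∫ x in (0 : ℝ)..L, w x y * ψ x) 2 μ := by
  have hm : AEStronglyMeasurable (fun p : ℝ × ℝ => w p.1 p.2 * ψ p.1)
      ((volume.restrict (Ioc 0 L)).prod μ) := hw.1.mul (by fun_prop)
  have hm' : AEStronglyMeasurable (fun y => ∫ x in (0 : ℝ)..L, w x y * ψ x) μ := by
    simp only [intervalIntegral_eq_integral_restrict hL]
    exact hm.prod_swap.integral_prod_right'
  rw [memLp_two_iff_integrable_sq hm']
  have hsw := hw.integrable_sq.swap
  refine (hsw.integral_prod_left.const_mul L).mono' (hm'.pow 2) ?_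
  filter_upwards [hw.1.prod_swap.prodMk_left, hsw.prod_right_ae] with y h1 h2
  have hs : MemLp (fun x => w x y) 2 (volume.restrict (Ioc 0 L)) :=
    (memLp_two_iff_integrable_sq h1).2 h2
  have hi : IntervalIntegrable (fun x => w x y * ψ x) volume 0 L := by
    rw [intervalIntegrable_iff_integrableOn_Ioc_of_le hL.le]
    exact (hs.integrable (by norm_num)).mul_bdd (c := 1) hψ.aestronglyMeasurable
      (Filter.Eventually.of_forall hb)
  have hle : ∀ x, (w x y * ψ x) ^ 2 ≤ w x y ^ 2 := fun x => by
    rw [mul_pow]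
    have : ψ x ^ 2 ≤ 1 := by rw [← sq_abs]; exact pow_le_one₀ (abs_nonneg _) (hb x)
    nlinarith [sq_nonneg (w x y)]
  have hi2 : IntervalIntegrable (fun x => (w x y * ψ x) ^ 2) volume 0 L := by
    rw [intervalIntegrable_iff_integrableOn_Ioc_of_le hL.le]
    refine h2.mono' ((h1.mul hψ.aestronglyMeasurable).pow 2) (Filter.Eventually.of_forall fun x => ?_)
    rw [Real.norm_eq_abs, abs_of_nonneg (sq_nonneg _)]
    exact hle x
  have hcs := sq_integral_abs_le hL hi hi2
  rw [sub_zero] at hcs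
  rw [Real.norm_eq_abs, abs_of_nonneg (sq_nonneg _)]
  calc (∫ x in (0 : ℝ)..L, w x y * ψ x) ^ 2 ≤ (∫ x in (0 : ℝ)..L, |w x y * ψ x|) ^ 2 := by
        rw [← sq_abs]
        exact pow_le_pow_left₀ (abs_nonneg _)
          (intervalIntegral.abs_integral_le_integral_abs hL.le) 2
    _ ≤ L * ∫ x in (0 : ℝ)..L, (w x y * ψ x) ^ 2 := hcs
    _ ≤ L * ∫ x, w x y ^ 2 ∂volume.restrict (Ioc 0 L) := by
        rw [intervalIntegral_eq_integral_restrict hL]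
        refine mul_le_mul_of_nonneg_left (integral_mono ?_ h2 hle) hL.le
        exact (intervalIntegrable_iff_integrableOn_Ioc_of_le hL.le).1 hi2

/-- Fubini's theorem for the coefficient of an expansion in `y`. -/
lemma integral_coeff_mul_test (hL : 0 < L) (hw : MemLp (fun p : ℝ × ℝ => w p.1 p.2) 2
    ((volume.restrict (Ioc 0 L)).prod μ)) {ψ g : ℝ → ℝ} (hψ : Continuous ψ) (hg : MemLp g 2 μ) :
    ∫ x in (0 : ℝ)..L, (∫ y, w x y * g y ∂μ) * ψ x
      = ∫ y, (∫ x in (0 : ℝ)..L, w x y * ψ x) * g y ∂μ := by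
  have hψm : MemLp ψ 2 (volume.restrict (Ioc 0 L)) := by
    rw [memLp_two_iff_integrable_sq hψ.aestronglyMeasurable]
    exact ((hψ.pow 2).integrableOn_Icc).mono_set Ioc_subset_Icc_self
  have h := integral_integral_swap (f := fun x y => w x y * (ψ x * g y))
    (integrable_mul_mul_of_memLp hw hψm hg)
  simp only [intervalIntegral_eq_integral_restrict hL, ← integral_mul_const]
  convert! h using 3 <;> (congr 1; funext z; ring)

variable {P : ℕ → ℝ[X]}

/-- The expansion coefficients of `w(x, ·)` are square integrable in `x`, by Bessel's inequality for
almost every `x`. -/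
lemma memLp_expansion_coeff (hμ : ∀ᵐ y ∂μ, y ∈ Ioo (-1 : ℝ) 1)
    (hP : IsOrthonormalPolynomials μ P) (hw : MemLp (fun p : ℝ × ℝ => w p.1 p.2) 2
      ((volume.restrict (Ioc 0 L)).prod μ)) (n : ℕ) :
    MemLp (fun x => ∫ y, w x y * (P n).eval y ∂μ) 2 (volume.restrict (Ioc 0 L)) := by
  have hm : AEStronglyMeasurable (fun x => ∫ y, w x y * (P n).eval y ∂μ)
      (volume.restrict (Ioc 0 L)) := by
    have : AEStronglyMeasurable (fun p : ℝ × ℝ => w p.1 p.2 * (P n).eval p.2)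
      ((volume.restrict (Ioc 0 L)).prod μ) := hw.1.mul (by fun_prop)
    exact this.integral_prod_right'
  rw [memLp_two_iff_integrable_sq hm]
  refine hw.integrable_sq.integral_prod_left.mono' (hm.pow 2) ?_
  filter_upwards [ae_memLp_section hw] with x hx
  rw [Real.norm_eq_abs, abs_of_nonneg (sq_nonneg _)]
  simpa using sum_sq_integral_mul_le hμ hP (e := fun _ : Fin 1 => n)
    (fun _ _ _ => Subsingleton.elim _ _) hx

/-- Parseval's identity for the expansion coefficients, integrated in space. -/
lemma hasSum_integral_sq_expansion_coeff (hL : 0 < L) (hμ : ∀ᵐ y ∂μ, y ∈ Ioo (-1 : ℝ) 1)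
    (hP : IsOrthonormalPolynomials μ P) (hw : MemLp (fun p : ℝ × ℝ => w p.1 p.2) 2
      ((volume.restrict (Ioc 0 L)).prod μ)) :
    HasSum (fun n => ∫ x in (0 : ℝ)..L, (∫ y, w x y * (P n).eval y ∂μ) ^ 2)
      (∫ y, (∫ x in (0 : ℝ)..L, w x y ^ 2) ∂μ) := by
  have hint : ∀ n, Integrable (fun x => (∫ y, w x y * (P n).eval y ∂μ) ^ 2)
      (volume.restrict (Ioc 0 L)) := fun n => (memLp_expansion_coeff hμ hP hw n).integrable_sq
  have hsq := hw.integrable_sq.integral_prod_left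
  have hswap : ∫ y, (∫ x in (0 : ℝ)..L, w x y ^ 2) ∂μ
      = ∫ x, ∫ y, w x y ^ 2 ∂μ ∂volume.restrict (Ioc 0 L) := by
    simp only [intervalIntegral_eq_integral_restrict hL]
    exact (integral_integral_swap (f := fun x y => w x y ^ 2) hw.integrable_sq).symm
  have hsum : Summable fun n =>
      ∫ x, ‖(∫ y, w x y * (P n).eval y ∂μ) ^ 2‖ ∂volume.restrict (Ioc 0 L) := by
    refine summable_of_sum_range_le (c := ∫ x, ∫ y, w x y ^ 2 ∂μ ∂volume.restrict (Ioc 0 L))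
      (fun n => integral_nonneg fun _ => norm_nonneg _) fun N => ?_
    rw [← integral_finsetSum _ fun n _ => (hint n).norm]
    refine integral_mono_ae (integrable_finsetSum _ fun n _ => (hint n).norm) hsq ?_
    filter_upwards [ae_memLp_section hw] with x hx
    simp only [norm_pow, Real.norm_eq_abs, sq_abs, Finset.sum_range]
    exact sum_sq_integral_mul_le hμ hP (e := fun i : Fin N => (i : ℕ)) Fin.val_injective hx
  have h := hasSum_integral_of_summable_integral_norm hint hsum
  simp only [intervalIntegral_eq_integral_restrict hL] at hswap ⊢
  rw [hswap]
  convert! h using 1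
  refine integral_congr_ae ?_
  filter_upwards [ae_memLp_section hw] with x hx
  exact (hasSum_sq_integral_mul hμ hP hx).tsum_eq.symm

/-- The mean-square distance to a finite expansion with arbitrary coefficients. -/
lemma integral_integral_sq_sub_expansion (hL : 0 < L) (hμ : ∀ᵐ y ∂μ, y ∈ Ioo (-1 : ℝ) 1)
    (hP : IsOrthonormalPolynomials μ P) (hw : MemLp (fun p : ℝ × ℝ => w p.1 p.2) 2
      ((volume.restrict (Ioc 0 L)).prod μ)) {N : ℕ} {d : Fin (N + 1) → ℝ → ℝ}
    (hd : ∀ n, MemLp (d n) 2 (volume.restrict (Ioc 0 L))) :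
    ∫ y, (∫ x in (0 : ℝ)..L, (w x y - ∑ n : Fin (N + 1), d n x * (P n).eval y) ^ 2) ∂μ
      = (∫ y, (∫ x in (0 : ℝ)..L, w x y ^ 2) ∂μ)
        - ∑ n : Fin (N + 1), (∫ x in (0 : ℝ)..L, (∫ y, w x y * (P n).eval y ∂μ) ^ 2)
        + ∑ n : Fin (N + 1), ∫ x in (0 : ℝ)..L, ((∫ y, w x y * (P n).eval y ∂μ) - d n x) ^ 2 := by
  have hPm : ∀ n, MemLp (fun y => (P n).eval y) 2 μ := fun n =>
    memLp_of_continuous hμ (P n).continuous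
  have hdP : ∀ n : Fin (N + 1), MemLp (fun p : ℝ × ℝ => d n p.1 * (P n).eval p.2) 2
      ((volume.restrict (Ioc 0 L)).prod μ) := by
    intro n
    have hm : AEStronglyMeasurable (fun p : ℝ × ℝ => d n p.1 * (P n).eval p.2)
        ((volume.restrict (Ioc 0 L)).prod μ) := (hd n).1.comp_fst.mul (hPm n).1.comp_snd
    rw [memLp_two_iff_integrable_sq hm]
    simp only [mul_pow]
    exact (hd n).integrable_sq.mul_prod (hPm n).integrable_sq
  have htot : MemLp (fun p : ℝ × ℝ => w p.1 p.2 - ∑ n : Fin (N + 1), d n p.1 * (P n).eval p.2) 2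
      ((volume.restrict (Ioc 0 L)).prod μ) := hw.sub (memLp_finsetSum _ fun n _ => hdP n)
  have i1 : ∀ n : Fin (N + 1), Integrable (fun x => (∫ y, w x y * (P n).eval y ∂μ) ^ 2)
      (volume.restrict (Ioc 0 L)) := fun n => (memLp_expansion_coeff hμ hP hw n).integrable_sq
  have i2 : ∀ n : Fin (N + 1), Integrable (fun x => ((∫ y, w x y * (P n).eval y ∂μ) - d n x) ^ 2)
      (volume.restrict (Ioc 0 L)) := fun n =>
    ((memLp_expansion_coeff hμ hP hw n).sub (hd n)).integrable_sq
  have i0 := hw.integrable_sq.integral_prod_left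
  simp only [intervalIntegral_eq_integral_restrict hL]
  rw [← integral_integral_swap (f := fun x y => w x y ^ 2) hw.integrable_sq,
    ← integral_integral_swap
      (f := fun x y => (w x y - ∑ n : Fin (N + 1), d n x * (P n).eval y) ^ 2) htot.integrable_sq,
    ← integral_finsetSum _ fun n _ => i1 n, ← integral_finsetSum _ fun n _ => i2 n,
    ← integral_sub i0 (integrable_finsetSum _ fun n _ => i1 n)]
  have i3 : Integrable (fun x => (∫ y, w x y ^ 2 ∂μ)
      - ∑ n : Fin (N + 1), (∫ y, w x y * (P n).eval y ∂μ) ^ 2) (volume.restrict (Ioc 0 L)) :=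
    i0.sub (integrable_finsetSum _ fun n _ => i1 n)
  rw [← integral_add i3 (integrable_finsetSum _ fun n _ => i2 n)]
  refine integral_congr_ae ?_
  filter_upwards [ae_memLp_section hw] with x hx
  exact integral_sq_sub_sum hμ hP (e := fun i : Fin (N + 1) => (i : ℕ)) Fin.val_injective hx
    fun n => d n x

end Product

/-! ### The Fourier modes of the gPC coefficients -/

section Modes

variable {L T M : ℝ} {μ : Measure ℝ} {c : ℝ → ℝ} {P : ℕ → ℝ[X]}
  {u : ℝ → ℝ → ℝ → ℝ}

/-- The derivative of the expectation of a pair of modes that rotates with the random angular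
velocity `b c(y)`. -/
lemma hasDerivAt_integral_rotation (hc : Measurable c) (hM : ∀ᵐ y ∂μ, |c y| ≤ M)
    {C D g : ℝ → ℝ} (hC : MemLp C 2 μ) (hD : MemLp D 2 μ) (hg : MemLp g 2 μ) (b t : ℝ) :
    HasDerivAt
      (fun t => ∫ y, (C y * Real.cos (c y * b * t) + D y * Real.sin (c y * b * t)) * g y ∂μ)
      (b * ∫ y, c y * ((D y * Real.cos (c y * b * t) - C y * Real.sin (c y * b * t)) * g y) ∂μ)
      t := by
  have hcos : ∀ t, AEStronglyMeasurable (fun y => Real.cos (c y * b * t)) μ := fun t =>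
    (Real.measurable_cos.comp ((hc.mul_const b).mul_const t)).aestronglyMeasurable
  have hsin : ∀ t, AEStronglyMeasurable (fun y => Real.sin (c y * b * t)) μ := fun t =>
    (Real.measurable_sin.comp ((hc.mul_const b).mul_const t)).aestronglyMeasurable
  have hb1 : Integrable (fun y => (|C y| + |D y|) * |g y|) μ :=
    (hC.abs.add hD.abs).integrable_mul hg.abs
  have hcs : ∀ (y s : ℝ), |C y * Real.cos s + D y * Real.sin s| ≤ |C y| + |D y| := by
    intro y s
    refine (abs_add_le _ _).trans ?_
    rw [abs_mul, abs_mul]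
    exact add_le_add (mul_le_of_le_one_right (abs_nonneg _) (Real.abs_cos_le_one _))
      (mul_le_of_le_one_right (abs_nonneg _) (Real.abs_sin_le_one _))
  have h := (hasDerivAt_integral_of_dominated_loc_of_deriv_le (μ := μ) (s := univ) (x₀ := t)
    (bound := fun y => |b| * M * ((|C y| + |D y|) * |g y|))
    (F := fun t y => (C y * Real.cos (c y * b * t) + D y * Real.sin (c y * b * t)) * g y)
    (F' := fun t y => b * (c y *
      ((D y * Real.cos (c y * b * t) - C y * Real.sin (c y * b * t)) * g y)))
    Filter.univ_mem ?_ ?_ ?_ ?_ (hb1.const_mul _) ?_).2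
  · rwa [integral_const_mul] at h
  · exact Filter.Eventually.of_forall fun s =>
      ((hC.1.mul (hcos s)).add (hD.1.mul (hsin s))).mul hg.1
  · refine hb1.mono' (((hC.1.mul (hcos t)).add (hD.1.mul (hsin t))).mul hg.1) ?_
    refine Filter.Eventually.of_forall fun y => ?_
    rw [Real.norm_eq_abs, abs_mul]
    exact mul_le_mul_of_nonneg_right (hcs y _) (abs_nonneg _)
  · exact ((hc.aestronglyMeasurable.mul
      (((hD.1.mul (hcos t)).sub (hC.1.mul (hsin t))).mul hg.1)).const_mul b)
  · filter_upwards [hM] with y hy s _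
    have h1 : |D y * Real.cos (c y * b * s) - C y * Real.sin (c y * b * s)| ≤ |C y| + |D y| := by
      have := hcs y (Real.pi / 2 + c y * b * s)
      rw [Real.cos_add, Real.sin_add, Real.cos_pi_div_two, Real.sin_pi_div_two] at this
      simpa [← sub_eq_neg_add] using this
    rw [Real.norm_eq_abs, abs_mul, abs_mul, abs_mul, mul_assoc |b|]
    have hM0 : 0 ≤ M := (abs_nonneg _).trans hy
    gcongr
  · refine Filter.Eventually.of_forall fun y s _ => ?_
    have hl : HasDerivAt (fun s => c y * b * s) (c y * b) s := by
      simpa using (hasDerivAt_id s).const_mul (c y * b)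
    exact (((hl.cos.const_mul (C y)).add (hl.sin.const_mul (D y))).mul_const (g y)).congr_deriv
      (by ring)

variable [IsProbabilityMeasure μ]

lemma abs_cos_freq_le (L : ℝ) (m : ℤ) (x : ℝ) : |Real.cos (freq L m * x)| ≤ 1 :=
  Real.abs_cos_le_one _

lemma abs_sin_freq_le (L : ℝ) (m : ℤ) (x : ℝ) : |Real.sin (freq L m * x)| ≤ 1 :=
  Real.abs_sin_le_one _

lemma IsModelSolution.memLp_cosCoeff (hL : 0 < L) (hu : IsModelSolution L T μ c u) (m : ℤ)
    {t : ℝ} (ht : t ∈ Icc 0 T) : MemLp (fun y => cosCoeff L m fun x => u x t y) 2 μ :=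
  memLp_spatial_moment (w := fun x y => u x t y) hL (hu.2 t ht) (by fun_prop) (abs_cos_freq_le L m)

lemma IsModelSolution.memLp_sinCoeff (hL : 0 < L) (hu : IsModelSolution L T μ c u) (m : ℤ)
    {t : ℝ} (ht : t ∈ Icc 0 T) : MemLp (fun y => sinCoeff L m fun x => u x t y) 2 μ :=
  memLp_spatial_moment (w := fun x y => u x t y) hL (hu.2 t ht) (by fun_prop) (abs_sin_freq_le L m)

lemma memLp_eval (hμ : ∀ᵐ y ∂μ, y ∈ Ioo (-1 : ℝ) 1) (p : ℝ[X]) :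
    MemLp (fun y => p.eval y) 2 μ := memLp_of_continuous hμ p.continuous

lemma cosCoeff_gpcCoeff (hL : 0 < L) (hμ : ∀ᵐ y ∂μ, y ∈ Ioo (-1 : ℝ) 1)
    (hu : IsModelSolution L T μ c u) (m : ℤ) (n : ℕ) {t : ℝ} (ht : t ∈ Icc 0 T) :
    cosCoeff L m (gpcCoeff μ P u n t)
      = ∫ y, (cosCoeff L m fun x => u x t y) * (P n).eval y ∂μ :=
  integral_coeff_mul_test (w := fun x y => u x t y) hL (hu.2 t ht)
    (ψ := fun x => Real.cos (freq L m * x)) (by fun_prop) (memLp_eval hμ (P n))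

lemma sinCoeff_gpcCoeff (hL : 0 < L) (hμ : ∀ᵐ y ∂μ, y ∈ Ioo (-1 : ℝ) 1)
    (hu : IsModelSolution L T μ c u) (m : ℤ) (n : ℕ) {t : ℝ} (ht : t ∈ Icc 0 T) :
    sinCoeff L m (gpcCoeff μ P u n t)
      = ∫ y, (sinCoeff L m fun x => u x t y) * (P n).eval y ∂μ :=
  integral_coeff_mul_test (w := fun x y => u x t y) hL (hu.2 t ht)
    (ψ := fun x => Real.sin (freq L m * x)) (by fun_prop) (memLp_eval hμ (P n))

lemma hasDerivWithinAt_cosCoeff_gpcCoeff (hL : 0 < L) (hT : 0 < T)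
    (hμ : ∀ᵐ y ∂μ, y ∈ Ioo (-1 : ℝ) 1)
    (hc : Measurable c) (hM : ∀ᵐ y ∂μ, |c y| ≤ M)
    (hu : IsModelSolution L T μ c u) (m : ℤ) (n : ℕ) {t : ℝ} (ht : t ∈ Icc 0 T) :
    HasDerivWithinAt (fun t => cosCoeff L m (gpcCoeff μ P u n t))
      (freq L m * ∫ y, c y * ((sinCoeff L m fun x => u x t y) * (P n).eval y) ∂μ) (Icc 0 T) t := by
  have h0 : (0 : ℝ) ∈ Icc 0 T := ⟨le_rfl, hT.le⟩
  have h := (hasDerivAt_integral_rotation hc hM (hu.memLp_cosCoeff hL m h0)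
    (hu.memLp_sinCoeff hL m h0) (memLp_eval hμ (P n)) (freq L m) t).hasDerivWithinAt
    (s := Icc 0 T)
  have hF : ∀ s ∈ Icc 0 T, cosCoeff L m (gpcCoeff μ P u n s)
      = ∫ y, ((cosCoeff L m fun x => u x 0 y) * Real.cos (c y * freq L m * s)
        + (sinCoeff L m fun x => u x 0 y) * Real.sin (c y * freq L m * s)) * (P n).eval y ∂μ := by
    intro s hs
    rw [cosCoeff_gpcCoeff hL hμ hu m n hs]
    refine integral_congr_ae ?_
    filter_upwards [hu.1] with y hy
    rw [(hy.coeff_eq hL m hs).1]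
  refine (h.congr hF (hF t ht)).congr_deriv ?_
  congr 1
  refine integral_congr_ae ?_
  filter_upwards [hu.1] with y hy
  rw [(hy.coeff_eq hL m ht).2]

lemma hasDerivWithinAt_sinCoeff_gpcCoeff (hL : 0 < L) (hT : 0 < T)
    (hμ : ∀ᵐ y ∂μ, y ∈ Ioo (-1 : ℝ) 1)
    (hc : Measurable c) (hM : ∀ᵐ y ∂μ, |c y| ≤ M)
    (hu : IsModelSolution L T μ c u) (m : ℤ) (n : ℕ) {t : ℝ} (ht : t ∈ Icc 0 T) :
    HasDerivWithinAt (fun t => sinCoeff L m (gpcCoeff μ P u n t))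
      (-(freq L m * ∫ y, c y * ((cosCoeff L m fun x => u x t y) * (P n).eval y) ∂μ))
      (Icc 0 T) t := by
  have h0 : (0 : ℝ) ∈ Icc 0 T := ⟨le_rfl, hT.le⟩
  have h := (hasDerivAt_integral_rotation hc hM (hu.memLp_sinCoeff hL m h0)
    (hu.memLp_cosCoeff hL m h0).neg (memLp_eval hμ (P n)) (freq L m) t).hasDerivWithinAt
    (s := Icc 0 T)
  have hF : ∀ s ∈ Icc 0 T, sinCoeff L m (gpcCoeff μ P u n s)
      = ∫ y, ((sinCoeff L m fun x => u x 0 y) * Real.cos (c y * freq L m * s)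
        + (-fun y => cosCoeff L m fun x => u x 0 y) y * Real.sin (c y * freq L m * s))
          * (P n).eval y ∂μ := by
    intro s hs
    rw [sinCoeff_gpcCoeff hL hμ hu m n hs]
    refine integral_congr_ae ?_
    filter_upwards [hu.1] with y hy
    rw [(hy.coeff_eq hL m hs).2]
    simp only [Pi.neg_apply]
    ring
  refine (h.congr hF (hF t ht)).congr_deriv ?_
  rw [← mul_neg, ← integral_neg]
  congr 1
  refine integral_congr_ae ?_
  filter_upwards [hu.1] with y hy
  rw [(hy.coeff_eq hL m ht).1]
  simp only [Pi.neg_apply]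
  ring

/-- The Fourier coefficients of a solution of the Galerkin system. -/
lemma IsSystemSolution.hasDerivWithinAt_coeff {ι : Type} [Fintype ι] {A : Matrix ι ι ℝ}
    {v : ι → ℝ → ℝ → ℝ} (hL : 0 < L) (hv : IsSystemSolution L T A v) (m : ℤ) (n : ι) {t : ℝ}
    (ht : t ∈ Icc 0 T) :
    HasDerivWithinAt (fun t => cosCoeff L m (v n t))
        (freq L m * ∑ l, A n l * sinCoeff L m (v l t)) (Icc 0 T) t ∧
      HasDerivWithinAt (fun t => sinCoeff L m (v n t))
        (-(freq L m * ∑ l, A n l * cosCoeff L m (v l t))) (Icc 0 T) t := by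
  have h1 := hv.2 _ (contDiff_cos_freq L m) (periodic_cos_freq hL.ne' m) n t ht
  have h2 := hv.2 _ (contDiff_sin_freq L m) (periodic_sin_freq hL.ne' m) n t ht
  simp only [integral_mul_deriv_cos] at h1
  simp only [integral_mul_deriv_sin] at h2
  constructor
  · refine h1.congr_deriv ?_
    rw [Finset.mul_sum, ← Finset.sum_neg_distrib]
    exact Finset.sum_congr rfl fun l _ => by ring
  · refine h2.congr_deriv ?_
    rw [Finset.mul_sum]
    congr 1
    exact Finset.sum_congr rfl fun l _ => by ring

/-- The rate of change of the energy of the Galerkin error in one Fourier mode. The coupling of the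
error with itself cancels because `c` is real, and only the truncated part of the mode remains. -/
lemma mode_energy_rate_le (hμ : ∀ᵐ y ∂μ, y ∈ Ioo (-1 : ℝ) 1) (hP : IsOrthonormalPolynomials μ P)
    (hc : Measurable c) (hM : ∀ᵐ y ∂μ, |c y| ≤ M) {N : ℕ} {C D : ℝ → ℝ}
    (hC : MemLp C 2 μ) (hD : MemLp D 2 μ) (vc vs : Fin (N + 1) → ℝ) (b : ℝ)
    {e s e' s' : Fin (N + 1) → ℝ}
    (he : ∀ n, e n = (∫ y, C y * (P n).eval y ∂μ) - vc n)
    (hs : ∀ n, s n = (∫ y, D y * (P n).eval y ∂μ) - vs n)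
    (he' : ∀ n, e' n = b * (∫ y, c y * (D y * (P n).eval y) ∂μ)
      - b * ∑ l, gpcMatrix μ c P N n l * vs l)
    (hs' : ∀ n, s' n = -(b * (∫ y, c y * (C y * (P n).eval y) ∂μ))
      - -(b * ∑ l, gpcMatrix μ c P N n l * vc l)) :
    ∑ n, (2 * e n * e' n + 2 * s n * s' n) ≤ ∑ n, (e n ^ 2 + s n ^ 2)
      + b ^ 2 * M ^ 2 * (((∫ y, C y ^ 2 ∂μ)
          - ∑ n : Fin (N + 1), (∫ y, C y * (P n).eval y ∂μ) ^ 2)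
        + ((∫ y, D y ^ 2 ∂μ) - ∑ n : Fin (N + 1), (∫ y, D y * (P n).eval y ∂μ) ^ 2)) := by
  have hval : Function.Injective fun i : Fin (N + 1) => (i : ℕ) := Fin.val_injective
  have hPm : ∀ n, MemLp (fun y => (P n).eval y) 2 μ := fun n => memLp_eval hμ (P n)
  have hcomb : ∀ x : Fin (N + 1) → ℝ,
      MemLp (fun y => ∑ n : Fin (N + 1), x n * (P n).eval y) 2 μ := fun x =>
    memLp_of_continuous hμ (by fun_prop)
  set a₁ : Fin (N + 1) → ℝ := fun n => ∫ y, C y * (P n).eval y ∂μ with ha₁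
  set a₂ : Fin (N + 1) → ℝ := fun n => ∫ y, D y * (P n).eval y ∂μ with ha₂
  -- `Z₁`, `Z₂` carry the error; `R₁`, `R₂` are the truncated parts of the mode.
  set Z₁ : ℝ → ℝ := fun y => ∑ n : Fin (N + 1), e n * (P n).eval y with hZ₁
  set Z₂ : ℝ → ℝ := fun y => ∑ n : Fin (N + 1), s n * (P n).eval y with hZ₂
  set R₁ : ℝ → ℝ := fun y => C y - ∑ n : Fin (N + 1), a₁ n * (P n).eval y with hR₁
  set R₂ : ℝ → ℝ := fun y => D y - ∑ n : Fin (N + 1), a₂ n * (P n).eval y with hR₂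
  have mZ₁ : MemLp Z₁ 2 μ := hcomb e
  have mZ₂ : MemLp Z₂ 2 μ := hcomb s
  have mR₁ : MemLp R₁ 2 μ := hC.sub (hcomb a₁)
  have mR₂ : MemLp R₂ 2 μ := hD.sub (hcomb a₂)
  have iZ₁ : ∫ y, Z₁ y ^ 2 ∂μ = ∑ n, e n ^ 2 := integral_sq_sum hμ hP hval e
  have iZ₂ : ∫ y, Z₂ y ^ 2 ∂μ = ∑ n, s n ^ 2 := integral_sq_sum hμ hP hval s
  have iR₁ : ∫ y, R₁ y ^ 2 ∂μ = (∫ y, C y ^ 2 ∂μ) - ∑ n, a₁ n ^ 2 := by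
    have := integral_sq_sub_sum hμ hP hval hC a₁
    simpa [ha₁] using this
  have iR₂ : ∫ y, R₂ y ^ 2 ∂μ = (∫ y, D y ^ 2 ∂μ) - ∑ n, a₂ n ^ 2 := by
    have := integral_sq_sub_sum hμ hP hval hD a₂
    simpa [ha₂] using this
  -- The pairing of a combination of the polynomials with the residual of the Galerkin system.
  have pairing : ∀ (x z z' : Fin (N + 1) → ℝ) (F : ℝ → ℝ), MemLp F 2 μ →
      (∀ n, z' n = (∫ y, F y * (P n).eval y ∂μ) - z n) →
      ∑ n : Fin (N + 1), x n * ((∫ y, c y * (F y * (P n).eval y) ∂μ)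
          - ∑ l, gpcMatrix μ c P N n l * z l)
        = ∫ y, c y * ((∑ n : Fin (N + 1), x n * (P n).eval y)
          * ((∑ n : Fin (N + 1), z' n * (P n).eval y)
            + (F y - ∑ n : Fin (N + 1), (∫ y, F y * (P n).eval y ∂μ) * (P n).eval y))) ∂μ := by
    intro x z z' F hF hz'
    have hFz : MemLp (fun y => F y - ∑ l : Fin (N + 1), z l * (P l).eval y) 2 μ := hF.sub (hcomb z)
    have h1 : ∀ n : Fin (N + 1),
        (∫ y, c y * (F y * (P n).eval y) ∂μ) - ∑ l, gpcMatrix μ c P N n l * z l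
        = ∫ y, c y * ((F y - ∑ l : Fin (N + 1), z l * (P l).eval y) * (P n).eval y) ∂μ := by
      intro n
      rw [sum_gpcMatrix_mul hμ hc hM, ← integral_sub (integrable_coeff_mul hc hM hF (hPm n))
        (integrable_coeff_mul hc hM (hPm n) (hcomb z))]
      exact integral_congr_ae (Filter.Eventually.of_forall fun y => by ring)
    simp only [h1, ← integral_const_mul]
    rw [← integral_finsetSum _ fun (n : Fin (N + 1)) _ =>
      (integrable_coeff_mul hc hM hFz (hPm n)).const_mul (x n)]
    refine integral_congr_ae (Filter.Eventually.of_forall fun y => ?_)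
    have h2 : ∑ n : Fin (N + 1), z' n * (P n).eval y
        = (∑ n : Fin (N + 1), (∫ y, F y * (P n).eval y ∂μ) * (P n).eval y)
          - ∑ n : Fin (N + 1), z n * (P n).eval y := by
      rw [← Finset.sum_sub_distrib]
      exact Finset.sum_congr rfl fun n _ => by rw [hz']; ring
    simp only
    rw [h2, Finset.sum_mul, Finset.mul_sum]
    exact Finset.sum_congr rfl fun n _ => by ring
  have p₁ := pairing e vs s D hD hs
  have p₂ := pairing s vc e C hC he
  have hsum : ∑ n, (2 * e n * e' n + 2 * s n * s' n)
      = 2 * b * ((∫ y, c y * (Z₁ y * (Z₂ y + R₂ y)) ∂μ)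
        - ∫ y, c y * (Z₂ y * (Z₁ y + R₁ y)) ∂μ) := by
    rw [← p₁, ← p₂, ← Finset.sum_sub_distrib, Finset.mul_sum]
    refine Finset.sum_congr rfl fun n _ => ?_
    rw [he', hs']; ring
  have j₁ : Integrable (fun y => c y * (Z₁ y * (Z₂ y + R₂ y))) μ :=
    integrable_coeff_mul hc hM mZ₁ (mZ₂.add mR₂)
  have j₂ : Integrable (fun y => c y * (Z₂ y * (Z₁ y + R₁ y))) μ :=
    integrable_coeff_mul hc hM mZ₂ (mZ₁.add mR₁)
  have j₃ : Integrable (fun y => (Z₁ y ^ 2 + Z₂ y ^ 2) + b ^ 2 * M ^ 2 * (R₁ y ^ 2 + R₂ y ^ 2)) μ :=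
    (mZ₁.integrable_sq.add mZ₂.integrable_sq).add
      ((mR₁.integrable_sq.add mR₂.integrable_sq).const_mul _)
  have j₄ : Integrable (fun y => Z₁ y ^ 2 + Z₂ y ^ 2) μ := mZ₁.integrable_sq.add mZ₂.integrable_sq
  have j₅ : Integrable (fun y => b ^ 2 * M ^ 2 * (R₁ y ^ 2 + R₂ y ^ 2)) μ :=
    (mR₁.integrable_sq.add mR₂.integrable_sq).const_mul _
  have hle : 2 * b * ((∫ y, c y * (Z₁ y * (Z₂ y + R₂ y)) ∂μ)
        - ∫ y, c y * (Z₂ y * (Z₁ y + R₁ y)) ∂μ)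
      ≤ ∫ y, ((Z₁ y ^ 2 + Z₂ y ^ 2) + b ^ 2 * M ^ 2 * (R₁ y ^ 2 + R₂ y ^ 2)) ∂μ := by
    rw [← integral_sub j₁ j₂, ← integral_const_mul]
    refine integral_mono_ae ((j₁.sub j₂).const_mul _) j₃ ?_
    filter_upwards [hM] with y hy
    have hc2 : c y ^ 2 ≤ M ^ 2 := by
      rw [← sq_abs]; exact pow_le_pow_left₀ (abs_nonneg _) hy 2
    have h3 : b ^ 2 * c y ^ 2 * (R₁ y ^ 2 + R₂ y ^ 2) ≤ b ^ 2 * M ^ 2 * (R₁ y ^ 2 + R₂ y ^ 2) := by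
      gcongr
    -- The products `Z₁ Z₂` cancel pointwise, and the remaining products are split by these squares.
    have h4 : 0 ≤ (Z₁ y - b * c y * R₂ y) ^ 2 + (Z₂ y + b * c y * R₁ y) ^ 2 := by positivity
    linarith
  rw [hsum]
  refine hle.trans (le_of_eq ?_)
  rw [integral_add j₄ j₅,
    integral_add mZ₁.integrable_sq mZ₂.integrable_sq, integral_const_mul,
    integral_add mR₁.integrable_sq mR₂.integrable_sq, iZ₁, iZ₂, iR₁, iR₂, Finset.sum_add_distrib]

end Modes

/-! ### The error of the Galerkin truncation -/

section Truncation

variable {L T M : ℝ} {μ : Measure ℝ} {c : ℝ → ℝ} {P : ℕ → ℝ[X]} {u : ℝ → ℝ → ℝ → ℝ}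

lemma IsModelSolution.perL2_gpcCoeff (hμ : ∀ᵐ y ∂μ, y ∈ Ioo (-1 : ℝ) 1)
    (hP : IsOrthonormalPolynomials μ P) [IsProbabilityMeasure μ]
    (hu : IsModelSolution L T μ c u) (n : ℕ) {t : ℝ} (ht : t ∈ Icc 0 T) :
    PerL2 L (gpcCoeff μ P u n t) := by
  refine ⟨fun x => integral_congr_ae ?_,
    memLp_expansion_coeff (w := fun x y => u x t y) hμ hP (hu.2 t ht) n⟩
  filter_upwards [hu.1] with y hy
  rw [show u (x + L) t y = u x t y from (hy.1 t ht).1 x]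

/-- Bessel's inequality for the Fourier coefficients of the weak derivative. -/
lemma sum_freq_sq_mul_coeff_sq_le {f : ℝ → ℝ} (hL : 0 < L) (hf : PerSobolev L 1 f)
    (F : Finset ℤ) :
    ∑ m ∈ F, freq L m ^ 2 * (cosCoeff L m f ^ 2 + sinCoeff L m f ^ 2) ≤ L * semi L 1 f ^ 2 := by
  have h := hasSum_sq_cosCoeff_add_sq_sinCoeff hL (weakDeriv_spec (hf.2 1 le_rfl)).1.2
  rw [← l2Norm_sq L hL.le] at h
  refine le_trans (le_of_eq ?_) (sum_le_hasSum F (fun m _ => by positivity) h)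
  refine Finset.sum_congr rfl fun m _ => ?_
  rw [(hf.coeff_weakDeriv hL m).1, (hf.coeff_weakDeriv hL m).2]
  ring

lemma IsModelSolution.integral_sq_eq (hL : 0 < L) (hu : IsModelSolution L T μ c u) {t : ℝ}
    (ht : t ∈ Icc 0 T) :
    ∫ y, (∫ x in (0 : ℝ)..L, u x t y ^ 2) ∂μ = ∫ y, (∫ x in (0 : ℝ)..L, u x 0 y ^ 2) ∂μ := by
  refine integral_congr_ae ?_
  filter_upwards [hu.1] with y hy using hy.integral_sq_eq hL ht

variable [IsProbabilityMeasure μ] {N : ℕ} {τ : ℝ}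

/-- The truncated parts of the Fourier modes of `∂ₓu` are controlled by the seminorms of the
neglected gPC coefficients. -/
lemma sum_freq_sq_mul_residual_le (hL : 0 < L) (hμ : ∀ᵐ y ∂μ, y ∈ Ioo (-1 : ℝ) 1)
    (hP : IsOrthonormalPolynomials μ P) (hu : IsModelSolution L T μ c u) {t : ℝ}
    (ht : t ∈ Icc 0 T) (hreg : ∀ n, PerSobolev L 1 (gpcCoeff μ P u (n + (N + 1)) t))
    (hτ : ∀ k, ∑ n ∈ Finset.range k, semi L 1 (gpcCoeff μ P u (n + (N + 1)) t) ^ 2 ≤ τ)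
    (F : Finset ℤ) :
    ∑ m ∈ F, freq L m ^ 2 *
      (((∫ y, (cosCoeff L m fun x => u x t y) ^ 2 ∂μ) - ∑ n : Fin (N + 1),
          (∫ y, (cosCoeff L m fun x => u x t y) * (P n).eval y ∂μ) ^ 2)
        + ((∫ y, (sinCoeff L m fun x => u x t y) ^ 2 ∂μ) - ∑ n : Fin (N + 1),
          (∫ y, (sinCoeff L m fun x => u x t y) * (P n).eval y ∂μ) ^ 2)) ≤ L * τ := by
  have hm : ∀ m ∈ F, HasSum (fun n => freq L m ^ 2 *
      (cosCoeff L m (gpcCoeff μ P u (n + (N + 1)) t) ^ 2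
        + sinCoeff L m (gpcCoeff μ P u (n + (N + 1)) t) ^ 2)) (freq L m ^ 2 *
      (((∫ y, (cosCoeff L m fun x => u x t y) ^ 2 ∂μ) - ∑ n : Fin (N + 1),
          (∫ y, (cosCoeff L m fun x => u x t y) * (P n).eval y ∂μ) ^ 2)
        + ((∫ y, (sinCoeff L m fun x => u x t y) ^ 2 ∂μ) - ∑ n : Fin (N + 1),
          (∫ y, (sinCoeff L m fun x => u x t y) * (P n).eval y ∂μ) ^ 2))) := by
    intro m _
    have h1 := (hasSum_nat_add_iff' (N + 1)).2
      (hasSum_sq_integral_mul hμ hP (hu.memLp_cosCoeff hL m ht))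
    have h2 := (hasSum_nat_add_iff' (N + 1)).2
      (hasSum_sq_integral_mul hμ hP (hu.memLp_sinCoeff hL m ht))
    simp only [cosCoeff_gpcCoeff hL hμ hu _ _ ht, sinCoeff_gpcCoeff hL hμ hu _ _ ht]
    rw [Finset.sum_range] at h1 h2
    exact (h1.add h2).mul_left _
  refine le_of_tendsto' (hasSum_sum hm).tendsto_sum_nat fun k => ?_
  calc _ ≤ ∑ n ∈ Finset.range k, L * semi L 1 (gpcCoeff μ P u (n + (N + 1)) t) ^ 2 :=
        Finset.sum_le_sum fun n _ => sum_freq_sq_mul_coeff_sq_le hL (hreg n) F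
    _ ≤ L * τ := by
        rw [← Finset.mul_sum]
        exact mul_le_mul_of_nonneg_left (hτ k) hL.le

/-- Galerkin projection and truncation. In finitely many Fourier modes the energy of the difference
between the exact and the Galerkin coefficients grows at most like `E' ≤ E + M² L τ`; as `E`
vanishes at time zero, Grönwall's inequality and Parseval's identity give a bound that is linear in
the tail `τ`. -/
lemma sum_integral_sq_sub_galerkin_le (hL : 0 < L) (hT : 0 < T)
    (hμ : ∀ᵐ y ∂μ, y ∈ Ioo (-1 : ℝ) 1) (hP : IsOrthonormalPolynomials μ P) (hc : Measurable c)
    (hM : ∀ᵐ y ∂μ, |c y| ≤ M) (hu : IsModelSolution L T μ c u)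
    {v : Fin (N + 1) → ℝ → ℝ → ℝ} (hv : IsSystemSolution L T (gpcMatrix μ c P N) v)
    (h0 : ∀ n, v n 0 =ᵐ[volume] gpcCoeff μ P u n 0)
    (hreg : ∀ t ∈ Icc 0 T, ∀ n, PerSobolev L 1 (gpcCoeff μ P u (n + (N + 1)) t))
    (hτ : ∀ t ∈ Icc 0 T, ∀ k,
      ∑ n ∈ Finset.range k, semi L 1 (gpcCoeff μ P u (n + (N + 1)) t) ^ 2 ≤ τ)
    {t : ℝ} (ht : t ∈ Icc 0 T) :
    ∑ n : Fin (N + 1), ∫ x in (0 : ℝ)..L, (gpcCoeff μ P u n t x - v n t x) ^ 2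
      ≤ t * Real.exp T * (M ^ 2 * τ) := by
  have hτ0 : 0 ≤ τ := by simpa using hτ t ht 0
  set ec : ℤ → Fin (N + 1) → ℝ → ℝ := fun m n t =>
    cosCoeff L m (gpcCoeff μ P u n t) - cosCoeff L m (v n t) with hec
  set es : ℤ → Fin (N + 1) → ℝ → ℝ := fun m n t =>
    sinCoeff L m (gpcCoeff μ P u n t) - sinCoeff L m (v n t) with hes
  have henergy : ∀ F : Finset ℤ, ∑ m ∈ F, ∑ n, (ec m n t ^ 2 + es m n t ^ 2)
      ≤ t * Real.exp T * (M ^ 2 * (L * τ)) := by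
    intro F
    have hdc := fun m (n : Fin (N + 1)) t (ht : t ∈ Icc 0 T) =>
      (hasDerivWithinAt_cosCoeff_gpcCoeff (P := P) hL hT hμ hc hM hu m n ht).sub
        (hv.hasDerivWithinAt_coeff hL m n ht).1
    have hds := fun m (n : Fin (N + 1)) t (ht : t ∈ Icc 0 T) =>
      (hasDerivWithinAt_sinCoeff_gpcCoeff (P := P) hL hT hμ hc hM hu m n ht).sub
        (hv.hasDerivWithinAt_coeff hL m n ht).2
    have hE := fun t ht => HasDerivWithinAt.fun_sum (u := F) fun m _ =>
      HasDerivWithinAt.fun_sum (u := Finset.univ) fun n _ =>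
        ((hdc m n t ht).pow 2).add ((hds m n t ht).pow 2)
    have hG := gronwall_add_const (R := M ^ 2 * (L * τ)) hE (fun t ht => ?_) t ht
    · have hz : ∑ m ∈ F, ∑ n, (ec m n 0 ^ 2 + es m n 0 ^ 2) = 0 := by
        refine Finset.sum_eq_zero fun m _ => Finset.sum_eq_zero fun n _ => ?_
        simp only [hec, hes]
        rw [cosCoeff_congr_ae (h0 n), sinCoeff_congr_ae (h0 n)]
        ring
      have hG' : ∑ m ∈ F, ∑ n, (ec m n t ^ 2 + es m n t ^ 2) + M ^ 2 * (L * τ)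
          ≤ Real.exp t * (∑ m ∈ F, ∑ n, (ec m n 0 ^ 2 + es m n 0 ^ 2) + M ^ 2 * (L * τ)) := hG
      rw [hz, zero_add] at hG'
      have h1 : Real.exp t - 1 ≤ t * Real.exp T := by
        have h2 := Real.add_one_le_exp (-t)
        have h3 : Real.exp t * Real.exp (-t) = 1 := by rw [← Real.exp_add]; simp
        have h4 := mul_le_mul_of_nonneg_left h2 (Real.exp_pos t).le
        have h5 : t * Real.exp t ≤ t * Real.exp T :=
          mul_le_mul_of_nonneg_left (Real.exp_le_exp.2 ht.2) ht.1
        linarith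
      have h6 := mul_le_mul_of_nonneg_right h1 (show 0 ≤ M ^ 2 * (L * τ) by positivity)
      linarith
    · have hmode := fun m => mode_energy_rate_le (N := N) hμ hP hc hM (hu.memLp_cosCoeff hL m ht)
        (hu.memLp_sinCoeff hL m ht) (fun n => cosCoeff L m (v n t))
        (fun n => sinCoeff L m (v n t)) (freq L m) (e := fun n => ec m n t)
        (s := fun n => es m n t)
        (fun n => by simp only [hec]; rw [cosCoeff_gpcCoeff hL hμ hu _ _ ht])
        (fun n => by simp only [hes]; rw [sinCoeff_gpcCoeff hL hμ hu _ _ ht])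
        (fun n => rfl) (fun n => rfl)
      have hsum := Finset.sum_le_sum fun m (_ : m ∈ F) => hmode m
      rw [Finset.sum_add_distrib] at hsum
      have hres := mul_le_mul_of_nonneg_left
        (sum_freq_sq_mul_residual_le hL hμ hP hu ht (hreg t ht) (hτ t ht) F) (sq_nonneg M)
      rw [Finset.mul_sum] at hres
      refine le_trans (le_of_eq ?_) (hsum.trans (add_le_add le_rfl (le_trans (le_of_eq ?_) hres)))
      · refine Finset.sum_congr rfl fun m _ => Finset.sum_congr rfl fun n _ => ?_
        simp only [hec, hes, Pi.sub_apply]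
        push_cast
        ring
      · exact Finset.sum_congr rfl fun m _ => by ring
  have hpars : HasSum (fun m => ∑ n, (ec m n t ^ 2 + es m n t ^ 2))
      (∑ n : Fin (N + 1), L * ∫ x in (0 : ℝ)..L, (gpcCoeff μ P u n t x - v n t x) ^ 2) := by
    refine hasSum_sum fun n _ => ?_
    have hg := hu.perL2_gpcCoeff hμ hP n ht
    have h := hasSum_sq_cosCoeff_add_sq_sinCoeff hL (hg.sub (hv.1 n t ht)).2
    convert! h using 2 with m
    rw [cosCoeff_sub hL hg (hv.1 n t ht), sinCoeff_sub hL hg (hv.1 n t ht)]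
  have h := hasSum_le_of_sum_le hpars henergy
  rw [← Finset.mul_sum] at h
  refine le_of_mul_le_mul_left (h.trans (le_of_eq ?_)) hL
  ring

/-- The part of the mean-square error that stems from the neglected gPC coefficients. -/
lemma integral_sq_sub_sum_gpcCoeff_le (hL : 0 < L) (hμ : ∀ᵐ y ∂μ, y ∈ Ioo (-1 : ℝ) 1)
    (hP : IsOrthonormalPolynomials μ P) (hu : IsModelSolution L T μ c u) {t : ℝ}
    (ht : t ∈ Icc 0 T)
    (hτ : ∀ k, ∑ n ∈ Finset.range k, l2Norm L (gpcCoeff μ P u (n + (N + 1)) t) ^ 2 ≤ τ) :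
    (∫ y, (∫ x in (0 : ℝ)..L, u x t y ^ 2) ∂μ)
      - ∑ n : Fin (N + 1), ∫ x in (0 : ℝ)..L, gpcCoeff μ P u n t x ^ 2 ≤ τ := by
  have h := (hasSum_nat_add_iff' (N + 1)).2
    (hasSum_integral_sq_expansion_coeff (w := fun x y => u x t y) hL hμ hP (hu.2 t ht))
  rw [Finset.sum_range] at h
  refine le_of_tendsto' h.tendsto_sum_nat fun k => le_trans (le_of_eq ?_) (hτ k)
  simp only [l2Norm_sq L hL.le]
  rfl

/-- Bessel's inequality for the gPC coefficients, integrated in space. -/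
lemma sum_integral_sq_gpcCoeff_le (hL : 0 < L) (hμ : ∀ᵐ y ∂μ, y ∈ Ioo (-1 : ℝ) 1)
    (hP : IsOrthonormalPolynomials μ P) (hu : IsModelSolution L T μ c u) {t : ℝ}
    (ht : t ∈ Icc 0 T) :
    ∑ n : Fin (N + 1), ∫ x in (0 : ℝ)..L, gpcCoeff μ P u n t x ^ 2
      ≤ ∫ y, (∫ x in (0 : ℝ)..L, u x t y ^ 2) ∂μ := by
  have h := sum_le_hasSum (Finset.range (N + 1)) (fun n _ =>
    intervalIntegral.integral_nonneg hL.le fun _ _ => sq_nonneg _)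
    (hasSum_integral_sq_expansion_coeff (w := fun x y => u x t y) hL hμ hP (hu.2 t ht))
  rwa [Finset.sum_range] at h

end Truncation

section Energy

variable {L T : ℝ} {N : ℕ} {S : Matrix (Fin (N + 1)) (Fin (N + 1)) ℝ}

/-- A system with an orthogonal diagonalization conserves the energy, because its characteristic
variables do. -/
lemma IsSystemSolution.sum_integral_sq_eq {A : Matrix (Fin (N + 1)) (Fin (N + 1)) ℝ}
    {lam : Fin (N + 1) → ℝ} {v : Fin (N + 1) → ℝ → ℝ → ℝ} (hL : 0 < L)
    (hv : IsSystemSolution L T A v) (hS : Sᵀ * S = 1) (hD : Sᵀ * A * S = Matrix.diagonal lam)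
    {t : ℝ} (ht : t ∈ Icc 0 T) :
    ∑ n, ∫ x in (0 : ℝ)..L, v n t x ^ 2 = ∑ n, ∫ x in (0 : ℝ)..L, v n 0 x ^ 2 := by
  have h : ∀ s ∈ Icc 0 T, ∑ n, ∫ x in (0 : ℝ)..L, DGgPC.charVar S v n s x ^ 2
      = ∑ n, ∫ x in (0 : ℝ)..L, v n s x ^ 2 := by
    intro s hs
    rw [← intervalIntegral.integral_finsetSum fun n _ =>
        (((hv.charVar hL hS hD n).1 s hs).sq_intervalIntegrable hL _ _),
      ← intervalIntegral.integral_finsetSum fun n _ => (hv.1 n s hs).sq_intervalIntegrable hL _ _]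
    exact intervalIntegral.integral_congr fun x _ =>
      sum_sq_orthogonal_transpose hS fun l => v l s x
  rw [← h t ht, ← h 0 ⟨le_rfl, ht.1.trans ht.2⟩]
  exact Finset.sum_congr rfl fun n _ => (hv.charVar hL hS hD n).integral_sq_eq hL ht

end Energy

/-! ### The mean-square error -/

section MeanSquare

/-- Comparison of the tail of the series `∑ n^{-2m}` with an integral. -/
lemma sum_rpow_inv_le {m : ℝ} (hm : 1 < 2 * m) {N : ℕ} (hN : 1 ≤ N) (k : ℕ) :
    ∑ n ∈ Finset.range k, 1 / ((n + (N + 1) : ℕ) : ℝ) ^ (2 * m)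
      ≤ 1 / ((2 * m - 1) * (N : ℝ) ^ (2 * m - 1)) := by
  have hN0 : (0 : ℝ) < N := by exact_mod_cast hN
  have hanti : AntitoneOn (fun x : ℝ => x ^ (-(2 * m))) (Icc (N : ℝ) (N + k)) := by
    intro x hx y _ hxy
    exact Real.rpow_le_rpow_of_nonpos (hN0.trans_le hx.1) hxy (by linarith)
  have h := hanti.sum_le_integral
  have hb : (0 : ℝ) < N + k := by positivity
  have h0 : (0 : ℝ) ∉ uIcc (N : ℝ) (N + k) := by
    rw [uIcc_of_le (by linarith [(Nat.cast_nonneg k : (0 : ℝ) ≤ k)])]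
    exact fun h => absurd h.1 (not_le.2 hN0)
  rw [integral_rpow (Or.inr ⟨by linarith, h0⟩)] at h
  have hexp : -(2 * m) + 1 = -(2 * m - 1) := by ring
  rw [hexp, Real.rpow_neg hN0.le, Real.rpow_neg hb.le] at h
  refine le_trans (le_of_eq ?_) (h.trans ?_)
  · refine Finset.sum_congr rfl fun n _ => ?_
    rw [one_div, ← Real.rpow_neg (by positivity)]
    congr 1
    push_cast
    ring
  · have h1 : (0 : ℝ) < (N : ℝ) ^ (2 * m - 1) := by positivity
    have h2 : (0 : ℝ) < ((N : ℝ) + k) ^ (2 * m - 1) := by positivity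
    have h3 : (0 : ℝ) < 2 * m - 1 := by linarith
    rw [div_neg, ← neg_div, neg_sub, mul_comm (2 * m - 1), ← div_div, one_div]
    exact div_le_div_of_nonneg_right (by linarith [inv_pos.2 h2]) h3.le

variable {L T M : ℝ} {μ : Measure ℝ} {c : ℝ → ℝ} {P : ℕ → ℝ[X]} {u : ℝ → ℝ → ℝ → ℝ}

lemma DecayCondition.sum_h1NormSq_le {m K₀ : ℝ} {n₀ : ℕ} (hd : DecayCondition L T μ P u m n₀ K₀)
    (hm : 1 < 2 * m) {N : ℕ} (hN : 1 ≤ N) (hn : n₀ ≤ N) {t : ℝ} (ht : t ∈ Icc 0 T) (k : ℕ) :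
    ∑ n ∈ Finset.range k, h1NormSq L (gpcCoeff μ P u (n + (N + 1)) t)
      ≤ |K₀| / ((2 * m - 1) * (N : ℝ) ^ (2 * m - 1)) := by
  calc _ ≤ ∑ n ∈ Finset.range k, |K₀| * (1 / ((n + (N + 1) : ℕ) : ℝ) ^ (2 * m)) := by
        refine Finset.sum_le_sum fun n _ => ((hd _ (by omega) t ht).2).trans ?_
        rw [← mul_one_div]
        exact mul_le_mul_of_nonneg_right (le_abs_self _) (by positivity)
    _ ≤ |K₀| * (1 / ((2 * m - 1) * (N : ℝ) ^ (2 * m - 1))) := by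
        rw [← Finset.mul_sum]
        exact mul_le_mul_of_nonneg_left (sum_rpow_inv_le hm hN k) (abs_nonneg _)
    _ = _ := mul_one_div _ _

lemma sum_integral_sq_sub_le {N : ℕ} (hL : 0 < L) {f g d : Fin (N + 1) → ℝ → ℝ}
    (hf : ∀ n, MemLp (f n) 2 (volume.restrict (Ioc 0 L)))
    (hg : ∀ n, MemLp (g n) 2 (volume.restrict (Ioc 0 L)))
    (hd : ∀ n, MemLp (d n) 2 (volume.restrict (Ioc 0 L))) :
    ∑ n, ∫ x in (0 : ℝ)..L, (f n x - d n x) ^ 2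
      ≤ 2 * (∑ n, ∫ x in (0 : ℝ)..L, (f n x - g n x) ^ 2)
        + 2 * ∑ n, ∫ x in (0 : ℝ)..L, (g n x - d n x) ^ 2 := by
  have hi : ∀ {w : ℝ → ℝ}, MemLp w 2 (volume.restrict (Ioc 0 L)) →
      IntervalIntegrable (fun x => w x ^ 2) volume 0 L := fun hw =>
    (intervalIntegrable_iff_integrableOn_Ioc_of_le hL.le).2 hw.integrable_sq
  rw [Finset.mul_sum, Finset.mul_sum, ← Finset.sum_add_distrib]
  refine Finset.sum_le_sum fun n _ => ?_
  have i1 : IntervalIntegrable (fun x => 2 * (f n x - g n x) ^ 2) volume 0 L :=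
    (hi ((hf n).sub (hg n))).const_mul 2
  have i2 : IntervalIntegrable (fun x => 2 * (g n x - d n x) ^ 2) volume 0 L :=
    (hi ((hg n).sub (hd n))).const_mul 2
  rw [← intervalIntegral.integral_const_mul, ← intervalIntegral.integral_const_mul,
    ← intervalIntegral.integral_add i1 i2]
  refine intervalIntegral.integral_mono_on hL.le (hi ((hf n).sub (hd n))) (i1.add i2)
    fun x _ => ?_
  nlinarith [sq_nonneg (f n x - g n x - (g n x - d n x))]

variable [IsProbabilityMeasure μ] {N k : ℕ} {𝒯 : Mesh L} {v : Fin (N + 1) → ℝ → ℝ → ℝ}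
  {S : Matrix (Fin (N + 1)) (Fin (N + 1)) ℝ} {lam : Fin (N + 1) → ℝ}
  {qh : Fin (N + 1) → ℝ → 𝒯.Broken}

/-- The mean-square error splits into the neglected part of the expansion, the error of the
Galerkin truncation and the error of the DG method. -/
lemma meanSquareError_le (hL : 0 < L) (hμ : ∀ᵐ y ∂μ, y ∈ Ioo (-1 : ℝ) 1)
    (hP : IsOrthonormalPolynomials μ P) (hu : IsModelSolution L T μ c u) {t : ℝ}
    (ht : t ∈ Icc 0 T) (hv : ∀ n, PerL2 L (v n t)) :
    meanSquareError μ P u S qh t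
      ≤ ((∫ y, (∫ x in (0 : ℝ)..L, u x t y ^ 2) ∂μ)
          - ∑ n : Fin (N + 1), ∫ x in (0 : ℝ)..L, gpcCoeff μ P u n t x ^ 2)
        + 2 * (∑ n : Fin (N + 1), ∫ x in (0 : ℝ)..L, (gpcCoeff μ P u n t x - v n t x) ^ 2)
        + 2 * ∑ n, ∫ x in (0 : ℝ)..L, (v n t x - dgCoeff S qh n t x) ^ 2 := by
  have h := integral_integral_sq_sub_expansion (w := fun x y => u x t y) hL hμ hP (hu.2 t ht)
    (d := fun n => dgCoeff S qh n t) fun n => memLp_dgCoeff n t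
  have h2 := sum_integral_sq_sub_le hL (f := fun n => gpcCoeff μ P u n t) (g := fun n => v n t)
    (d := fun n => dgCoeff S qh n t) (fun n => (hu.perL2_gpcCoeff hμ hP n ht).2)
    (fun n => (hv n).2) fun n => memLp_dgCoeff n t
  unfold meanSquareError
  simp only [l2Norm_sq L hL.le]
  rw [h, add_assoc]
  exact add_le_add le_rfl h2

/-- Without any decay the energy bounds the part of the error that is not due to the DG method. The
exact and the Galerkin coefficients have at most the energy `E` of the solution, hence their
difference has at most `4 E`, and the neglected part at most `E`. -/
lemma IsDGgPC.truncation_le_energy (hL : 0 < L) (hμ : ∀ᵐ y ∂μ, y ∈ Ioo (-1 : ℝ) 1)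
    (hP : IsOrthonormalPolynomials μ P) (hu : IsModelSolution L T μ c u)
    (h : IsDGgPC T k N μ c P u 𝒯 v S lam qh) {t : ℝ} (ht : t ∈ Icc 0 T) :
    ((∫ y, (∫ x in (0 : ℝ)..L, u x t y ^ 2) ∂μ)
        - ∑ n : Fin (N + 1), ∫ x in (0 : ℝ)..L, gpcCoeff μ P u n t x ^ 2)
      + 2 * (∑ n : Fin (N + 1), ∫ x in (0 : ℝ)..L, (gpcCoeff μ P u n t x - v n t x) ^ 2)
      ≤ 9 * ∫ y, (∫ x in (0 : ℝ)..L, u x 0 y ^ 2) ∂μ := by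
  have h0 : (0 : ℝ) ∈ Icc 0 T := ⟨le_rfl, ht.1.trans ht.2⟩
  have e1 := sum_integral_sq_gpcCoeff_le (N := N) hL hμ hP hu ht
  have e2 := sum_integral_sq_gpcCoeff_le (N := N) hL hμ hP hu h0
  rw [hu.integral_sq_eq hL ht] at e1 ⊢
  have e3 := h.galerkin.sum_integral_sq_eq hL h.orthogonal h.diagonal ht
  have e4 : ∑ n, ∫ x in (0 : ℝ)..L, v n 0 x ^ 2
      = ∑ n : Fin (N + 1), ∫ x in (0 : ℝ)..L, gpcCoeff μ P u n 0 x ^ 2 := by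
    refine Finset.sum_congr rfl fun n _ => intervalIntegral.integral_congr_ae ?_
    filter_upwards [h.initial n] with x hx _
    rw [hx]
  have e5 := sum_integral_sq_sub_le hL (f := fun n : Fin (N + 1) => gpcCoeff μ P u n t)
    (g := fun _ _ => 0) (d := fun n => v n t) (fun n => (hu.perL2_gpcCoeff hμ hP n ht).2)
    (fun _ => MemLp.zero) fun n => (h.galerkin.1 n t ht).2
  have e6 : 0 ≤ ∑ n : Fin (N + 1), ∫ x in (0 : ℝ)..L, gpcCoeff μ P u n t x ^ 2 :=
    Finset.sum_nonneg fun n _ => intervalIntegral.integral_nonneg hL.le fun _ _ => sq_nonneg _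
  simp only [sub_zero, zero_sub, neg_sq] at e5
  linarith

/-- The part of the error that is not due to the DG method decays with `N`. For large `N` and
`m > 1/2` this follows from the decay of the gPC coefficients; in the remaining cases `N^{2m-1}` is
bounded, and the conservation of energy suffices. -/
lemma exists_truncation_bound (hL : 0 < L) (hμ : ∀ᵐ y ∂μ, y ∈ Ioo (-1 : ℝ) 1)
    (hP : IsOrthonormalPolynomials μ P) (hc : Measurable c) (hM : ∀ᵐ y ∂μ, |c y| ≤ M)
    (hu : IsModelSolution L T μ c u) {m K₀ : ℝ} {n₀ : ℕ}
    (hd : DecayCondition L T μ P u m n₀ K₀) {t₀ : ℝ} (ht₀ : t₀ ∈ Ioc 0 T) :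
    ∃ K : ℝ, 0 < K ∧ ∀ (k N : ℕ) (𝒯 : Mesh L) (v : Fin (N + 1) → ℝ → ℝ → ℝ)
      (S : Matrix (Fin (N + 1)) (Fin (N + 1)) ℝ) (lam : Fin (N + 1) → ℝ)
      (qh : Fin (N + 1) → ℝ → 𝒯.Broken), 1 ≤ N → IsDGgPC T k N μ c P u 𝒯 v S lam qh →
      ∀ t ∈ Icc t₀ T,
        ((∫ y, (∫ x in (0 : ℝ)..L, u x t y ^ 2) ∂μ)
            - ∑ n : Fin (N + 1), ∫ x in (0 : ℝ)..L, gpcCoeff μ P u n t x ^ 2)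
          + 2 * (∑ n : Fin (N + 1), ∫ x in (0 : ℝ)..L, (gpcCoeff μ P u n t x - v n t x) ^ 2)
        ≤ K * t / (N : ℝ) ^ (2 * m - 1) := by
  have hT : 0 < T := ht₀.1.trans_le ht₀.2
  set E : ℝ := ∫ y, (∫ x in (0 : ℝ)..L, u x 0 y ^ 2) ∂μ with hE
  have hE0 : 0 ≤ E := integral_nonneg fun y =>
    intervalIntegral.integral_nonneg hL.le fun _ _ => sq_nonneg _
  set B : ℝ := 1 + (n₀ : ℝ) ^ (2 * m - 1) with hB
  have hB0 : 0 < B := by positivity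
  -- For `m = 1/2` the quotient in `K₁` is zero by convention; `K₁` is used for `m > 1/2` only.
  set K₁ : ℝ := |K₀ / (2 * m - 1)| * (1 / t₀ + 2 * (Real.exp T * M ^ 2)) with hK₁
  set K₂ : ℝ := 9 * E * B / t₀ with hK₂
  have hp : 0 < t₀ := ht₀.1
  have hK₁0 : 0 ≤ K₁ := by positivity
  have hK₂0 : 0 ≤ K₂ := by positivity
  refine ⟨K₁ + K₂ + 1, by positivity, fun k N 𝒯 v S lam qh hN h t ht => ?_⟩
  have htI : t ∈ Icc 0 T := ⟨hp.le.trans ht.1, ht.2⟩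
  have hN0 : (0 : ℝ) < N := by exact_mod_cast hN
  have hN1 : (1 : ℝ) ≤ N := by exact_mod_cast hN
  have hX : 0 < (N : ℝ) ^ (2 * m - 1) := by positivity
  have htt : 1 ≤ t / t₀ := (one_le_div hp).2 ht.1
  by_cases hcase : 1 < 2 * m ∧ n₀ ≤ N
  · have hm : 0 < 2 * m - 1 := by linarith [hcase.1]
    set τ : ℝ := |K₀| / ((2 * m - 1) * (N : ℝ) ^ (2 * m - 1)) with hτ
    have hτ0 : 0 ≤ τ := by positivity
    have hsum := fun s (hs : s ∈ Icc 0 T) => hd.sum_h1NormSq_le hcase.1 hN hcase.2 hs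
    have h1 := integral_sq_sub_sum_gpcCoeff_le (N := N) (τ := τ) hL hμ hP hu htI fun k =>
      (Finset.sum_le_sum fun n _ => le_add_of_nonneg_right (sq_nonneg _)).trans (hsum t htI k)
    have h2 := sum_integral_sq_sub_galerkin_le (τ := τ) hL hT hμ hP hc hM hu h.galerkin h.initial
      (fun s hs n => (hd _ (by omega) s hs).1) (fun s hs k =>
        (Finset.sum_le_sum fun n _ => le_add_of_nonneg_left (sq_nonneg _)).trans (hsum s hs k)) htI
    have h3 : τ = |K₀ / (2 * m - 1)| / (N : ℝ) ^ (2 * m - 1) := by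
      rw [abs_div, abs_of_pos hm, div_div]
    have h4 : τ ≤ t / t₀ * τ := le_mul_of_one_le_left hτ0 htt
    calc _ ≤ t / t₀ * τ + 2 * (t * Real.exp T * (M ^ 2 * τ)) := by linarith
      _ = K₁ * t / (N : ℝ) ^ (2 * m - 1) := by rw [h3, hK₁]; ring
      _ ≤ _ := by
        have := htI.1
        gcongr
        linarith
  · have hXB : (N : ℝ) ^ (2 * m - 1) ≤ B := by
      have hn : 0 ≤ (n₀ : ℝ) ^ (2 * m - 1) := by positivity
      rcases le_or_gt (2 * m) 1 with hm | hm
      · have := Real.rpow_le_one_of_one_le_of_nonpos hN1 (show 2 * m - 1 ≤ 0 by linarith)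
        linarith
      · have hlt : N ≤ n₀ := by
          by_contra hlt
          exact hcase ⟨hm, by omega⟩
        have := Real.rpow_le_rpow hN0.le (show (N : ℝ) ≤ n₀ by exact_mod_cast hlt)
          (show 0 ≤ 2 * m - 1 by linarith)
        linarith
    have h1 := h.truncation_le_energy hL hμ hP hu htI
    calc _ ≤ 9 * E := h1
      _ ≤ 9 * E * (t / t₀ * (B / (N : ℝ) ^ (2 * m - 1))) := by
        refine le_mul_of_one_le_right (by positivity) ?_
        exact one_le_mul_of_one_le_of_one_le htt ((one_le_div hX).2 hXB)
      _ = K₂ * t / (N : ℝ) ^ (2 * m - 1) := by rw [hK₂]; field_simp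
      _ ≤ _ := by
        have := htI.1
        gcongr
        linarith

end MeanSquare

end DGgPC

open DGgPC

theorem mainTheorem3 (L T M : ℝ) (hL : 0 < L) (hT : 0 < T) :
    ∃ C : ℕ → ℝ, (∀ k, 0 < C k) ∧
      ∀ (α β : ℝ), 0 < α → 0 < β →
      ∀ c : ℝ → ℝ, Measurable c → (∀ y ∈ Set.Ioo (-1 : ℝ) 1, |c y| ≤ M) →
      ∀ P : ℕ → Polynomial ℝ, DGgPC.IsOrthonormalPolynomials (DGgPC.yLaw α β) P →
      ∀ u : ℝ → ℝ → ℝ → ℝ, DGgPC.IsModelSolution L T (DGgPC.yLaw α β) c u →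
      (∀ (k N : ℕ) (𝒯 : DGgPC.Mesh L) (v : Fin (N + 1) → ℝ → ℝ → ℝ)
          (S : Matrix (Fin (N + 1)) (Fin (N + 1)) ℝ) (lam : Fin (N + 1) → ℝ)
          (qh : Fin (N + 1) → ℝ → 𝒯.Broken),
          DGgPC.IsDGgPC T k N (DGgPC.yLaw α β) c P u 𝒯 v S lam qh →
          ∀ t ∈ Set.Icc 0 T, ∀ n : Fin (N + 1),
            DGgPC.l2Norm L (fun x => DGgPC.charVar S v n t x - 𝒯.toFun (qh n t) x)
                ≤ C k * DGgPC.semi L (k + 2) (DGgPC.charVar S v n 0) * 𝒯.size ^ (k + 1) ∧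
            DGgPC.l2Norm L (fun x => v n t x - DGgPC.dgCoeff S qh n t x)
                ≤ C k * DGgPC.vecSemi L (k + 2) (fun l => v l 0) * 𝒯.size ^ (k + 1)) ∧
      (∀ (m : ℝ) (n₀ : ℕ) (K₀ : ℝ), 0 < m →
          DGgPC.DecayCondition L T (DGgPC.yLaw α β) P u m n₀ K₀ →
          ∀ t₀ ∈ Set.Ioc 0 T, ∃ K : ℝ, 0 < K ∧
          ∀ (k N : ℕ) (𝒯 : DGgPC.Mesh L) (v : Fin (N + 1) → ℝ → ℝ → ℝ)
            (S : Matrix (Fin (N + 1)) (Fin (N + 1)) ℝ) (lam : Fin (N + 1) → ℝ)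
            (qh : Fin (N + 1) → ℝ → 𝒯.Broken), 1 ≤ N →
            DGgPC.IsDGgPC T k N (DGgPC.yLaw α β) c P u 𝒯 v S lam qh →
            ∀ t ∈ Set.Icc t₀ T,
              DGgPC.meanSquareError (DGgPC.yLaw α β) P u S qh t
                ≤ C k * DGgPC.vecSemi L (k + 2) (fun l => v l 0) ^ 2 * 𝒯.size ^ (2 * (k + 1))
                  + K * t / (N : ℝ) ^ (2 * m - 1)) := by
  choose C₁ hC₁ hbound using fun k => exists_dg_error_bound (L := L) (T := T) (M := M) hL hT k
  -- The first summand serves the linear estimates, the second one the mean-square estimate.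
  refine ⟨fun k => C₁ k + 2 * C₁ k ^ 2, fun k => by have := hC₁ k; positivity, ?_⟩
  intro α β hα hβ c hc hM P hP u hu
  have := isProbabilityMeasure_yLaw hα hβ
  refine ⟨fun k N 𝒯 v S lam qh h t ht n => ?_, fun m n₀ K₀ _ hd t₀ ht₀ => ?_⟩
  · have hk := hC₁ k
    have hs : 0 ≤ 𝒯.size := 𝒯.size_pos.le
    have hle : C₁ k ≤ C₁ k + 2 * C₁ k ^ 2 := le_add_of_nonneg_right (by positivity)
    obtain ⟨h1, h2⟩ := h.error_le hL hT hα hβ hc hM hP (hbound k) ht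
    have hsemi : 0 ≤ semi L (k + 2) (charVar S v n 0) := l2Norm_nonneg
    have hvec : 0 ≤ vecSemi L (k + 2) (fun l => v l 0) := Real.sqrt_nonneg _
    exact ⟨(h1 n).trans (by gcongr), (IsDGgPC.coeff_error_le hL hk.le n h2).trans (by gcongr)⟩
  · obtain ⟨K, hK, hKb⟩ := exists_truncation_bound hL ae_mem_Ioo_yLaw hP hc
      (ae_abs_le_of_forall_Ioo hM) hu hd ht₀
    refine ⟨K, hK, fun k N 𝒯 v S lam qh hN h t ht => ?_⟩
    have htI : t ∈ Icc 0 T := ⟨ht₀.1.le.trans ht.1, ht.2⟩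
    have hk := hC₁ k
    have hs : 0 ≤ 𝒯.size := 𝒯.size_pos.le
    have h1 := meanSquareError_le (S := S) (qh := qh) hL ae_mem_Ioo_yLaw hP hu htI
      fun n => h.galerkin.1 n t htI
    have h2 := hKb k N 𝒯 v S lam qh hN h t ht
    have h3 := (h.error_le hL hT hα hβ hc hM hP (hbound k) htI).2
    have h4 : 0 ≤ C₁ k * vecSemi L (k + 2) (fun l => v l 0) ^ 2 * 𝒯.size ^ (2 * (k + 1)) := by
      positivity
    simp only [add_mul]
    linarith
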